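/- An arc-weighted directed graph $(G,w)$ consists of a simple directed graph $G=(V,A)$ (no loops, no parallel arcs, opposite arcs allowed) with $n=|V|$ and a weight function $w\colon A\to\mathbb{N}$; let $w_{\max}$ be its largest arc weight. For an ordering $\pi$ of the vertices, i.e. a bijection $\pi\colon V\to\{1,\dots,n\}$, let $\mathrm{cut}_\pi^i=\{(u,v)\in A : \pi(u)>i \text{ and } \pi(v)\le i\}$. In weighted Directed Optimal Linear Arrangement one is given $(G,w)$ and is asked for an ordering $\pi$ minimizing $$\mathrm{val}(\pi)=\sum_{i=1}^{n-1}\ \sum_{e\in \mathrm{cut}_\pi^i} w(e).$$ Let $\omega$ be the matrix-multiplication exponent, i.e. the infimum of all real $\tau$ such that the rank of the tensor of $N\times N$ matrix multiplication over $\mathbb{Q}$ is $O(N^\tau)$. Running times are measured on random-access machines with logarithmic cost (arithmetic on a number is charged its binary length), and $O^*$ hides factors polynomial in the input size, that is, polynomial in $n$ and $\log w_{\max}$. Since $\omega$ is an infimum, a running time with $\omega$ in the exponent is understood, as usual, as a running time with $\tau$ in place of $\omega$ for every fixed $\tau>\omega$. **Proposition.** For each constant $0<\alpha<1$ there is a $\left(1+\frac{1}{1-\alpha}\right)$-approximation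 algorithm for weighted Directed Optimal Linear Arrangement that runs in $O^*\!\left(2^{\frac{\omega n}{3}}+2^{(1-\frac{\alpha}{4})n}\right)$ time. That is, for all real $\alpha$ with $0<\alpha<1$ and all real $\tau>\omega$, there are a (deterministic) program and constants $C,c\in\mathbb{N}$ such that on every input $(G,w)$ the program halts within time $$C\,(n+\ell(w_{\max})+1)^{c}\left(2^{\tau n/3}+2^{(1-\alpha/4)n}\right),$$ where $\ell(w_{\max})$ is the binary length of $w_{\max}$ (and $w_{\max}=0$ if there are no arcs), and outputs an ordering $\pi$ with $\mathrm{val}(\pi)\le\left(1+\frac{1}{1-\alpha}\right)\mathrm{val}(\sigma)$ for every ordering $\sigma$. -/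

import Mathlib

namespace DirectedOLA

/-! ### The matrix-multiplication exponent -/

/-- Multiplication of `n × n` matrices over `ℚ` is a sum of `r` products of a linear form in the
entries of the first factor and a linear form in the entries of the second factor; that is, the
matrix-multiplication tensor `⟨n,n,n⟩` over `ℚ` has rank at most `r`. -/
def HasBilinearAlgorithm (n r : ℕ) : Prop :=
  ∃ (f g : Fin r → (Matrix (Fin n) (Fin n) ℚ →ₗ[ℚ] ℚ)) (W : Fin r → Matrix (Fin n) (Fin n) ℚ),
    ∀ X Y : Matrix (Fin n) (Fin n) ℚ, X * Y = ∑ t, (f t X * g t Y) • W t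

/-- The rank of the `n × n` matrix-multiplication tensor over `ℚ`. -/
noncomputable def matMulRank (n : ℕ) : ℕ := sInf {r | HasBilinearAlgorithm n r}

/-- The matrix-multiplication exponent `ω`: the infimum of all `τ` such that the rank of
`n × n` matrix multiplication is `O(n ^ τ)`. -/
noncomputable def matMulExponent : ℝ :=
  sInf {τ : ℝ | (fun n : ℕ => (matMulRank n : ℝ)) =O[Filter.atTop] fun n : ℕ => (n : ℝ) ^ τ}

/-! ### Random-access machines with logarithmic cost -/

/-- The four arithmetic instructions on natural numbers. Subtraction is truncated at `0`,
division rounds down, and division by `0` gives `0`. -/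
inductive BinOp
  | add | sub | mul | div

/-- The value of an arithmetic instruction. -/
def BinOp.eval : BinOp → ℕ → ℕ → ℕ
  | .add, a, b => a + b
  | .sub, a, b => a - b
  | .mul, a, b => a * b
  | .div, a, b => a / b

/-- The memory of a machine: registers, and arrays with random access. A fixed program names only
finitely many registers and arrays. -/
structure State where
  reg : ℕ → ℕ
  mem : ℕ → ℕ → ℕ

/-- Expressions; `read j e` is the entry of array `j` at the address given by `e`. -/
inductive Expr
  | const (c : ℕ)
  | reg (i : ℕ)
  | read (j : ℕ) (e : Expr)
  | op (o : BinOp) (e f : Expr)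

/-- The value of an expression. -/
def Expr.eval (s : State) : Expr → ℕ
  | .const c => c
  | .reg i => s.reg i
  | .read j e => s.mem j (e.eval s)
  | .op o e f => o.eval (e.eval s) (f.eval s)

/-- The logarithmic cost of evaluating an expression: every number that is produced on the way,
addresses included, is charged its binary length plus one. -/
def Expr.cost (s : State) : Expr → ℕ
  | .const c => c.size + 1
  | .reg i => (s.reg i).size + 1
  | .read j e => e.cost s + (s.mem j (e.eval s)).size + 1
  | .op o e f => e.cost s + f.cost s + (o.eval (e.eval s) (f.eval s)).size + 1

/-- Programs: `assign i e` puts the value of `e` into register `i`, `write j a e` puts the value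
of `e` into array `j` at address `a`, and a condition counts as true if its value is nonzero. -/
inductive Program
  | skip
  | assign (i : ℕ) (e : Expr)
  | write (j : ℕ) (a e : Expr)
  | seq (p q : Program)
  | cond (e : Expr) (p q : Program)
  | loop (e : Expr) (p : Program)

/-- The state after an assignment to a register. -/
def State.setReg (s : State) (i x : ℕ) : State :=
  { s with reg := Function.update s.reg i x }

/-- The state after writing an array entry. -/
def State.setMem (s : State) (j a x : ℕ) : State :=
  { s with mem := Function.update s.mem j (Function.update (s.mem j) a x) }

/-- `Exec p s s' t`: started in state `s`, the program `p` halts in state `s'` after time `t`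
(under the logarithmic cost measure). -/
inductive Exec : Program → State → State → ℕ → Prop
  | skip (s : State) : Exec .skip s s 1
  | assign (i : ℕ) (e : Expr) (s : State) :
      Exec (.assign i e) s (s.setReg i (e.eval s)) (e.cost s + 1)
  | write (j : ℕ) (a e : Expr) (s : State) :
      Exec (.write j a e) s (s.setMem j (a.eval s) (e.eval s)) (a.cost s + e.cost s + 1)
  | seq {p q : Program} {s s₁ s₂ : State} {t₁ t₂ : ℕ} :
      Exec p s s₁ t₁ → Exec q s₁ s₂ t₂ → Exec (.seq p q) s s₂ (t₁ + t₂)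
  | condTrue {e : Expr} {p q : Program} {s s' : State} {t : ℕ} :
      e.eval s ≠ 0 → Exec p s s' t → Exec (.cond e p q) s s' (e.cost s + t + 1)
  | condFalse {e : Expr} {p q : Program} {s s' : State} {t : ℕ} :
      e.eval s = 0 → Exec q s s' t → Exec (.cond e p q) s s' (e.cost s + t + 1)
  | loopStep {e : Expr} {p : Program} {s s₁ s₂ : State} {t₁ t₂ : ℕ} :
      e.eval s ≠ 0 → Exec p s s₁ t₁ → Exec (.loop e p) s₁ s₂ t₂ →
        Exec (.loop e p) s s₂ (e.cost s + t₁ + t₂ + 1)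
  | loopDone {e : Expr} {p : Program} {s : State} :
      e.eval s = 0 → Exec (.loop e p) s s (e.cost s + 1)

/-- Programs are deterministic: final state and running time are determined by the start. -/
theorem Exec.deterministic {p : Program} {s s₁ s₂ : State} {t₁ t₂ : ℕ}
    (h₁ : Exec p s s₁ t₁) (h₂ : Exec p s s₂ t₂) : s₁ = s₂ ∧ t₁ = t₂ := by
  induction h₁ generalizing s₂ t₂ with
  | skip | assign | write => cases h₂; exact ⟨rfl, rfl⟩
  | seq _ _ ih₁ ih₂ =>
    cases h₂ with
    | seq k₁ k₂ =>
      obtain ⟨rfl, rfl⟩ := ih₁ k₁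
      obtain ⟨rfl, rfl⟩ := ih₂ k₂
      exact ⟨rfl, rfl⟩
  | condTrue he _ ih =>
    cases h₂ with
    | condTrue _ k => obtain ⟨rfl, rfl⟩ := ih k; exact ⟨rfl, rfl⟩
    | condFalse k _ => exact absurd k he
  | condFalse he _ ih =>
    cases h₂ with
    | condTrue k _ => exact absurd he k
    | condFalse _ k => obtain ⟨rfl, rfl⟩ := ih k; exact ⟨rfl, rfl⟩
  | loopStep he _ _ ih₁ ih₂ =>
    cases h₂ with
    | loopStep _ k₁ k₂ =>
      obtain ⟨rfl, rfl⟩ := ih₁ k₁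
      obtain ⟨rfl, rfl⟩ := ih₂ k₂
      exact ⟨rfl, rfl⟩
    | loopDone k => exact absurd k he
  | loopDone he =>
    cases h₂ with
    | loopStep k _ _ => exact absurd he k
    | loopDone _ => exact ⟨rfl, rfl⟩

/-! ### Weighted Directed Optimal Linear Arrangement -/

/-- An arc-weighted simple directed graph with vertex set `Fin n`. Values of `weight` at pairs
that are not arcs are never used. -/
structure WeightedDigraph (n : ℕ) where
  arcs : Finset (Fin n × Fin n)
  loopless : ∀ v, (v, v) ∉ arcs
  weight : Fin n × Fin n → ℕ

/-- The position in `{1, …, n}` of a vertex in an ordering. -/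
def position {n : ℕ} (π : Equiv.Perm (Fin n)) (v : Fin n) : ℕ := (π v : ℕ) + 1

namespace WeightedDigraph

variable {n : ℕ}

/-- The largest weight of an arc (`0` if there are no arcs). -/
def maxWeight (G : WeightedDigraph n) : ℕ := G.arcs.sup G.weight

/-- The cut at position `i`: all arcs from a vertex after position `i` to a vertex at position
at most `i`. -/
def cut (G : WeightedDigraph n) (π : Equiv.Perm (Fin n)) (i : ℕ) : Finset (Fin n × Fin n) :=
  G.arcs.filter fun a => i < position π a.1 ∧ position π a.2 ≤ i

/-- The objective value of an ordering: the total weight of the cuts at positions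
`1, …, n - 1`. -/
def olaCost (G : WeightedDigraph n) (π : Equiv.Perm (Fin n)) : ℕ :=
  ∑ i ∈ Finset.Icc 1 (n - 1), ∑ a ∈ G.cut π i, G.weight a

/-- The entry of row-major `n × n` matrix `M` at address `k`, and `0` beyond the matrix. -/
def rowMajor (M : Fin n × Fin n → ℕ) (k : ℕ) : ℕ :=
  if h : k < n * n then M (finProdFinEquiv.symm ⟨k, h⟩) else 0

/-- The initial memory on input `G`: register `0` holds `n`, array `0` the adjacency matrix,
array `1` the weight matrix (with `0` for pairs that are not arcs); all else is `0`. -/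
def inputState (G : WeightedDigraph n) : State where
  reg i := if i = 0 then n else 0
  mem j :=
    if j = 0 then rowMajor fun a => if a ∈ G.arcs then 1 else 0
    else if j = 1 then rowMajor fun a => if a ∈ G.arcs then G.weight a else 0
    else fun _ => 0

end WeightedDigraph

/-- The state `s` holds the ordering `π` as output: array `2` lists the positions of the
vertices. -/
def Outputs {n : ℕ} (s : State) (π : Equiv.Perm (Fin n)) : Prop :=
  ∀ v : Fin n, s.mem 2 v = position π v

/-- The program `p` is a `ρ`-approximation algorithm for weighted Directed Optimal Linear
Arrangement with running time `O*(T n)`: on every input it halts within time `T n` times a fixed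
polynomial in the number of vertices and the binary length of the largest weight, and it outputs
an ordering whose value is at most `ρ` times the value of any ordering. -/
def ApproximatesOLA (p : Program) (ρ : ℝ) (T : ℕ → ℝ) : Prop :=
  ∃ C c : ℕ, ∀ (n : ℕ) (G : WeightedDigraph n),
    ∃ (s : State) (t : ℕ) (π : Equiv.Perm (Fin n)),
      Exec p G.inputState s t ∧
      (t : ℝ) ≤ C * ((n : ℝ) + G.maxWeight.size + 1) ^ c * T n ∧
      Outputs s π ∧
      ∀ σ : Equiv.Perm (Fin n), (G.olaCost π : ℝ) ≤ ρ * G.olaCost σ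

end DirectedOLA

/-!
The algorithm computes, by exhaustive search over the first `m = n - k` vertices and a minimum cut
for each of the `2 ^ m` choices, a vertex set `Z` that minimizes the weight of the arcs from `Z` to
its complement among all sets that are balanced on the first `m` vertices. It then orders both sides
optimally by dynamic programming over subsets. With `k` about `α n / 4` up to `α n / 3` this takes
time `O*(2 ^ ((1 - α / 4) n))`, so that the matrix-multiplication term of the bound is not needed.
-/

namespace DirectedOLA

open DirectedOLA.Program DirectedOLA.Expr

/-! ### Time-bounded execution with bounded memory -/

/-! Put q = ⌈3/α⌉, k = ⌊(n - 1)/q⌋ and m = n - k, and call a vertex set balanced if it contains at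
least k of the first m vertices and misses at least k of them. Along any ordering, the set of
vertices after position i shrinks from everything to nothing, one vertex at a time. It is unbalanced
only near the two ends, and the k vertices outside the first m can lengthen these stretches by at
most k positions in total. So at least n - 1 - 3k of the cuts in the objective are cuts of balanced
sets, and if `best` is the least weight of arcs leaving a balanced set, every ordering costs at
least (n - 1 - 3k) · best (`mul_le_orderCost`).

Conversely, let Z attain `best`, order the complement of Z and Z itself optimally, and put the
complement first. The arcs inside the two sides cost together at most what any ordering pays for
them, arcs from the complement into Z cost nothing, and an arc from Z to the complement is counted
at most n - 1 times (`orderCost_concat_le`). So the output costs at most OPT + (n - 1) · best. Since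
3k ≤ α(n - 1), the second term is at most OPT/(1 - α).

For the running time, the trace of Z on the first m vertices is one of 2^m masks. Given the trace,
the k free vertices are placed optimally by a minimum cut with the trace as sources and the other
first m vertices as sinks; capacity scaling makes this polynomial (`runs_minCut`, `runs_bestCut`).
Balance leaves at most n - k = m vertices on each side of Z, so the subset dynamic programs
(`table_le_sum_cutSum`, `runs_solve`) also take 2^m steps up to polynomial factors. As αq ≤ 4, the
number 2^m is at most 4 · 2^((1 - α/4)n).

The machine model enters through `Runs b p T s Q`: T counts evaluation steps, every stored number
stays below 2^b, and the factor `p.unit * (b + 2)` pays for the logarithmic cost. Values kept by a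
program are tracked by the syntactic frame condition `Agrees`. -/

/-- All numbers stored in the memory have at most `b` binary digits. -/
def Bounded (b : ℕ) (s : State) : Prop :=
  (∀ i, s.reg i < 2 ^ b) ∧ ∀ j a, s.mem j a < 2 ^ b

instance : Add Expr := ⟨Expr.op .add⟩
instance : Sub Expr := ⟨Expr.op .sub⟩
instance : Mul Expr := ⟨Expr.op .mul⟩
instance : Div Expr := ⟨Expr.op .div⟩
instance : Zero Expr := ⟨Expr.const 0⟩
instance : One Expr := ⟨Expr.const 1⟩

namespace Expr

variable (s : State) (e f : Expr)

@[simp] theorem eval_zero : (0 : Expr).eval s = 0 := rfl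
@[simp] theorem eval_one : (1 : Expr).eval s = 1 := rfl
@[simp] theorem eval_const (c : ℕ) : (const c).eval s = c := rfl
@[simp] theorem eval_reg (i : ℕ) : (Expr.reg i).eval s = s.reg i := rfl
@[simp] theorem eval_read (j : ℕ) : (read j e).eval s = s.mem j (e.eval s) := rfl
@[simp] theorem eval_add : (e + f).eval s = e.eval s + f.eval s := rfl
@[simp] theorem eval_sub : (e - f).eval s = e.eval s - f.eval s := rfl
@[simp] theorem eval_mul : (e * f).eval s = e.eval s * f.eval s := rfl
@[simp] theorem eval_div : (e / f).eval s = e.eval s / f.eval s := rfl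

/-- The remainder of a division, as an expression. -/
def rem (e f : Expr) : Expr := e - e / f * f

@[simp] theorem eval_rem : (rem e f).eval s = e.eval s % f.eval s := by
  rw [rem, eval_sub, eval_mul, eval_div, Nat.mod_eq_sub_div_mul]

/-- The size of an expression. -/
def weight : Expr → ℕ
  | .const c => c.size + 1
  | .reg _ => 1
  | .read _ e => e.weight + 1
  | .op _ e f => e.weight + f.weight + 1

end Expr

theorem BinOp.size_eval_le (o : BinOp) (x y : ℕ) : (o.eval x y).size ≤ x.size + y.size + 1 := by
  have hx := Nat.lt_size_self x
  have hy := Nat.lt_size_self y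
  cases o with
  | add =>
    refine Nat.size_le.2 ?_
    have h1 : 2 ^ x.size ≤ 2 ^ (x.size + y.size) := Nat.pow_le_pow_right two_pos (by omega)
    have h2 : 2 ^ y.size ≤ 2 ^ (x.size + y.size) := Nat.pow_le_pow_right two_pos (by omega)
    rw [pow_succ]
    simp only [BinOp.eval]
    omega
  | sub => exact (Nat.size_le_size (Nat.sub_le x y)).trans (by omega)
  | mul =>
    refine Nat.size_le.2 ?_
    simp only [BinOp.eval]
    calc x * y < 2 ^ x.size * 2 ^ y.size := Nat.mul_lt_mul'' hx hy
      _ = 2 ^ (x.size + y.size) := (pow_add _ _ _).symm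
      _ ≤ _ := Nat.pow_le_pow_right two_pos (by omega)
  | div => exact (Nat.size_le_size (Nat.div_le_self x y)).trans (by omega)

namespace Expr

theorem size_eval_le {b : ℕ} {s : State} (hs : Bounded b s) (e : Expr) :
    (e.eval s).size ≤ e.weight * (b + 1) := by
  induction e with
  | const c => simp only [eval_const, weight]; nlinarith
  | reg i => simpa [weight] using (Nat.size_le.2 (hs.1 i)).trans (Nat.le_succ b)
  | read j e ih =>
    refine (Nat.size_le.2 (hs.2 j _)).trans ?_
    simp only [weight]; nlinarith
  | op o e f ihe ihf =>
    refine (o.size_eval_le _ _).trans ?_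
    simp only [weight]; nlinarith

/-- Each node of the expression has a value of length linear in its weight times b, and the number
of nodes is at most the weight; hence the square. -/
theorem cost_le {b : ℕ} {s : State} (hs : Bounded b s) (e : Expr) :
    e.cost s ≤ e.weight ^ 2 * (b + 2) := by
  have key : ∀ e : Expr, (e.eval s).size + 1 ≤ e.weight * (b + 1) + 1 := fun e =>
    Nat.succ_le_succ (e.size_eval_le hs)
  induction e with
  | const c => simp only [cost, weight]; nlinarith
  | reg i =>
    have := key (.reg i)
    simp only [cost, weight, eval_reg] at *; omega
  | read j e ih =>
    have := Nat.size_le.2 (hs.2 j (e.eval s))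
    simp only [cost, weight] at *
    nlinarith [Nat.zero_le (e.weight * b)]
  | op o e f ihe ihf =>
    have := key (.op o e f)
    simp only [cost, weight, Expr.eval] at *
    nlinarith [Nat.zero_le (e.weight * b), Nat.zero_le (f.weight * b),
      Nat.zero_le (e.weight * f.weight), Nat.zero_le (e.weight * f.weight * b)]

end Expr

namespace Program

/-- A bound for the total cost of evaluating each expression in a program once. -/
def unit : Program → ℕ
  | .skip => 1
  | .assign _ e => e.weight ^ 2 + 1
  | .write _ a e => a.weight ^ 2 + e.weight ^ 2 + 1
  | .seq p q => p.unit + q.unit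
  | .cond e p q => e.weight ^ 2 + 1 + p.unit + q.unit
  | .loop e p => e.weight ^ 2 + 1 + p.unit

/-- The program does not assign to register `r`. -/
def keepsReg (r : ℕ) : Program → Bool
  | .skip => true
  | .assign i _ => i != r
  | .write _ _ _ => true
  | .seq p q => p.keepsReg r && q.keepsReg r
  | .cond _ p q => p.keepsReg r && q.keepsReg r
  | .loop _ p => p.keepsReg r

/-- The program does not write to array `j`. -/
def keepsMem (j : ℕ) : Program → Bool
  | .skip => true
  | .assign _ _ => true
  | .write i _ _ => i != j
  | .seq p q => p.keepsMem j && q.keepsMem j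
  | .cond _ p q => p.keepsMem j && q.keepsMem j
  | .loop _ p => p.keepsMem j

/-- The two states agree on all registers and arrays that the program does not modify. -/
def Agrees (p : Program) (s s' : State) : Prop :=
  (∀ r, p.keepsReg r = true → s'.reg r = s.reg r) ∧
    ∀ j, p.keepsMem j = true → s'.mem j = s.mem j

theorem Agrees.refl (p : Program) (s : State) : p.Agrees s s := ⟨fun _ _ => rfl, fun _ _ => rfl⟩

theorem Agrees.trans {p : Program} {s s' s'' : State} (h : p.Agrees s s') (h' : p.Agrees s' s'') :
    p.Agrees s s'' :=
  ⟨fun r hr => (h'.1 r hr).trans (h.1 r hr), fun j hj => (h'.2 j hj).trans (h.2 j hj)⟩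

infixr:60 " ;; " => Program.seq

/-- Run `p` for the values `0, …, N - 1` of register `i`, where `N` is the content of
register `N`. -/
def forTo (i N : ℕ) (p : Program) : Program :=
  assign i 0 ;; loop (Expr.reg N - Expr.reg i) (p ;; assign i (Expr.reg i + 1))

end Program

namespace State

variable (s : State) (i j a x r : ℕ)

@[simp] theorem reg_setReg : (s.setReg i x).reg r = if r = i then x else s.reg r := by
  simp [setReg, Function.update_apply]

@[simp] theorem mem_setReg : (s.setReg i x).mem = s.mem := rfl

@[simp] theorem reg_setMem : (s.setMem j a x).reg = s.reg := rfl

theorem mem_setMem (j' a' : ℕ) :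
    (s.setMem j a x).mem j' a' = if j' = j ∧ a' = a then x else s.mem j' a' := by
  simp only [setMem, Function.update_apply]
  by_cases h : j' = j
  · subst h; by_cases h' : a' = a <;> simp [h']
  · simp [h]

@[simp] theorem mem_setMem_same (a' : ℕ) :
    (s.setMem j a x).mem j a' = if a' = a then x else s.mem j a' := by
  simp [mem_setMem]

theorem mem_setMem_of_ne {j' : ℕ} (h : j' ≠ j) : (s.setMem j a x).mem j' = s.mem j' := by
  funext a'; simp [mem_setMem, h]

end State

/-- The frame rule. Which registers and arrays a program leaves alone is computed from its text, so
for concrete programs each preservation claim reduces to `rfl`. -/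
theorem Exec.agrees {p : Program} {s s' : State} {t : ℕ} (h : Exec p s s' t) : p.Agrees s s' := by
  induction h with
  | skip => exact .refl _ _
  | assign i e s =>
    refine ⟨fun r hr => ?_, fun _ _ => rfl⟩
    simp only [keepsReg, bne_iff_ne] at hr
    simp [Ne.symm hr]
  | write j a e s =>
    refine ⟨fun _ _ => rfl, fun i hi => ?_⟩
    simp only [keepsMem, bne_iff_ne] at hi
    exact s.mem_setMem_of_ne _ _ _ (Ne.symm hi)
  | seq _ _ h₁ h₂ =>
    refine ⟨fun r hr => ?_, fun r hr => ?_⟩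
    · simp only [keepsReg, Bool.and_eq_true] at hr
      rw [h₂.1 r hr.2, h₁.1 r hr.1]
    · simp only [keepsMem, Bool.and_eq_true] at hr
      rw [h₂.2 r hr.2, h₁.2 r hr.1]
  | condTrue _ _ h =>
    refine ⟨fun r hr => ?_, fun r hr => ?_⟩
    · simp only [keepsReg, Bool.and_eq_true] at hr
      exact h.1 r hr.1
    · simp only [keepsMem, Bool.and_eq_true] at hr
      exact h.2 r hr.1
  | condFalse _ _ h =>
    refine ⟨fun r hr => ?_, fun r hr => ?_⟩
    · simp only [keepsReg, Bool.and_eq_true] at hr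
      exact h.1 r hr.2
    · simp only [keepsMem, Bool.and_eq_true] at hr
      exact h.2 r hr.2
  | loopStep _ _ _ h₁ h₂ =>
    refine ⟨fun r hr => ?_, fun r hr => ?_⟩
    · rw [h₂.1 r hr, h₁.1 r hr]
    · rw [h₂.2 r hr, h₁.2 r hr]
  | loopDone => exact .refl _ _

/-- Started in `s`, the program `p` halts after at most `T` steps, up to the cost of evaluating
expressions, with numbers of at most `b` binary digits, in a state with property `Q`. -/
def Runs (b : ℕ) (p : Program) (T : ℕ) (s : State) (Q : State → Prop) : Prop :=
  Bounded b s → ∃ s' t, Exec p s s' t ∧ Bounded b s' ∧ t ≤ T * p.unit * (b + 2) ∧ Q s'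

namespace Runs

variable {b T T₁ T₂ : ℕ} {p q : Program} {s : State} {Q R : State → Prop}

theorem of_bounded (h : Bounded b s → Runs b p T s Q) : Runs b p T s Q := fun hs => h hs hs

/-- Besides weakening the bounds, this hands the frame condition to the new postcondition. -/
theorem mono (h : Runs b p T₁ s R) (hT : T₁ ≤ T₂) (hQ : ∀ s', p.Agrees s s' → R s' → Q s') :
    Runs b p T₂ s Q := by
  intro hs
  obtain ⟨s', t, he, hb, ht, hR⟩ := h hs
  refine ⟨s', t, he, hb, ht.trans ?_, hQ s' he.agrees hR⟩
  gcongr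

theorem skip (h : Q s) : Runs b .skip 1 s Q := fun hs =>
  ⟨s, 1, .skip s, hs, by simp [unit], h⟩

theorem assign {i : ℕ} {e : Expr} (hb : Bounded b s → e.eval s < 2 ^ b)
    (h : Q (s.setReg i (e.eval s))) : Runs b (.assign i e) 1 s Q := by
  intro hs
  refine ⟨_, _, .assign i e s, ⟨fun r => ?_, hs.2⟩, ?_, h⟩
  · rw [State.reg_setReg]; split_ifs
    exacts [hb hs, hs.1 r]
  · have := e.cost_le hs
    simp only [unit]; nlinarith

theorem write {j : ℕ} {a e : Expr} (hb : Bounded b s → e.eval s < 2 ^ b)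
    (h : Q (s.setMem j (a.eval s) (e.eval s))) : Runs b (.write j a e) 1 s Q := by
  intro hs
  refine ⟨_, _, .write j a e s, ⟨hs.1, fun i r => ?_⟩, ?_, h⟩
  · rw [State.mem_setMem]; split_ifs
    exacts [hb hs, hs.2 i r]
  · have := e.cost_le hs
    have := a.cost_le hs
    simp only [unit]; nlinarith

theorem seq (h₁ : Runs b p T₁ s R) (h₂ : ∀ s', p.Agrees s s' → R s' → Runs b q T₂ s' Q) :
    Runs b (p ;; q) (T₁ + T₂) s Q := by
  intro hs
  obtain ⟨s₁, t₁, e₁, b₁, l₁, r₁⟩ := h₁ hs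
  obtain ⟨s₂, t₂, e₂, b₂, l₂, r₂⟩ := h₂ s₁ e₁.agrees r₁ b₁
  refine ⟨s₂, _, .seq e₁ e₂, b₂, ?_, r₂⟩
  calc t₁ + t₂ ≤ T₁ * p.unit * (b + 2) + T₂ * q.unit * (b + 2) := add_le_add l₁ l₂
    _ ≤ T₁ * (p.unit + q.unit) * (b + 2) + T₂ * (p.unit + q.unit) * (b + 2) := by
      gcongr <;> omega
    _ = _ := by simp only [unit]; ring

theorem assign_seq {i : ℕ} {e : Expr} (hb : Bounded b s → e.eval s < 2 ^ b)
    (h : Runs b q T (s.setReg i (e.eval s)) Q) : Runs b (.assign i e ;; q) (1 + T) s Q :=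
  seq (R := fun s' => s' = s.setReg i (e.eval s)) (assign hb rfl) fun _ _ h' => h' ▸ h

theorem write_seq {j : ℕ} {a e : Expr} (hb : Bounded b s → e.eval s < 2 ^ b)
    (h : Runs b q T (s.setMem j (a.eval s) (e.eval s)) Q) :
    Runs b (.write j a e ;; q) (1 + T) s Q :=
  seq (R := fun s' => s' = s.setMem j (a.eval s) (e.eval s)) (write hb rfl) fun _ _ h' => h' ▸ h

theorem cond {e : Expr} (h₁ : e.eval s ≠ 0 → Runs b p T s Q)
    (h₂ : e.eval s = 0 → Runs b q T s Q) : Runs b (.cond e p q) (1 + T) s Q := by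
  intro hs
  have hc := e.cost_le hs
  by_cases he : e.eval s = 0
  · obtain ⟨s', t, ex, hb, ht, hQ⟩ := h₂ he hs
    refine ⟨s', _, .condFalse he ex, hb, ?_, hQ⟩
    simp only [unit]
    nlinarith [Nat.zero_le (T * (e.weight ^ 2 + 1 + p.unit) * (b + 2)),
      Nat.zero_le ((p.unit + q.unit) * (b + 2))]
  · obtain ⟨s', t, ex, hb, ht, hQ⟩ := h₁ he hs
    refine ⟨s', _, .condTrue he ex, hb, ?_, hQ⟩
    simp only [unit]
    nlinarith [Nat.zero_le (T * (e.weight ^ 2 + 1 + q.unit) * (b + 2)),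
      Nat.zero_le ((p.unit + q.unit) * (b + 2))]

/-- `I v s` means that the loop invariant holds and at most `v` iterations are left. -/
theorem loop {e : Expr} (I : ℕ → State → Prop) (v : ℕ) (h : I v s)
    (step : ∀ v s', p.Agrees s s' → I v s' → e.eval s' ≠ 0 →
      Runs b p T s' fun s'' => ∃ v' < v, I v' s'')
    (hQ : ∀ v s', p.Agrees s s' → I v s' → e.eval s' = 0 → Q s') :
    Runs b (.loop e p) (v * (T + 1) + 1) s Q := by
  suffices H : ∀ v s', p.Agrees s s' → I v s' → Runs b (.loop e p) (v * (T + 1) + 1) s' Q from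
    H v s (.refl _ _) h
  intro v
  induction v using Nat.strong_induction_on with
  | _ v ih =>
    intro s' ha hI hs
    have hc := e.cost_le hs
    by_cases he : e.eval s' = 0
    · refine ⟨s', _, .loopDone he, hs, ?_, hQ v s' ha hI he⟩
      simp only [unit]
      nlinarith [Nat.zero_le (v * (T + 1) * (e.weight ^ 2 + 1 + p.unit) * (b + 2)),
        Nat.zero_le (p.unit * (b + 2))]
    · obtain ⟨s₁, t₁, e₁, b₁, l₁, v', hv', hI'⟩ := step v s' ha hI he hs
      obtain ⟨s₂, t₂, e₂, b₂, l₂, r₂⟩ := ih v' hv' s₁ (ha.trans e₁.agrees) hI' b₁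
      refine ⟨s₂, _, .loopStep he e₁ e₂, b₂, ?_, r₂⟩
      simp only [unit] at l₂ ⊢
      have hv : v' * (T + 1) + (T + 1) ≤ v * (T + 1) := by nlinarith
      calc e.cost s' + t₁ + t₂ + 1
          ≤ e.weight ^ 2 * (b + 2) + T * p.unit * (b + 2)
            + (v' * (T + 1) + 1) * (e.weight ^ 2 + 1 + p.unit) * (b + 2) + 1 := by omega
        _ ≤ (T + 1) * (e.weight ^ 2 + 1 + p.unit) * (b + 2)
            + (v' * (T + 1) + 1) * (e.weight ^ 2 + 1 + p.unit) * (b + 2) := by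
          nlinarith [Nat.zero_le (T * (e.weight ^ 2 + 1) * (b + 2)),
            Nat.zero_le (p.unit * (b + 2))]
        _ = (v' * (T + 1) + (T + 1) + 1) * (e.weight ^ 2 + 1 + p.unit) * (b + 2) := by ring
        _ ≤ _ := by gcongr

/-- A round costs T for the body, one step for the increment and one for the test; the
initialization and the last test give the final 2. The invariant must not depend on the counter
register, because the increment changes it after the body; the body sees the counter only through
the separate hypothesis `s'.reg i = j`. -/
theorem forTo {i rN : ℕ} (N : ℕ) (I : ℕ → State → Prop) (hi : p.keepsReg i = true)
    (hN : (Program.forTo i rN p).keepsReg rN = true) (hs : s.reg rN = N)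
    (hI : ∀ j s' x, I j s' → I j (s'.setReg i x)) (h0 : I 0 s)
    (step : ∀ j < N, ∀ s', (Program.forTo i rN p).Agrees s s' → s'.reg i = j → I j s' →
      Runs b p T s' (I (j + 1)))
    (hQ : ∀ s', (Program.forTo i rN p).Agrees s s' → I N s' → Q s') :
    Runs b (Program.forTo i rN p) (N * (T + 2) + 2) s Q := by
  have hne : rN ≠ i := by
    rintro rfl
    simp [Program.forTo, keepsReg] at hN
  have ha0 : (Program.forTo i rN p).Agrees s (s.setReg i 0) := by
    refine ⟨fun r hr => ?_, fun _ _ => rfl⟩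
    have : r ≠ i := by rintro rfl; simp [Program.forTo, keepsReg] at hr
    simp [this]
  refine of_bounded fun hb => ?_
  have hb2 : 0 < 2 ^ b := by positivity
  refine (assign_seq (T := N * (T + 1 + 1) + 1) (fun _ => hb2) ?_).mono (by
    ring_nf; omega) fun _ _ h => h
  refine loop (fun v s' => (Program.forTo i rN p).Agrees s s' ∧
    ∃ j, j + v = N ∧ s'.reg i = j ∧ I j s') N ⟨ha0, 0, by simp, by simp, hI _ _ _ h0⟩ ?_ ?_
  · rintro v s' ha ⟨ha', j, hj, hr, hIj⟩ he
    have hN' : s'.reg rN = N := (ha'.1 rN hN).trans hs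
    have hjN : j < N := by
      simp only [eval_sub, eval_reg, hN', hr] at he
      omega
    refine seq (step j hjN s' ha' hr hIj) fun s₁ a₁ h₁ => ?_
    have hr₁ : s₁.reg i = j := (a₁.1 i hi).trans hr
    refine assign (fun _ => ?_) ?_
    · have := hb.1 rN
      simp only [eval_add, eval_reg, eval_one, hr₁]
      omega
    · refine ⟨v - 1, by omega, ?_, j + 1, by omega, by simp [hr₁], hI _ _ _ h₁⟩
      refine ha'.trans (Agrees.trans (s' := s₁) ⟨fun r hr => ?_, fun r hr => ?_⟩
        ⟨fun r hr => ?_, fun _ _ => rfl⟩)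
      · simp only [Program.forTo, keepsReg, Bool.and_eq_true] at hr
        exact a₁.1 r hr.2.1
      · simp only [Program.forTo, keepsMem, Bool.and_eq_true] at hr
        exact a₁.2 r hr.2.1
      · have : r ≠ i := by rintro rfl; simp [Program.forTo, keepsReg] at hr
        simp [this]
  · rintro v s' - ⟨ha', j, hj, hr, hIj⟩ he
    have hN' : s'.reg rN = N := (ha'.1 rN hN).trans hs
    simp only [eval_sub, eval_reg, hN', hr] at he
    obtain rfl : j = N := by omega
    exact hQ s' ha' hIj

end Runs

/-! ### Cuts and orderings -/

open Classical in
/-- The total weight of the pairs in `{0, …, n - 1}` leading from `Z` to its complement. -/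
noncomputable def cutSum (n : ℕ) (W : ℕ → ℕ → ℕ) (Z : ℕ → Prop) : ℕ :=
  ∑ u ∈ Finset.range n, ∑ v ∈ Finset.range n, if Z u ∧ ¬Z v then W u v else 0

theorem cutSum_congr {n : ℕ} {W W' : ℕ → ℕ → ℕ} {Z Z' : ℕ → Prop}
    (hW : ∀ u < n, ∀ v < n, W u v = W' u v) (h : ∀ v < n, (Z v ↔ Z' v)) :
    cutSum n W Z = cutSum n W' Z' := by
  refine Finset.sum_congr rfl fun u hu => Finset.sum_congr rfl fun v hv => ?_
  rw [Finset.mem_range] at hu hv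
  rw [hW u hu v hv]
  split_ifs with h1 h2 h2
  · rfl
  · rw [h u hu, h v hv] at h1; exact absurd h1 h2
  · rw [← h u hu, ← h v hv] at h2; exact absurd h2 h1
  · rfl

theorem cutSum_eq_zero_of_forall {n : ℕ} {W : ℕ → ℕ → ℕ} {Z : ℕ → Prop} (h : ∀ v < n, Z v) :
    cutSum n W Z = 0 := by
  refine Finset.sum_eq_zero fun u _ => Finset.sum_eq_zero fun v hv => ?_
  rw [if_neg fun h' => h'.2 (h v (Finset.mem_range.1 hv))]

theorem cutSum_eq_zero_of_forall_not {n : ℕ} {W : ℕ → ℕ → ℕ} {Z : ℕ → Prop}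
    (h : ∀ v < n, ¬Z v) : cutSum n W Z = 0 := by
  refine Finset.sum_eq_zero fun u hu => Finset.sum_eq_zero fun v _ => ?_
  rw [if_neg fun h' => h u (Finset.mem_range.1 hu) h'.1]

theorem sum_range_mul_eq {M : Type*} [AddCommMonoid M] (a b : ℕ) (f : ℕ → M) :
    ∑ e ∈ Finset.range (a * b), f e =
      ∑ i ∈ Finset.range a, ∑ j ∈ Finset.range b, f (i * b + j) := by
  induction a with
  | zero => simp
  | succ a ih => rw [Nat.succ_mul, Finset.sum_range_add, ih, Finset.sum_range_succ]

open Classical in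
theorem cutSum_eq_sum_range_mul (n : ℕ) (W : ℕ → ℕ → ℕ) (Z : ℕ → Prop) :
    cutSum n W Z =
      ∑ e ∈ Finset.range (n * n), if Z (e / n) ∧ ¬Z (e % n) then W (e / n) (e % n) else 0 := by
  rw [sum_range_mul_eq, cutSum]
  refine Finset.sum_congr rfl fun u _ => Finset.sum_congr rfl fun v hv => ?_
  rw [Finset.mem_range] at hv
  have hn : 0 < n := by omega
  rw [mul_comm u n, Nat.mul_add_div hn, Nat.div_eq_of_lt hv, Nat.mul_add_mod, Nat.mod_eq_of_lt hv]
  simp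

/-- The objective value of the ordering with positions `p`. -/
noncomputable def orderCost (n : ℕ) (W : ℕ → ℕ → ℕ) (p : ℕ → ℕ) : ℕ :=
  ∑ i ∈ Finset.Icc 1 (n - 1), cutSum n W fun v => i < p v

/-- Array `1` of the input holds 0 at pairs that are not arcs, so summing over all pairs equals
summing over arcs. From here on only the matrix matters. -/
theorem WeightedDigraph.olaCost_eq_orderCost {n : ℕ} (G : WeightedDigraph n)
    (π : Equiv.Perm (Fin n)) (p : ℕ → ℕ) (hp : ∀ v : Fin n, p v = position π v) :
    G.olaCost π = orderCost n (fun u v => G.inputState.mem 1 (u * n + v)) p := by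
  refine Finset.sum_congr rfl fun i _ => ?_
  classical
  have key : ∀ f : Fin n × Fin n → ℕ, ∑ a ∈ G.arcs, f a = ∑ a, if a ∈ G.arcs then f a else 0 :=
    fun f => by simp
  rw [cut, Finset.sum_filter, key, Fintype.sum_prod_type, cutSum, Finset.sum_range]
  refine Finset.sum_congr rfl fun u _ => ?_
  rw [Finset.sum_range]
  refine Finset.sum_congr rfl fun v _ => ?_
  have hlt : (u : ℕ) * n + v < n * n := by nlinarith [u.2, v.2]
  have he : finProdFinEquiv.symm ⟨(u : ℕ) * n + v, hlt⟩ = (u, v) := by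
    rw [Equiv.symm_apply_eq, Fin.ext_iff]
    simp only [finProdFinEquiv, Equiv.coe_fn_mk]
    ring
  have hw : G.inputState.mem 1 (u * n + v) = if (u, v) ∈ G.arcs then G.weight (u, v) else 0 := by
    rw [← he, ← dif_pos (c := (u : ℕ) * n + v < n * n) (e := fun _ => 0) hlt (t := fun h =>
      if finProdFinEquiv.symm ⟨(u : ℕ) * n + v, h⟩ ∈ G.arcs
        then G.weight (finProdFinEquiv.symm ⟨(u : ℕ) * n + v, h⟩) else 0)]
    rfl
  simp only [hw, hp, not_lt]
  by_cases h1 : (u, v) ∈ G.arcs <;> simp [h1]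

/-- A numbering of `{0, …, n - 1}` by positions `1, …, n`. -/
structure IsOrdering (n : ℕ) (p : ℕ → ℕ) : Prop where
  pos : ∀ v < n, 1 ≤ p v
  le : ∀ v < n, p v ≤ n
  inj : ∀ u < n, ∀ v < n, p u = p v → u = v

theorem isOrdering_of_perm {n : ℕ} (π : Equiv.Perm (Fin n)) (p : ℕ → ℕ)
    (hp : ∀ v : Fin n, p v = position π v) : IsOrdering n p where
  pos v hv := by rw [hp ⟨v, hv⟩, position]; omega
  le v hv := by rw [hp ⟨v, hv⟩, position]; omega
  inj u hu v hv h := by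
    rw [hp ⟨u, hu⟩, hp ⟨v, hv⟩, position, position] at h
    simpa [Fin.ext_iff] using π.injective (Fin.ext (Nat.succ_injective h))

theorem IsOrdering.exists_perm {n : ℕ} {p : ℕ → ℕ} (h : IsOrdering n p) :
    ∃ π : Equiv.Perm (Fin n), ∀ v : Fin n, p v = position π v := by
  have hlt : ∀ v : Fin n, p v - 1 < n := fun v => by
    have := h.le v v.2
    have := h.pos v v.2
    omega
  have hinj : Function.Injective fun v : Fin n => (⟨p v - 1, hlt v⟩ : Fin n) := by
    intro u v huv
    have h1 := h.pos u u.2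
    have h2 := h.pos v v.2
    simp only [Fin.mk.injEq] at huv
    exact Fin.ext (h.inj u u.2 v v.2 (by omega))
  refine ⟨Equiv.ofBijective _ (Finite.injective_iff_bijective.1 hinj), fun v => ?_⟩
  have := h.pos v v.2
  simp only [position, Equiv.ofBijective_apply]
  omega

open Classical in
/-- The number of elements below `m` with property `Z`. -/
noncomputable def countBelow (m : ℕ) (Z : ℕ → Prop) : ℕ := ((Finset.range m).filter Z).card

theorem IsOrdering.image_range {n : ℕ} {p : ℕ → ℕ} (h : IsOrdering n p) :
    (Finset.range n).image p = Finset.Icc 1 n := by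
  refine Finset.eq_of_subset_of_card_le (fun x hx => ?_) ?_
  · obtain ⟨v, hv, rfl⟩ := Finset.mem_image.1 hx
    rw [Finset.mem_range] at hv
    exact Finset.mem_Icc.2 ⟨h.pos v hv, h.le v hv⟩
  · rw [Finset.card_image_of_injOn fun u hu v hv => h.inj u (by simpa using hu) v (by simpa using hv)]
    simp

/-- The vertices at positions after `i`. -/
theorem IsOrdering.countBelow_lt {n : ℕ} {p : ℕ → ℕ} (h : IsOrdering n p) (i : ℕ) :
    countBelow n (fun v => i < p v) = n - i := by
  classical
  rw [countBelow, ← Finset.card_image_of_injOn (f := p) fun u hu v hv => h.inj u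
    (by simp at hu; exact hu.1) v (by simp at hv; exact hv.1)]
  refine (congrArg Finset.card (a₂ := Finset.Icc (i + 1) n) ?_).trans (by rw [Nat.card_Icc]; omega)
  ext x
  simp only [Finset.mem_image, Finset.mem_filter, Finset.mem_range, Finset.mem_Icc]
  constructor
  · rintro ⟨v, ⟨hv, hi⟩, rfl⟩
    exact ⟨hi, h.le v hv⟩
  · rintro ⟨h1, h2⟩
    have : x ∈ (Finset.range n).image p := by
      rw [h.image_range]; exact Finset.mem_Icc.2 ⟨by omega, h2⟩
    obtain ⟨v, hv, rfl⟩ := Finset.mem_image.1 this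
    exact ⟨v, ⟨Finset.mem_range.1 hv, h1⟩, rfl⟩

theorem countBelow_add_card {m n : ℕ} (hmn : m ≤ n) (Z : ℕ → Prop) [DecidablePred Z] :
    countBelow n Z = countBelow m Z + ((Finset.Ico m n).filter Z).card := by
  classical
  rw [countBelow, countBelow, ← Finset.card_union_of_disjoint]
  · congr 1
    ext x
    simp only [Finset.mem_filter, Finset.mem_range, Finset.mem_union, Finset.mem_Ico]
    by_cases Z x <;> simp [*]
    omega
  · rw [Finset.disjoint_left]
    simp only [Finset.mem_filter, Finset.mem_range, Finset.mem_Ico]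
    omega

theorem countBelow_mono {m : ℕ} {Z Z' : ℕ → Prop} (h : ∀ v < m, Z v → Z' v) :
    countBelow m Z ≤ countBelow m Z' := by
  classical
  refine Finset.card_le_card fun v hv => ?_
  simp only [Finset.mem_filter, Finset.mem_range] at hv ⊢
  exact ⟨hv.1, h v hv.1 hv.2⟩

theorem countBelow_congr {m : ℕ} {Z Z' : ℕ → Prop} (h : ∀ v < m, (Z v ↔ Z' v)) :
    countBelow m Z = countBelow m Z' :=
  le_antisymm (countBelow_mono fun v hv => (h v hv).1) (countBelow_mono fun v hv => (h v hv).2)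

theorem countBelow_of_forall {m : ℕ} {Z : ℕ → Prop} (h : ∀ v < m, Z v) : countBelow m Z = m := by
  classical
  rw [countBelow, Finset.filter_true_of_mem fun v hv => h v (Finset.mem_range.1 hv),
    Finset.card_range]

theorem countBelow_of_forall_not {m : ℕ} {Z : ℕ → Prop} (h : ∀ v < m, ¬Z v) :
    countBelow m Z = 0 := by
  classical
  rw [countBelow, Finset.filter_false_of_mem fun v hv => h v (Finset.mem_range.1 hv),
    Finset.card_empty]

theorem countBelow_le (m : ℕ) (Z : ℕ → Prop) : countBelow m Z ≤ m := by
  classical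
  exact (Finset.card_filter_le _ _).trans (by simp)

open Classical in
theorem countBelow_succ (m : ℕ) (Z : ℕ → Prop) :
    countBelow (m + 1) Z = countBelow m Z + if Z m then 1 else 0 := by
  rw [countBelow, Finset.range_add_one, Finset.filter_insert]
  split_ifs
  · rw [Finset.card_insert_of_notMem (by simp), countBelow]
  · simp [countBelow]

theorem countBelow_not (m : ℕ) (Z : ℕ → Prop) :
    countBelow m Z + countBelow m (fun v => ¬Z v) = m := by
  classical
  induction m with
  | zero => simp [countBelow]
  | succ m ih => rw [countBelow_succ, countBelow_succ]; split_ifs <;> omega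

/-- A lower bound for the value of an ordering by a lower bound for the cuts that are balanced on
the first `m` vertices. -/
theorem mul_le_orderCost {n k m best : ℕ} {W : ℕ → ℕ → ℕ} {p : ℕ → ℕ} (hp : IsOrdering n p)
    (hm : m + k = n) (hk : 2 * k ≤ m)
    (hbest : ∀ Z : ℕ → Prop, k ≤ countBelow m Z → countBelow m Z + k ≤ m → best ≤ cutSum n W Z) :
    (n - 1 - 3 * k) * best ≤ orderCost n W p := by
  classical
  set a : ℕ → ℕ := fun i => countBelow m fun v => i < p v with ha
  have ha_anti : ∀ i j, i ≤ j → a j ≤ a i := fun i j hij =>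
    countBelow_mono fun v _ hv => lt_of_le_of_lt hij hv
  have han : a n = 0 := countBelow_of_forall_not fun v hv => not_lt.2 (hp.le v (by omega))
  have ha0 : a 0 = m := countBelow_of_forall fun v hv => hp.pos v (by omega)
  -- For k = 0 every set is balanced, and the index `y` below would not exist.
  rcases Nat.eq_zero_or_pos k with rfl | hk0
  · calc (n - 1 - 3 * 0) * best = ∑ i ∈ Finset.Icc 1 (n - 1), best := by simp
      _ ≤ _ := Finset.sum_le_sum fun i _ => hbest _ (by omega) (by
        have := countBelow_le m fun v => i < p v; omega)
  have hcount := hp.countBelow_lt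
  have hsplit : ∀ i, n - i = a i + ((Finset.Ico m n).filter fun v => i < p v).card := fun i => by
    rw [← hcount i, countBelow_add_card (show m ≤ n by omega)]
  have hx : ∃ i, a i + k ≤ m := ⟨n, by omega⟩
  have hy : ∃ i, a i < k := ⟨n, by omega⟩
  -- As `a` is antitone, the balanced positions are exactly those from `x`, the first with at most m
  -- - k of the first m vertices after it, to just before `y`, the first with fewer than k of them.
  set x := Nat.find hx with hxdef
  set y := Nat.find hy with hydef
  have hx1 : a x + k ≤ m := Nat.find_spec hx
  have hy1 : a y < k := Nat.find_spec hy
  have hx0 : x ≠ 0 := by intro h; rw [h, ha0] at hx1; omega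
  have hx2 : m < a (x - 1) + k := not_le.1 (Nat.find_min hx (by omega))
  have hyn : y ≤ n := Nat.find_min' hy (by omega)
  have hxy : x ≤ y := Nat.find_min' hx (by omega)
  have hgood : ∀ i, x ≤ i → i < y → k ≤ a i ∧ a i + k ≤ m := fun i h1 h2 =>
    ⟨not_lt.1 (Nat.find_min hy h2), (Nat.add_le_add_right (ha_anti _ _ h1) k).trans hx1⟩
  have hs := hsplit y
  have hs' := hsplit (x - 1)
  have hR'' : ((Finset.Ico m n).filter fun v => y < p v).card ≤
      ((Finset.Ico m n).filter fun v => x - 1 < p v).card := by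
    refine Finset.card_le_card fun v hv => ?_
    simp only [Finset.mem_filter] at hv ⊢
    exact ⟨hv.1, by omega⟩
  -- Compare `hsplit` at `x - 1` and `y`: the first m vertices account for a drop of at least m - 2k
  -- + 2, and the contribution of the others does not increase, so y - x > m - 2k = n - 3k.
  calc (n - 1 - 3 * k) * best ≤ (y - x) * best := Nat.mul_le_mul_right _ (by omega)
    _ = ∑ i ∈ Finset.Ico x y, best := by simp
    _ ≤ ∑ i ∈ Finset.Ico x y, cutSum n W fun v => i < p v :=
      Finset.sum_le_sum fun i hi => by
        rw [Finset.mem_Ico] at hi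
        exact hbest _ (hgood i hi.1 hi.2).1 (hgood i hi.1 hi.2).2
    _ ≤ _ := by
      refine Finset.sum_le_sum_of_subset fun i hi => ?_
      rw [Finset.mem_Ico] at hi
      exact Finset.mem_Icc.2 ⟨by omega, by omega⟩

/-! ### Dynamic programming over subsets -/

/-- Bit j is set, so the subtraction causes no borrow: 2^j(2a + 1) + c becomes 2^j(2a) + c. -/
theorem testBit_sub_two_pow {M j : ℕ} (h : M.testBit j = true) (i : ℕ) :
    (M - 2 ^ j).testBit i = (M.testBit i && decide (i ≠ j)) := by
  obtain ⟨a, c, hc, rfl⟩ : ∃ a c, c < 2 ^ j ∧ M = 2 ^ j * (2 * a + 1) + c := by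
    refine ⟨M / 2 ^ j / 2, M % 2 ^ j, Nat.mod_lt _ (by positivity), ?_⟩
    rw [Nat.testBit_eq_decide_div_mod_eq, decide_eq_true_eq] at h
    have h1 : 2 * (M / 2 ^ j / 2) + 1 = M / 2 ^ j := by omega
    rw [h1, Nat.div_add_mod]
  have hsub : 2 ^ j * (2 * a + 1) + c - 2 ^ j = 2 ^ j * (2 * a) + c := by
    rw [mul_add, mul_one]; omega
  rw [hsub, Nat.testBit_two_pow_mul_add _ hc, Nat.testBit_two_pow_mul_add _ hc]
  split_ifs with hij
  · simp [hij.ne]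
  · obtain ⟨t, rfl⟩ := Nat.exists_eq_add_of_le (not_lt.1 hij)
    rw [Nat.add_sub_cancel_left]
    cases t with
    | zero => simp
    | succ t =>
      rw [Nat.testBit_succ, Nat.testBit_succ]
      have h1 : 2 * a / 2 = a := by omega
      have h2 : (2 * a + 1) / 2 = a := by omega
      simp [h1, h2]

theorem two_pow_le_of_testBit {M j : ℕ} (h : M.testBit j = true) : 2 ^ j ≤ M :=
  Nat.ge_two_pow_of_testBit h

theorem lt_of_testBit {M j r : ℕ} (hM : M < 2 ^ r) (h : M.testBit j = true) : j < r := by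
  by_contra hj
  have := two_pow_le_of_testBit h
  have := Nat.pow_le_pow_right two_pos (not_lt.1 hj)
  omega

theorem exists_mask (r : ℕ) (Z : ℕ → Prop) :
    ∃ M < 2 ^ r, ∀ j < r, (M.testBit j = true ↔ Z j) := by
  classical
  exact ⟨Nat.ofBits fun j : Fin r => decide (Z j), Nat.ofBits_lt_two_pow _, fun j hj => by
    rw [Nat.testBit_ofBits_lt _ _ hj, decide_eq_true_eq]⟩

theorem mask_ext {r M M' : ℕ} (hM : M < 2 ^ r) (hM' : M' < 2 ^ r)
    (h : ∀ j < r, (M.testBit j = true ↔ M'.testBit j = true)) : M = M' := by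
  refine Nat.eq_of_testBit_eq fun j => ?_
  by_cases hj : j < r
  · exact Bool.eq_iff_iff.2 (h j hj)
  · have := Nat.pow_le_pow_right two_pos (not_lt.1 hj)
    rw [Nat.testBit_lt_two_pow (by omega), Nat.testBit_lt_two_pow (by omega)]

/-- A table satisfying Bellman's inequalities bounds the cost of every ordering from below. -/
theorem table_le_sum_cutSum {n r : ℕ} {W : ℕ → ℕ → ℕ} {D q : ℕ → ℕ}
    (hpos : ∀ j < r, 1 ≤ q j) (hle : ∀ j < r, q j ≤ n)
    (hinj : ∀ i < r, ∀ j < r, q i = q j → i = j) (h0 : D 0 = 0)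
    (hD : ∀ M < 2 ^ r, ∀ j < r, M.testBit j = true →
      D M ≤ D (M - 2 ^ j) + cutSum r W fun i => M.testBit i = false) :
    D (2 ^ r - 1) ≤ ∑ i ∈ Finset.Icc 1 (n - 1), cutSum r W fun j => i < q j := by
  -- `M i` is the mask of the vertices at positions at most i. Following these prefixes through the
  -- table bounds it by the ordering's own cost.
  choose M hM hbit using fun i => exists_mask r fun j => q j ≤ i
  have hbit' : ∀ i, cutSum r W (fun j => (M i).testBit j = false) =
      cutSum r W fun j => i < q j := fun i => cutSum_congr (fun _ _ _ _ => rfl) fun j hj => by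
    rw [← not_iff_not, Bool.not_eq_false, hbit i j hj, not_lt]
  have key : ∀ i, D (M i) ≤ ∑ i' ∈ Finset.Icc 1 i, cutSum r W fun j => i' < q j := by
    intro i
    induction i with
    | zero =>
      have : M 0 = 0 := mask_ext (hM 0) (by positivity) fun j hj => by
        rw [hbit 0 j hj]
        have := hpos j hj
        simp; omega
      simp [this, h0]
    | succ i ih =>
      rw [Finset.sum_Icc_succ_top (by omega)]
      by_cases hex : ∃ j < r, q j = i + 1
      · obtain ⟨j, hj, hqj⟩ := hex
        have hj1 : (M (i + 1)).testBit j = true := (hbit _ j hj).2 hqj.le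
        have hsub : M (i + 1) - 2 ^ j = M i := by
          refine mask_ext ((Nat.sub_le _ _).trans_lt (hM _)) (hM _) fun j' hj' => ?_
          rw [testBit_sub_two_pow hj1, hbit i j' hj', Bool.and_eq_true, hbit _ j' hj',
            decide_eq_true_eq]
          constructor
          · rintro ⟨h1, h2⟩
            rcases Nat.lt_or_ge i (q j') with h | h
            · exact absurd (hinj j' hj' j hj (by omega)) h2
            · exact h
          · intro h
            refine ⟨by omega, ?_⟩
            rintro rfl
            omega
        have := hD _ (hM (i + 1)) j hj hj1
        rw [hsub, hbit'] at this
        omega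
      -- The positions `q` need not be consecutive, since other vertices of the ordering lie in
      -- between. At a position taken by one of these the prefix is unchanged and the additional cut
      -- only increases the right side.
      · have : M (i + 1) = M i := mask_ext (hM _) (hM _) fun j hj => by
          rw [hbit _ j hj, hbit _ j hj]
          have : q j ≠ i + 1 := fun h => hex ⟨j, hj, h⟩
          omega
        rw [this]
        exact ih.trans (Nat.le_add_right _ _)
  have hfull : M n = 2 ^ r - 1 := mask_ext (hM n) (Nat.sub_lt (by positivity) one_pos)
    fun j hj => by rw [hbit n j hj]; simp [hle j hj, hj]
  rw [← hfull]
  refine (key n).trans ?_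
  -- The induction runs to position n, whose cut is empty, while the objective stops at n - 1.
  cases n with
  | zero => simp
  | succ n =>
    rw [Finset.sum_Icc_succ_top (by omega), Nat.add_sub_cancel,
      cutSum_eq_zero_of_forall_not (fun j hj => not_lt.2 (hle j hj)), add_zero]

/-! ### Concatenating orderings of the two sides of a cut -/

section Concatenation

variable {n : ℕ} {W : ℕ → ℕ → ℕ} {el : ℕ → ℕ}

theorem image_el (hlt : ∀ i < n, el i < n) (hinj : ∀ i < n, ∀ j < n, el i = el j → i = j) :
    (Finset.range n).image el = Finset.range n := by
  refine Finset.eq_of_subset_of_card_le (fun x hx => ?_) ?_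
  · obtain ⟨v, hv, rfl⟩ := Finset.mem_image.1 hx
    exact Finset.mem_range.2 (hlt v (Finset.mem_range.1 hv))
  · rw [Finset.card_image_of_injOn fun u hu v hv => hinj u (by simpa using hu) v (by simpa using hv)]

theorem cutSum_relabel (hlt : ∀ i < n, el i < n)
    (hinj : ∀ i < n, ∀ j < n, el i = el j → i = j) (Z : ℕ → Prop) :
    cutSum n W Z = cutSum n (fun i j => W (el i) (el j)) fun i => Z (el i) := by
  classical
  have key : ∀ f : ℕ → ℕ, ∑ v ∈ Finset.range n, f v = ∑ i ∈ Finset.range n, f (el i) := by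
    intro f
    conv_lhs => rw [← image_el hlt hinj]
    exact Finset.sum_image fun u hu v hv => hinj u (by simpa using hu) v (by simpa using hv)
  exact (key _).trans (Finset.sum_congr rfl fun i _ => key _)

/-- The four blocks of a cut with respect to a splitting of the index range. -/
theorem cutSum_add {r t : ℕ} (Z : ℕ → Prop) [DecidablePred Z] :
    cutSum (r + t) W Z =
      cutSum r W Z + cutSum t (fun i j => W (r + i) (r + j)) (fun i => Z (r + i)) +
      (∑ i ∈ Finset.range r, ∑ j ∈ Finset.range t, if Z i ∧ ¬Z (r + j) then W i (r + j) else 0) +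
      ∑ i ∈ Finset.range t, ∑ j ∈ Finset.range r, if Z (r + i) ∧ ¬Z j then W (r + i) j else 0 := by
  classical
  simp only [cutSum, Finset.sum_range_add, Finset.sum_add_distrib]
  have e : ∀ (A : Prop) (d1 d2 : Decidable A) (x : ℕ), @ite _ A d1 x 0 = @ite _ A d2 x 0 := by
    intros; congr
  simp only [fun A d x => e A d (Classical.propDecidable A) x]
  omega

/-- Concatenating optimal orderings of the complement `{el 0, …, el (r - 1)}` and of the cut side
`{el r, …, el (n - 1)}` costs at most the value of any ordering and `n - 1` times the cut. -/
theorem orderCost_concat_le {r t x y : ℕ} {p out : ℕ → ℕ} (hn : r + t = n)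
    (hlt : ∀ i < n, el i < n) (hinj : ∀ i < n, ∀ j < n, el i = el j → i = j)
    (Z : ℕ → Prop) (hZ : ∀ i < n, (Z (el i) ↔ r ≤ i))
    (hx : x ≤ ∑ i ∈ Finset.Icc 1 (n - 1),
      cutSum r (fun i j => W (el i) (el j)) fun j => i < p (el j))
    (hy : y ≤ ∑ i ∈ Finset.Icc 1 (n - 1),
      cutSum t (fun i j => W (el (r + i)) (el (r + j))) fun j => i < p (el (r + j)))
    (hx' : ∑ i ∈ Finset.Ioc 0 r, cutSum r (fun i j => W (el i) (el j)) (fun j => i < out (el j))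
      = x)
    (hy' : ∑ i ∈ Finset.Ioc r n, cutSum t (fun i j => W (el (r + i)) (el (r + j)))
      (fun j => i < out (el (r + j))) = y)
    (hout : ∀ i < r, 0 < out (el i) ∧ out (el i) ≤ r)
    (hout' : ∀ i < t, r < out (el (r + i)) ∧ out (el (r + i)) ≤ n) :
    orderCost n W out ≤ orderCost n W p + (n - 1) * cutSum n W Z := by
  classical
  -- Restrict every cut of the ordering to the two diagonal blocks and drop the crossing arcs.
  have lower : x + y ≤ orderCost n W p := by
    refine (add_le_add hx hy).trans ?_
    rw [← Finset.sum_add_distrib]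
    refine Finset.sum_le_sum fun i _ => ?_
    rw [cutSum_relabel hlt hinj, ← hn, cutSum_add]
    omega
  -- Each side contributes only at its own positions: from position r on, no vertex of the first
  -- block lies after the position; up to position r, all of the second block does.
  have h1 : ∑ i ∈ Finset.Icc 1 (n - 1), cutSum r (fun i j => W (el i) (el j))
      (fun j => i < out (el j)) ≤ x := by
    rw [← hx']
    refine Finset.sum_le_sum_of_ne_zero fun i hi h => ?_
    rw [Finset.mem_Icc] at hi
    rw [Finset.mem_Ioc]
    refine ⟨by omega, not_lt.1 fun h' => h ?_⟩
    exact cutSum_eq_zero_of_forall_not fun j hj => by have := hout j hj; omega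
  have h2 : ∑ i ∈ Finset.Icc 1 (n - 1), cutSum t (fun i j => W (el (r + i)) (el (r + j)))
      (fun j => i < out (el (r + j))) ≤ y := by
    rw [← hy']
    refine Finset.sum_le_sum_of_ne_zero fun i hi h => ?_
    rw [Finset.mem_Icc] at hi
    rw [Finset.mem_Ioc]
    refine ⟨not_le.1 fun h' => h ?_, by omega⟩
    exact cutSum_eq_zero_of_forall fun j hj => by have := hout' j hj; omega
  have h3 : ∑ i ∈ Finset.Icc 1 (n - 1), cutSum n W Z = (n - 1) * cutSum n W Z := by simp
  refine le_trans ?_ (Nat.add_le_add_right lower _)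
  refine le_trans ?_ (Nat.add_le_add_right (add_le_add h1 h2) _)
  rw [← h3, ← Finset.sum_add_distrib, ← Finset.sum_add_distrib, orderCost]
  refine Finset.sum_le_sum fun i _ => ?_
  rw [cutSum_relabel hlt hinj, cutSum_relabel hlt hinj Z, ← hn, cutSum_add, cutSum_add]
  -- Arcs from the first block to the second point forward and never cross a position backwards. The
  -- opposite ones are bounded at every position by the whole cut of Z.
  have e1 : (∑ i' ∈ Finset.range r, ∑ j ∈ Finset.range t,
      if i < out (el i') ∧ ¬i < out (el (r + j)) then W (el i') (el (r + j)) else 0) = 0 := by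
    refine Finset.sum_eq_zero fun i' hi' => Finset.sum_eq_zero fun j hj => if_neg ?_
    rw [Finset.mem_range] at hi' hj
    have := hout i' hi'
    have := hout' j hj
    omega
  have e2 : (∑ i' ∈ Finset.range t, ∑ j ∈ Finset.range r,
      if i < out (el (r + i')) ∧ ¬i < out (el j) then W (el (r + i')) (el j) else 0) ≤
      ∑ i' ∈ Finset.range t, ∑ j ∈ Finset.range r,
        if Z (el (r + i')) ∧ ¬Z (el j) then W (el (r + i')) (el j) else 0 := by
    refine Finset.sum_le_sum fun i' hi' => Finset.sum_le_sum fun j hj => ?_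
    rw [Finset.mem_range] at hi' hj
    rw [if_pos (show Z (el (r + i')) ∧ ¬Z (el j) from
      ⟨(hZ _ (by omega)).2 (by omega), fun h => by have := (hZ j (by omega)).1 h; omega⟩)]
    split_ifs <;> omega
  omega

end Concatenation

/-! ### Pushing flow in a residual matrix -/

open Classical in
/-- The total weight of the pairs with property `P`. -/
noncomputable def pairSum (n : ℕ) (W : ℕ → ℕ → ℕ) (P : ℕ → ℕ → Prop) : ℕ :=
  ∑ u ∈ Finset.range n, ∑ v ∈ Finset.range n, if P u v then W u v else 0

/-- The matrix stored in row-major order at `c`. -/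
def entries (n : ℕ) (c : ℕ → ℕ) (u v : ℕ) : ℕ := c (u * n + v)

theorem cutSum_eq_pairSum (n : ℕ) (W : ℕ → ℕ → ℕ) (Z : ℕ → Prop) :
    cutSum n W Z = pairSum n W fun u v => Z u ∧ ¬Z v :=
  Finset.sum_congr rfl fun _ _ => Finset.sum_congr rfl fun _ _ => by congr

theorem pairSum_mono {n : ℕ} {W W' : ℕ → ℕ → ℕ} {P P' : ℕ → ℕ → Prop}
    (hW : ∀ u < n, ∀ v < n, P u v → P' u v ∧ W u v ≤ W' u v) : pairSum n W P ≤ pairSum n W' P' := by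
  refine Finset.sum_le_sum fun u hu => Finset.sum_le_sum fun v hv => ?_
  rw [Finset.mem_range] at hu hv
  have := hW u hu v hv
  by_cases h : P u v
  · rw [if_pos h, if_pos (this h).1]; exact (this h).2
  · rw [if_neg h]; exact Nat.zero_le _

theorem le_pairSum {n : ℕ} (W : ℕ → ℕ → ℕ) {P : ℕ → ℕ → Prop} {u v : ℕ} (hu : u < n) (hv : v < n)
    (h : P u v) : W u v ≤ pairSum n W P := by
  classical
  calc W u v = if P u v then W u v else 0 := (if_pos h).symm
    _ ≤ ∑ v ∈ Finset.range n, if P u v then W u v else 0 :=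
      Finset.single_le_sum (f := fun v => if P u v then W u v else 0) (fun _ _ => Nat.zero_le _)
        (Finset.mem_range.2 hv)
    _ ≤ _ := by
      refine le_trans ?_ (Finset.single_le_sum (f := fun u => ∑ v ∈ Finset.range n,
        if P u v then W u v else 0) (fun _ _ => Nat.zero_le _) (Finset.mem_range.2 hu))
      exact (Finset.sum_congr rfl fun v _ => by congr).le

open Classical in
theorem pairSum_const (n d : ℕ) {P : ℕ → ℕ → Prop} {u v : ℕ} (hu : u < n) (hv : v < n) :
    pairSum n (fun x y => if x = u ∧ y = v then d else 0) P = if P u v then d else 0 := by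
  rw [pairSum, Finset.sum_eq_single_of_mem u (Finset.mem_range.2 hu),
    Finset.sum_eq_single_of_mem v (Finset.mem_range.2 hv)]
  · simp
  · intro y _ hy; simp [hy]
  · intro x _ hx; simp [hx]

theorem pairSum_add (n : ℕ) (W W' : ℕ → ℕ → ℕ) (P : ℕ → ℕ → Prop) :
    pairSum n (fun x y => W x y + W' x y) P = pairSum n W P + pairSum n W' P := by
  classical
  simp only [pairSum, ← Finset.sum_add_distrib]
  refine Finset.sum_congr rfl fun u _ => Finset.sum_congr rfl fun v _ => ?_
  split_ifs <;> rfl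

theorem pairSum_congr {n : ℕ} {W W' : ℕ → ℕ → ℕ} {P : ℕ → ℕ → Prop}
    (h : ∀ u < n, ∀ v < n, W u v = W' u v) : pairSum n W P = pairSum n W' P :=
  le_antisymm (pairSum_mono fun u hu v hv hP => ⟨hP, (h u hu v hv).le⟩)
    (pairSum_mono fun u hu v hv hP => ⟨hP, (h u hu v hv).ge⟩)

theorem pairSum_le_mul {n d : ℕ} {W : ℕ → ℕ → ℕ} {P : ℕ → ℕ → Prop}
    (h : ∀ u < n, ∀ v < n, P u v → W u v ≤ d) : pairSum n W P ≤ n * n * d := by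
  classical
  calc pairSum n W P ≤ ∑ u ∈ Finset.range n, ∑ v ∈ Finset.range n, d := by
        refine Finset.sum_le_sum fun u hu => Finset.sum_le_sum fun v hv => ?_
        rw [Finset.mem_range] at hu hv
        split_ifs with hP
        · exact h u hu v hv hP
        · exact Nat.zero_le _
    _ = n * n * d := by simp [mul_assoc]

theorem address_inj {n x y u v : ℕ} (hy : y < n) (hv : v < n) :
    x * n + y = u * n + v ↔ x = u ∧ y = v := by
  constructor
  · intro h
    have hx : (x * n + y) / n = x := by
      rw [mul_comm, Nat.mul_add_div (by omega), Nat.div_eq_of_lt hy, add_zero]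
    have hu : (u * n + v) / n = u := by
      rw [mul_comm, Nat.mul_add_div (by omega), Nat.div_eq_of_lt hv, add_zero]
    have : x = u := by rw [← hx, ← hu, h]
    subst this
    exact ⟨rfl, by omega⟩
  · rintro ⟨rfl, rfl⟩; rfl

theorem address_lt {n u v : ℕ} (hu : u < n) (hv : v < n) : u * n + v < n * n := by nlinarith

/-- The residual matrix after pushing `d` units from `u` to `v`. -/
def push (n d u v : ℕ) (c : ℕ → ℕ) : ℕ → ℕ := fun a =>
  if a = v * n + u then c (v * n + u) + d else if a = u * n + v then c (u * n + v) - d else c a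

open Classical in
theorem pairSum_push {n d u v : ℕ} {c : ℕ → ℕ} (hu : u < n) (hv : v < n) (huv : u ≠ v)
    (hd : d ≤ c (u * n + v)) (P : ℕ → ℕ → Prop) :
    pairSum n (entries n (push n d u v c)) P + (if P u v then d else 0) =
      pairSum n (entries n c) P + if P v u then d else 0 := by
  rw [← pairSum_const n d hu hv, ← pairSum_const n d hv hu, ← pairSum_add, ← pairSum_add]
  refine pairSum_congr fun x hx y hy => ?_
  simp only [entries, push, address_inj hy hu, address_inj hy hv]
  by_cases h1 : x = v ∧ y = u
  · obtain ⟨rfl, rfl⟩ := h1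
    have : ¬(x = y ∧ y = x) := fun h => huv h.2
    simp [this]
  · by_cases h2 : x = u ∧ y = v
    · obtain ⟨rfl, rfl⟩ := h2
      simp [h1]; omega
    · simp [h1, h2]

-- A push is recorded only in the residual matrix. A cut changes by d · ([Z v] - [Z u]), so along a
-- path the changes telescope, and every cut separating the ends loses the same amount.
open Classical in
theorem cutSum_push {n d u v : ℕ} {c : ℕ → ℕ} (hu : u < n) (hv : v < n) (huv : u ≠ v)
    (hd : d ≤ c (u * n + v)) (Z : ℕ → Prop) :
    cutSum n (entries n (push n d u v c)) Z + (if Z u then d else 0) =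
      cutSum n (entries n c) Z + if Z v then d else 0 := by
  have := pairSum_push hu hv huv hd fun u v => Z u ∧ ¬Z v
  simp only [cutSum_eq_pairSum] at *
  by_cases h1 : Z u <;> by_cases h2 : Z v <;> simp [h1, h2] at this ⊢ <;> omega

/-- Since the total is preserved, every residual entry stays below the total weight throughout,
which keeps the stored numbers short. -/
theorem total_push {n d u v : ℕ} {c : ℕ → ℕ} (hu : u < n) (hv : v < n) (huv : u ≠ v)
    (hd : d ≤ c (u * n + v)) :
    pairSum n (entries n (push n d u v c)) (fun _ _ => True) =
      pairSum n (entries n c) fun _ _ => True := by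
  have := pairSum_push hu hv huv hd fun _ _ => True
  simpa using this

theorem cutSum_le_total (n : ℕ) (W : ℕ → ℕ → ℕ) (Z : ℕ → Prop) :
    cutSum n W Z ≤ pairSum n W fun _ _ => True :=
  cutSum_eq_pairSum n W Z ▸ pairSum_mono fun _ _ _ _ _ => ⟨trivial, le_rfl⟩

theorem entry_le_total {n e : ℕ} {c : ℕ → ℕ} (he : e < n * n) :
    c e ≤ pairSum n (entries n c) fun _ _ => True := by
  have hn : 0 < n := Nat.pos_of_ne_zero (by rintro rfl; simp at he)
  have := le_pairSum (entries n c) (P := fun _ _ => True) (u := e / n) (v := e % n)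
    (Nat.div_lt_of_lt_mul he) (Nat.mod_lt _ hn) trivial
  rwa [entries, Nat.div_add_mod'] at this

/-! ### Reachability in the residual graph -/

/-- Look for an arc of residual capacity at least `reg 9` that leaves the marked set. -/
def scanBody : Program :=
  .cond (read 8 (reg 10 / reg 0) * (1 - read 8 (rem (reg 10) (reg 0))) *
      (read 7 (reg 10) + 1 - reg 9))
    (assign 12 (reg 10 / reg 0) ;; assign 13 (rem (reg 10) (reg 0)) ;; assign 11 1) skip

/-- Mark one more vertex, if possible. -/
def markStep : Program :=
  assign 11 0 ;; forTo 10 3 scanBody ;;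
    .cond (reg 11) (write 8 (reg 13) (read 8 (reg 12) + 1) ;; write 9 (reg 13) (reg 12)) skip

/-- Mark all vertices reachable from the sources by arcs of residual capacity at least `reg 9`. -/
def reach : Program :=
  forTo 10 0 (write 8 (reg 10) (read 5 (reg 10))) ;; assign 11 1 ;; loop (reg 11) markStep

/-- The arc at address `e` leaves the marked set and has residual capacity at least `d`. -/
def Leaves (n d : ℕ) (c lev : ℕ → ℕ) (e : ℕ) : Prop :=
  lev (e / n) ≠ 0 ∧ lev (e % n) = 0 ∧ d ≤ c e

/-- The tests are products of truncated differences: `1 - x` is nonzero iff x = 0, and c + 1 - d iff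
d ≤ c. A later hit overwrites an earlier one; any leaving arc will do. -/
theorem runs_scan {b n : ℕ} {s : State} {lev : ℕ → ℕ} (h0 : s.reg 0 = n) (h3 : s.reg 3 = n * n)
    (h11 : s.reg 11 = 0) (hlev : s.mem 8 = lev) (hb : 1 ≤ b) :
    Runs b (forTo 10 3 scanBody) (n * n * 6 + 2) s fun s' =>
      (s'.reg 11 = 0 → ∀ e < n * n, ¬Leaves n (s.reg 9) (s.mem 7) lev e) ∧
      (s'.reg 11 ≠ 0 → s'.reg 12 < n ∧ s'.reg 13 < n ∧ lev (s'.reg 12) ≠ 0 ∧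
        lev (s'.reg 13) = 0 ∧ s.reg 9 ≤ s.mem 7 (s'.reg 12 * n + s'.reg 13)) := by
  have hb2 : 1 < 2 ^ b := Nat.one_lt_two_pow (by omega)
  refine Runs.forTo (T := 4) (n * n) (fun j s' =>
      (s'.reg 11 = 0 → ∀ e < j, ¬Leaves n (s.reg 9) (s.mem 7) lev e) ∧
      (s'.reg 11 ≠ 0 → s'.reg 12 < n ∧ s'.reg 13 < n ∧ lev (s'.reg 12) ≠ 0 ∧
        lev (s'.reg 13) = 0 ∧ s.reg 9 ≤ s.mem 7 (s'.reg 12 * n + s'.reg 13)))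
    rfl rfl h3 (fun _ _ _ h => h) ⟨fun _ e he => absurd he (Nat.not_lt_zero _), fun h => absurd h11 h⟩
    ?_ (fun _ _ h => h)
  intro j hj s' ha h10 hI
  have g0 : s'.reg 0 = n := (ha.1 0 rfl).trans h0
  have g9 : s'.reg 9 = s.reg 9 := ha.1 9 rfl
  have g7 : s'.mem 7 = s.mem 7 := ha.2 7 rfl
  have g8 : s'.mem 8 = lev := (ha.2 8 rfl).trans hlev
  have hn : 0 < n := Nat.pos_of_ne_zero (by rintro rfl; simp at hj)
  have hcond : (read 8 (reg 10 / reg 0) * (1 - read 8 (rem (reg 10) (reg 0))) *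
      (read 7 (reg 10) + 1 - reg 9)).eval s' ≠ 0 ↔ Leaves n (s.reg 9) (s.mem 7) lev j := by
    simp only [eval_mul, eval_read, eval_div, eval_reg, eval_sub, eval_one, eval_rem, eval_add, g0,
      g9, g7, g8, h10, Leaves, mul_ne_zero_iff, and_assoc]
    refine and_congr_right fun _ => and_congr ?_ ?_ <;> omega
  refine (Runs.cond (T := 3) (fun he => ?_) fun he => ?_).mono le_rfl fun _ _ h => h
  · have hL := hcond.1 he
    refine Runs.of_bounded fun hbd => ?_
    have hj' := hbd.1 10
    rw [h10] at hj'
    refine Runs.assign_seq (T := 2) (fun _ => ?_) (Runs.assign_seq (T := 1) (fun _ => ?_)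
      (Runs.assign (fun _ => by simpa using hb2) ?_))
    · simp only [eval_div, eval_reg, h10, g0]
      exact (Nat.div_le_self _ _).trans_lt hj'
    · simp only [eval_rem, eval_reg, State.reg_setReg, h10, g0]
      exact (Nat.mod_le _ _).trans_lt hj'
    · simp only [eval_rem, eval_reg, eval_div, eval_one, State.reg_setReg, h10, g0]
      refine ⟨fun h => absurd h (by simp), fun _ => ?_⟩
      simp only [Nat.reduceEqDiff, if_false, if_true]
      refine ⟨Nat.div_lt_of_lt_mul hj, Nat.mod_lt _ hn, hL.1, hL.2.1, ?_⟩
      rw [Nat.div_add_mod']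
      exact hL.2.2
  · refine Runs.skip ⟨fun h e he' => ?_, hI.2⟩ |>.mono (by omega) fun _ _ h => h
    rcases Nat.lt_succ_iff_lt_or_eq.1 he' with h' | rfl
    · exact hI.1 h e h'
    · exact fun hL => hcond.2 hL he

/-- The marks `lev` with parents `par` describe paths from the sources. -/
structure Marked (n d : ℕ) (src c lev par : ℕ → ℕ) : Prop where
  source : ∀ v < n, src v ≠ 0 → lev v ≠ 0
  parent : ∀ v < n, lev v ≠ 0 → src v = 0 →
    par v < n ∧ lev (par v) ≠ 0 ∧ lev (par v) < lev v ∧ d ≤ c (par v * n + v)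
  le : ∀ v < n, lev v ≤ countBelow n fun v => lev v ≠ 0

theorem Marked.lev_le {n d : ℕ} {src c lev par : ℕ → ℕ} (h : Marked n d src c lev par) {v : ℕ}
    (hv : v < n) : lev v ≤ n := (h.le v hv).trans (countBelow_le _ _)

theorem countBelow_update {n v x : ℕ} {lev : ℕ → ℕ} (hv : v < n) (h : lev v = 0) (hx : x ≠ 0) :
    countBelow n (fun a => Function.update lev v x a ≠ 0) = countBelow n (fun a => lev a ≠ 0) + 1 := by
  classical
  refine Eq.trans (congrArg Finset.card (Finset.ext fun a => ?_))
    (Finset.card_insert_of_notMem (a := v) (by simp [h]))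
  simp only [Finset.mem_filter, Finset.mem_range, Finset.mem_insert, Function.update_apply]
  by_cases ha : a = v
  · simp [ha, hv, hx]
  · simp [ha]

/-- The new vertex lies one level above its parent. The parent's level is at most the number of
marked vertices, which also grows by one, so levels never exceed n. -/
theorem Marked.update {n d : ℕ} {src c lev par : ℕ → ℕ} (h : Marked n d src c lev par) {u v : ℕ}
    (hu : u < n) (hv : v < n) (hlu : lev u ≠ 0) (hlv : lev v = 0) (hd : d ≤ c (u * n + v)) :
    Marked n d src c (Function.update lev v (lev u + 1)) (Function.update par v u) := by
  have hcount := countBelow_update (lev := lev) hv hlv (Nat.succ_ne_zero (lev u))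
  have huv : u ≠ v := by rintro rfl; exact hlu hlv
  refine ⟨fun a ha hs => ?_, fun a ha hl hs => ?_, fun a ha => ?_⟩
  · rw [Function.update_apply]; split_ifs
    exacts [Nat.succ_ne_zero _, h.source a ha hs]
  · by_cases hav : a = v
    · subst hav
      simp only [Function.update_self, Function.update_of_ne huv]
      exact ⟨hu, hlu, Nat.lt_succ_self _, hd⟩
    · rw [Function.update_of_ne hav] at hl
      obtain ⟨h1, h2, h3, h4⟩ := h.parent a ha hl hs
      have : par a ≠ v := fun h' => h2 (h' ▸ hlv)
      simp only [Function.update_of_ne hav, Function.update_of_ne this]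
      exact ⟨h1, h2, h3, h4⟩
  · rw [hcount, Function.update_apply]; split_ifs
    · exact Nat.succ_le_succ (h.le u hu)
    · exact (h.le a ha).trans (Nat.le_succ _)

theorem State.mem_setMem_self (s : State) (j a x : ℕ) :
    (s.setMem j a x).mem j = Function.update (s.mem j) a x := by
  simp [State.setMem]

theorem runs_markStep {b n : ℕ} {s : State} (h0 : s.reg 0 = n) (h3 : s.reg 3 = n * n)
    (hn : n + 1 < 2 ^ b) (hb : 1 ≤ b)
    (hm : Marked n (s.reg 9) (s.mem 5) (s.mem 7) (s.mem 8) (s.mem 9)) :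
    Runs b markStep (n * n * 6 + 6) s fun s' =>
      Marked n (s.reg 9) (s.mem 5) (s.mem 7) (s'.mem 8) (s'.mem 9) ∧
      (s'.reg 11 = 0 → ∀ e < n * n, ¬Leaves n (s.reg 9) (s.mem 7) (s'.mem 8) e) ∧
      (s'.reg 11 ≠ 0 → countBelow n (fun v => s'.mem 8 v ≠ 0) =
        countBelow n (fun v => s.mem 8 v ≠ 0) + 1) := by
  have hb2 : 1 < 2 ^ b := Nat.one_lt_two_pow (by omega)
  refine (Runs.assign_seq (fun _ => by simp) (Runs.seq (T₂ := 3)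
    (runs_scan (lev := s.mem 8) (by simpa using h0) (by simpa using h3) (by simp) rfl hb)
    fun s' ha hs => Runs.cond (T := 2) (fun he => ?_) fun he => ?_)).mono (by ring_nf; omega)
    fun _ _ h => h
  · have g8 : s'.mem 8 = s.mem 8 := ha.2 8 rfl
    have g9 : s'.mem 9 = s.mem 9 := ha.2 9 rfl
    simp only [eval_reg] at he
    obtain ⟨h1, h2, h4, h5, h6⟩ := hs.2 he
    simp only [State.reg_setReg, State.mem_setReg] at h6
    refine Runs.write_seq (T := 1) (fun _ => ?_) (Runs.write (fun hb' => hb'.1 12) ?_)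
    · simp only [eval_add, eval_read, eval_reg, eval_one, g8]
      have := hm.lev_le h1
      omega
    · simp only [eval_add, eval_read, eval_reg, eval_one, g8, State.reg_setMem]
      rw [State.mem_setMem_of_ne _ _ _ _ (by decide : 8 ≠ 9), State.mem_setMem_self,
        State.mem_setMem_self, State.mem_setMem_of_ne _ _ _ _ (by decide : 9 ≠ 8), g8, g9]
      exact ⟨hm.update h1 h2 h4 h5 h6, fun h => absurd h he,
        fun _ => countBelow_update h2 h5 (Nat.succ_ne_zero _)⟩
  · have g8 : s'.mem 8 = s.mem 8 := ha.2 8 rfl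
    have g9 : s'.mem 9 = s.mem 9 := ha.2 9 rfl
    simp only [eval_reg] at he
    refine Runs.skip ?_ |>.mono (by omega) fun _ _ h => h
    rw [g8, g9]
    exact ⟨hm, fun _ => hs.1 he, fun h => absurd he h⟩

theorem runs_reach {b n : ℕ} {s : State} (h0 : s.reg 0 = n) (h3 : s.reg 3 = n * n)
    (hn : n + 1 < 2 ^ b) (hb : 1 ≤ b) (hsrc : ∀ v < n, s.mem 5 v ≤ 1) :
    Runs b reach ((n + 1) * (n * n * 6 + 7) + n * 3 + 4) s fun s' =>
      Marked n (s.reg 9) (s.mem 5) (s.mem 7) (s'.mem 8) (s'.mem 9) ∧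
      ∀ e < n * n, ¬Leaves n (s.reg 9) (s.mem 7) (s'.mem 8) e := by
  have hb2 : 1 < 2 ^ b := Nat.one_lt_two_pow (by omega)
  refine (Runs.seq (T₁ := n * 3 + 2) (T₂ := (n + 1) * (n * n * 6 + 7) + 2)
    (R := fun s' => ∀ v < n, s'.mem 8 v = s.mem 5 v) ?_ fun s₁ a₁ h₁ => ?_).mono (by omega)
    fun _ _ h => h
  · refine Runs.forTo (T := 1) n (fun j s' => ∀ v < j, s'.mem 8 v = s.mem 5 v) rfl rfl h0
      (fun _ _ _ h => h) (fun v hv => absurd hv (Nat.not_lt_zero _)) (fun j hj s' ha hr hI => ?_)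
      fun _ _ h => h
    refine Runs.write (fun hb' => hb'.2 _ _) fun v hv => ?_
    have g5 : s'.mem 5 = s.mem 5 := ha.2 5 rfl
    simp only [State.mem_setMem_same, eval_reg, eval_read, hr, g5]
    split_ifs with h
    · rw [h]
    · exact hI v (by omega)
  · have g0 : s₁.reg 0 = n := (a₁.1 0 rfl).trans h0
    have g3 : s₁.reg 3 = n * n := (a₁.1 3 rfl).trans h3
    have g5 : s₁.mem 5 = s.mem 5 := a₁.2 5 rfl
    have g7 : s₁.mem 7 = s.mem 7 := a₁.2 7 rfl
    have g9 : s₁.reg 9 = s.reg 9 := a₁.1 9 rfl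
    -- Initially only sources are marked, so parents left in array `9` by earlier calls are
    -- irrelevant.
    have hm₁ : Marked n (s.reg 9) (s.mem 5) (s.mem 7) (s₁.mem 8) (s₁.mem 9) := by
      refine ⟨fun v hv h => (h₁ v hv).symm ▸ h, fun v hv h h' => absurd (h₁ v hv) (by omega),
        fun v hv => ?_⟩
      by_cases hz : s₁.mem 8 v = 0
      · omega
      · have h1 : 1 ≤ countBelow n fun v => s₁.mem 8 v ≠ 0 :=
          Finset.card_pos.2 ⟨v, by simp [hv, hz]⟩
        have := hsrc v hv
        have := h₁ v hv
        omega
    -- The variant is one more than the number of unmarked vertices: each successful round marks a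
    -- new vertex, and the extra round is the one that finds no arc.
    refine (Runs.assign_seq (fun _ => by simpa using hb2) (Runs.loop (T := n * n * 6 + 6)
      (fun v s' => Marked n (s.reg 9) (s.mem 5) (s.mem 7) (s'.mem 8) (s'.mem 9) ∧
        (s'.reg 11 = 0 → ∀ e < n * n, ¬Leaves n (s.reg 9) (s.mem 7) (s'.mem 8) e) ∧
        (s'.reg 11 ≠ 0 → n + 1 ≤ v + countBelow n fun v => s'.mem 8 v ≠ 0)) (n + 1)
      ⟨hm₁, fun h => by simp at h, fun _ => by omega⟩ (fun v s' ha hI he => ?_)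
      fun v s' ha hI he => ⟨hI.1, hI.2.1 he⟩)).mono (by linarith) fun _ _ h => h
    have k0 : s'.reg 0 = n := (ha.1 0 rfl).trans g0
    have k3 : s'.reg 3 = n * n := (ha.1 3 rfl).trans g3
    have k5 : s'.mem 5 = s.mem 5 := (ha.2 5 rfl).trans g5
    have k7 : s'.mem 7 = s.mem 7 := (ha.2 7 rfl).trans g7
    have k9 : s'.reg 9 = s.reg 9 := (ha.1 9 rfl).trans g9
    refine (runs_markStep k0 k3 hn hb (by rw [k5, k7, k9]; exact hI.1)).mono le_rfl
      fun s'' _ h => ?_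
    rw [k5, k7, k9] at h
    have hv := hI.2.2 he
    have hc := countBelow_le n fun v => s'.mem 8 v ≠ 0
    refine ⟨v - 1, by omega, h.1, h.2.1, fun hne => ?_⟩
    rw [h.2.2 hne]
    omega

/-! ### Augmenting along a path -/

/-- Push `reg 9` units along the path of parents to vertex `reg 13`. -/
def augment : Program :=
  loop (1 - read 5 (reg 13))
    (assign 12 (read 9 (reg 13)) ;;
      write 7 (reg 12 * reg 0 + reg 13) (read 7 (reg 12 * reg 0 + reg 13) - reg 9) ;;
      write 7 (reg 13 * reg 0 + reg 12) (read 7 (reg 13 * reg 0 + reg 12) + reg 9) ;;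
      assign 13 (reg 12))

/-- `Z` contains all sources and no sinks. -/
def Separates (n : ℕ) (src snk : ℕ → ℕ) (Z : ℕ → Prop) : Prop :=
  ∀ v < n, (src v ≠ 0 → Z v) ∧ (snk v ≠ 0 → ¬Z v)

-- The walk goes from the sink back to a source. In between, d units are pending at the current
-- vertex, so a separating cut is short of its original value by d exactly if that vertex lies in Z.
-- This deficit is zero at the sink and d at the source. Strictly decreasing levels bound the number
-- of rounds by n.
open Classical in
theorem runs_augment {b n tot : ℕ} {s : State} (h0 : s.reg 0 = n)
    (htot : 2 * tot + 1 < 2 ^ b) (hd : s.reg 9 ≤ tot + 1)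
    (hm : Marked n (s.reg 9) (s.mem 5) (s.mem 7) (s.mem 8) (s.mem 9))
    (h13 : s.reg 13 < n) (hlev : s.mem 8 (s.reg 13) ≠ 0) (hsnk : s.mem 6 (s.reg 13) ≠ 0)
    (hsum : pairSum n (entries n (s.mem 7)) (fun _ _ => True) = tot) :
    Runs b augment (n * 5 + 1) s fun s' =>
      pairSum n (entries n (s'.mem 7)) (fun _ _ => True) = tot ∧
      ∀ Z, Separates n (s.mem 5) (s.mem 6) Z →
        cutSum n (entries n (s'.mem 7)) Z + s.reg 9 = cutSum n (entries n (s.mem 7)) Z := by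
  refine (Runs.loop (T := 4) (fun k s' => s'.reg 13 < n ∧ s.mem 8 (s'.reg 13) ≠ 0 ∧
      s.mem 8 (s'.reg 13) ≤ k ∧
      (∀ v < n, s.mem 8 v ≠ 0 → s.mem 8 v ≤ s.mem 8 (s'.reg 13) → s.mem 5 v = 0 →
        s.reg 9 ≤ s'.mem 7 (s.mem 9 v * n + v)) ∧
      pairSum n (entries n (s'.mem 7)) (fun _ _ => True) = tot ∧
      ∀ Z, Separates n (s.mem 5) (s.mem 6) Z →
        cutSum n (entries n (s'.mem 7)) Z + (if Z (s'.reg 13) then s.reg 9 else 0) =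
          cutSum n (entries n (s.mem 7)) Z) n
    ⟨h13, hlev, hm.lev_le h13, fun v hv hl _ hs => (hm.parent v hv hl hs).2.2.2, hsum,
      fun Z hZ => by simp [(hZ _ h13).2 hsnk]⟩ (fun k s' ha hI he => ?_)
    fun k s' ha hI he => ?_).mono le_rfl fun _ _ h => h
  · obtain ⟨i1, i2, i3, i4, i5, i6⟩ := hI
    have k0 : s'.reg 0 = n := (ha.1 0 rfl).trans h0
    have k5 : s'.mem 5 = s.mem 5 := ha.2 5 rfl
    have k9 : s'.mem 9 = s.mem 9 := ha.2 9 rfl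
    have kd : s'.reg 9 = s.reg 9 := ha.1 9 rfl
    set v := s'.reg 13 with hv
    set d := s.reg 9 with hddef
    have hs0 : s.mem 5 v = 0 := by
      simp only [eval_sub, eval_one, eval_read, eval_reg, k5, ← hv] at he; omega
    obtain ⟨p1, p2, p3, -⟩ := hm.parent v i1 i2 hs0
    set u := s.mem 9 v with hu
    have p4 : d ≤ s'.mem 7 (u * n + v) := i4 v i1 i2 le_rfl hs0
    have huv : u ≠ v := fun h => by rw [h] at p3; exact lt_irrefl _ p3
    have hne : v * n + u ≠ u * n + v := fun h => huv ((address_inj p1 i1).1 h).2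
    have hle : s'.mem 7 (v * n + u) ≤ tot := i5 ▸ entry_le_total (address_lt i1 p1)
    refine (Runs.assign_seq (T := 3) (fun hb' => hb'.2 _ _) (Runs.write_seq (T := 2) (fun hb' => ?_)
      (Runs.write_seq (T := 1) (fun hb' => ?_) (Runs.assign (fun hb' => hb'.1 12) ?_))))
    · exact (Nat.sub_le _ _).trans_lt (hb'.2 _ _)
    · simp only [eval_add, eval_read, eval_reg, eval_mul, eval_sub, State.reg_setMem,
        State.reg_setReg, State.mem_setMem_same, State.mem_setReg, Nat.reduceEqDiff, if_true,
        if_false, k0, k9, kd, ← hv, ← hu, if_neg hne]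
      omega
    · have hpush : (((s'.setReg 12 u).setMem 7 (u * n + v) (s'.mem 7 (u * n + v) - d)).setMem 7
          (v * n + u) (s'.mem 7 (v * n + u) + d)).mem 7 = push n d u v (s'.mem 7) := by
        funext a
        simp [push]
      simp only [eval_add, eval_read, eval_reg, eval_mul, eval_sub, State.reg_setMem,
        State.reg_setReg, State.mem_setMem_same, State.mem_setReg, Nat.reduceEqDiff, if_true,
        if_false, k0, k9, kd, ← hv, ← hu, if_neg hne, hpush]
      refine ⟨s.mem 8 u, by omega, p1, p2, le_rfl, fun x hx hx0 hxl hxs => ?_, ?_, fun Z hZ => ?_⟩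
      -- The arcs still to be used are untouched: one ending in v is excluded by levels, and if (v,
      -- u) were a parent arc, v would have a smaller level than its child u.
      · have hxv : x ≠ v := fun h => by rw [h] at hxl; omega
        have h1 := i4 x hx hx0 (by omega) hxs
        rw [if_neg, if_neg]
        · exact h1
        · exact fun h => hxv ((address_inj hx i1).1 h).2
        · intro h
          obtain ⟨h2, rfl⟩ := (address_inj hx p1).1 h
          have := (hm.parent _ hx hx0 hxs).2.2.1
          rw [h2] at this
          omega
      · rw [total_push p1 i1 huv p4, i5]
      · rw [cutSum_push p1 i1 huv p4, i6 Z hZ]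
  · obtain ⟨i1, i2, i3, i4, i5, i6⟩ := hI
    have k5 : s'.mem 5 = s.mem 5 := ha.2 5 rfl
    refine ⟨i5, fun Z hZ => ?_⟩
    have hs : s.mem 5 (s'.reg 13) ≠ 0 := by
      simp only [eval_sub, eval_one, eval_read, eval_reg, k5] at he; omega
    have := i6 Z hZ
    rwa [if_pos ((hZ _ i1).1 hs)] at this

/-! ### Minimum cuts by capacity scaling -/

/-- Set `reg 11` to a nonzero value and `reg 13` to a marked sink if there is one. -/
def findSink : Program :=
  assign 11 0 ;; forTo 10 0
    (.cond (read 6 (reg 10) * read 8 (reg 10)) (assign 13 (reg 10) ;; assign 11 1) skip)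

/-- Augment the flow by `reg 9`, or halve `reg 9` if this is impossible. -/
def flowStep : Program :=
  reach ;; findSink ;; .cond (reg 11) augment (assign 9 (reg 9 / const 2))

/-- Mark the vertices on the source side of a minimum cut between the sources listed in array `5`
and the sinks listed in array `6`. -/
def minCut : Program :=
  forTo 10 3 (write 7 (reg 10) (read 1 (reg 10))) ;; assign 9 (reg 4 + 1) ;; loop (reg 9) flowStep

theorem runs_findSink {b n : ℕ} {s : State} (h0 : s.reg 0 = n) (hb : 1 ≤ b) :
    Runs b findSink (n * 5 + 3) s fun s' =>
      (s'.reg 11 = 0 → ∀ v < n, s.mem 6 v ≠ 0 → s.mem 8 v = 0) ∧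
      (s'.reg 11 ≠ 0 → s'.reg 13 < n ∧ s.mem 6 (s'.reg 13) ≠ 0 ∧ s.mem 8 (s'.reg 13) ≠ 0) := by
  have hb2 : 1 < 2 ^ b := Nat.one_lt_two_pow (by omega)
  refine (Runs.assign_seq (fun _ => by simp) (Runs.forTo (i := 10) (rN := 0) (T := 3) n (fun j s' =>
      (s'.reg 11 = 0 → ∀ v < j, s.mem 6 v ≠ 0 → s.mem 8 v = 0) ∧
      (s'.reg 11 ≠ 0 → s'.reg 13 < n ∧ s.mem 6 (s'.reg 13) ≠ 0 ∧ s.mem 8 (s'.reg 13) ≠ 0))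
    rfl rfl (by simpa using h0) (fun _ _ _ h => h)
    ⟨fun _ v hv => absurd hv (Nat.not_lt_zero _), fun h => by simp at h⟩
    (fun j hj s' ha hr hI => Runs.cond (T := 2) (fun he => ?_) fun he => ?_)
    (fun _ _ h => h))).mono (by omega) fun _ _ h => h
  · have g6 : s'.mem 6 = s.mem 6 := ha.2 6 rfl
    have g8 : s'.mem 8 = s.mem 8 := ha.2 8 rfl
    simp only [eval_mul, eval_read, eval_reg, hr, g6, g8, mul_ne_zero_iff] at he
    refine Runs.assign_seq (T := 1) (fun hb' => hb'.1 10)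
      (Runs.assign (fun _ => by simpa using hb2) ?_)
    simp [hr, hj, he.1, he.2]
  · have g6 : s'.mem 6 = s.mem 6 := ha.2 6 rfl
    have g8 : s'.mem 8 = s.mem 8 := ha.2 8 rfl
    simp only [eval_mul, eval_read, eval_reg, hr, g6, g8, mul_eq_zero] at he
    refine Runs.skip ⟨fun h v hv h6 => ?_, hI.2⟩ |>.mono (by omega) fun _ _ h => h
    rcases Nat.lt_succ_iff_lt_or_eq.1 hv with h' | rfl
    · exact hI.1 h v h' h6
    · exact he.resolve_left h6

/-- The invariant of the flow computation: `d` is the current scale, and every cut between sources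
and sinks has lost the same amount of its capacity. -/
structure FlowInvariant (n tot d : ℕ) (src snk w c lev : ℕ → ℕ) : Prop where
  scale : d ≤ tot + 1
  total : pairSum n (entries n c) (fun _ _ => True) = tot
  cut : ∃ f, ∀ Z, Separates n src snk Z → cutSum n (entries n c) Z + f = cutSum n (entries n w) Z
  done : d = 0 → Separates n src snk (fun v => lev v ≠ 0) ∧
    cutSum n (entries n c) (fun v => lev v ≠ 0) = 0 ∧ ∀ v < n, lev v ≤ n

/-- Termination measure: if some separating cut has residual weight at most j · d, use j + size(d) ·
(2n² + 1). An augmentation lowers j by one. If no sink is reachable at scale d, the marked set has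
residual cut at most n²(d - 1) ≤ 2n² · ⌊d/2⌋, so halving d resets j to 2n² but removes one binary
digit from d. -/
theorem runs_flowStep {b n tot j : ℕ} {s : State} {w : ℕ → ℕ} (h0 : s.reg 0 = n)
    (h3 : s.reg 3 = n * n) (hn : n + 1 < 2 ^ b) (hb : 1 ≤ b) (htot : 2 * tot + 1 < 2 ^ b)
    (hsrc : ∀ v < n, s.mem 5 v ≤ 1) (hd : s.reg 9 ≠ 0)
    (hI : FlowInvariant n tot (s.reg 9) (s.mem 5) (s.mem 6) w (s.mem 7) (s.mem 8))
    (hj : ∃ Z, Separates n (s.mem 5) (s.mem 6) Z ∧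
      cutSum n (entries n (s.mem 7)) Z ≤ j * s.reg 9) :
    Runs b flowStep ((n + 1) * (n * n * 6 + 7) + n * 13 + 9) s fun s' =>
      FlowInvariant n tot (s'.reg 9) (s.mem 5) (s.mem 6) w (s'.mem 7) (s'.mem 8) ∧
      ∃ j', (s'.reg 9 ≠ 0 → ∃ Z, Separates n (s.mem 5) (s.mem 6) Z ∧
        cutSum n (entries n (s'.mem 7)) Z ≤ j' * s'.reg 9) ∧
        j' + (s'.reg 9).size * (2 * (n * n) + 1) < j + (s.reg 9).size * (2 * (n * n) + 1) := by
  refine (Runs.seq (T₂ := (n * 5 + 3) + (n * 5 + 2)) (runs_reach h0 h3 hn hb hsrc)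
    fun s₁ a₁ h₁ => Runs.seq (T₂ := n * 5 + 2) (runs_findSink ((a₁.1 0 rfl).trans h0) hb)
      fun s₂ a₂ h₂ => (Runs.cond (T := n * 5 + 1) (fun he => ?_) fun he => ?_).mono (by omega)
        fun _ _ h => h).mono (by omega) fun _ _ h => h
  all_goals
    have k0 : s₂.reg 0 = n := (a₂.1 0 rfl).trans ((a₁.1 0 rfl).trans h0)
    have k5 : s₂.mem 5 = s.mem 5 := (a₂.2 5 rfl).trans (a₁.2 5 rfl)
    have k6 : s₂.mem 6 = s.mem 6 := (a₂.2 6 rfl).trans (a₁.2 6 rfl)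
    have k7 : s₂.mem 7 = s.mem 7 := (a₂.2 7 rfl).trans (a₁.2 7 rfl)
    have k8 : s₂.mem 8 = s₁.mem 8 := a₂.2 8 rfl
    have k9 : s₂.mem 9 = s₁.mem 9 := a₂.2 9 rfl
    have kd : s₂.reg 9 = s.reg 9 := (a₂.1 9 rfl).trans (a₁.1 9 rfl)
    have m6 : s₁.mem 6 = s.mem 6 := a₁.2 6 rfl
    rw [m6] at h₂
    simp only [eval_reg] at he
  · obtain ⟨q1, q2, q3⟩ := h₂.2 he
    refine (runs_augment (tot := tot) k0 htot (kd ▸ hI.scale)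
      (by rw [kd, k5, k7, k8, k9]; exact h₁.1) q1 (by rw [k8]; exact q3) (by rw [k6]; exact q2)
      (by rw [k7]; exact hI.total)).mono le_rfl fun s' a' h' => ?_
    have l9 : s'.reg 9 = s.reg 9 := (a'.1 9 rfl).trans kd
    rw [k5, k6, k7, kd] at h'
    rw [l9]
    obtain ⟨Z, hZ, hZc⟩ := hj
    have hZ' := h'.2 Z hZ
    have hj0 : j ≠ 0 := by rintro rfl; omega
    obtain ⟨f, hf⟩ := hI.cut
    refine ⟨⟨hI.scale, h'.1, ⟨f + s.reg 9, fun Z hZ => ?_⟩, fun h => absurd h hd⟩, j - 1,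
      fun _ => ⟨Z, hZ, ?_⟩, by omega⟩
    · have := h'.2 Z hZ
      have := hf Z hZ
      omega
    · obtain ⟨i, rfl⟩ := Nat.exists_eq_succ_of_ne_zero hj0
      rw [Nat.succ_mul] at hZc
      rw [Nat.succ_sub_one]
      omega
  · have hsep : Separates n (s.mem 5) (s.mem 6) fun v => s₁.mem 8 v ≠ 0 := fun v hv =>
      ⟨h₁.1.source v hv, fun h h' => h' (h₂.1 he v hv h)⟩
    have hcut : cutSum n (entries n (s.mem 7)) (fun v => s₁.mem 8 v ≠ 0) ≤
        n * n * (s.reg 9 - 1) := by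
      rw [cutSum_eq_pairSum]
      refine pairSum_le_mul fun u hu v hv hP => ?_
      have := h₁.2 (u * n + v) (address_lt hu hv)
      rw [Leaves, mul_comm u n, Nat.mul_add_div (by omega), Nat.div_eq_of_lt hv, Nat.mul_add_mod,
        Nat.mod_eq_of_lt hv, mul_comm n u, add_zero] at this
      have : s.mem 7 (u * n + v) < s.reg 9 := not_le.1 fun h => this ⟨hP.1, not_not.1 hP.2, h⟩
      rw [entries]
      omega
    refine (Runs.assign (fun hb' => (Nat.div_le_self _ _).trans_lt (hb'.1 9)) ?_).mono (by omega)
      fun _ _ h => h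
    simp only [State.reg_setReg, State.mem_setReg, if_true, eval_div, eval_reg, eval_const, kd, k7,
      k8]
    refine ⟨⟨(Nat.div_le_self _ _).trans hI.scale, hI.total, hI.cut, fun h => ⟨hsep, ?_,
      fun v hv => h₁.1.lev_le hv⟩⟩, 2 * (n * n), fun _ => ⟨_, hsep, hcut.trans ?_⟩, ?_⟩
    -- The scale becomes 0 only from 1, and at scale 1 no positive residual capacity leaves the
    -- marked set.
    · have : s.reg 9 - 1 = 0 := by omega
      rw [this, mul_zero] at hcut
      exact Nat.le_zero.1 hcut
    · have : s.reg 9 - 1 ≤ 2 * (s.reg 9 / 2) := by omega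
      calc n * n * (s.reg 9 - 1) ≤ n * n * (2 * (s.reg 9 / 2)) := Nat.mul_le_mul_left _ this
        _ = _ := by ring
    · have hs : (s.reg 9 / 2).size + 1 ≤ (s.reg 9).size := by
        refine Nat.lt_size.2 ?_
        by_cases h2 : s.reg 9 / 2 = 0
        · rw [h2]; simpa [Nat.one_le_iff_ne_zero] using hd
        · have h3 := Nat.size_pos.2 (Nat.pos_of_ne_zero h2)
          have h4 : 2 ^ ((s.reg 9 / 2).size - 1) ≤ s.reg 9 / 2 := Nat.lt_size.1 (by omega)
          obtain ⟨i, hi⟩ := Nat.exists_eq_succ_of_ne_zero h3.ne'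
          rw [hi, Nat.succ_sub_one] at h4
          rw [hi, pow_succ]
          omega
      have := Nat.mul_le_mul_right (2 * (n * n) + 1) hs
      rw [Nat.succ_mul] at this
      omega

/-- Weak duality: all separating cuts have lost the same amount f. The residual cut of the marked
set is 0, so its original weight is f, while any other separating cut weighs f plus something
nonnegative. -/
theorem runs_minCut {b n tot : ℕ} {s : State} (h0 : s.reg 0 = n)
    (h3 : s.reg 3 = n * n) (h4 : s.reg 4 = tot) (hn : n + 1 < 2 ^ b) (hb : 1 ≤ b)
    (htot : 2 * tot + 1 < 2 ^ b) (hsrc : ∀ v < n, s.mem 5 v ≤ 1)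
    (hsum : pairSum n (entries n (s.mem 1)) (fun _ _ => True) = tot)
    (hdisj : ∀ v < n, s.mem 5 v ≠ 0 → s.mem 6 v = 0) :
    Runs b minCut ((b * (2 * (n * n) + 1) + 1) * ((n + 1) * (n * n * 6 + 7) + n * 13 + 10) +
      n * n * 3 + 4) s fun s' =>
      Separates n (s.mem 5) (s.mem 6) (fun v => s'.mem 8 v ≠ 0) ∧ (∀ v < n, s'.mem 8 v ≤ n) ∧
      ∀ Z, Separates n (s.mem 5) (s.mem 6) Z →
        cutSum n (entries n (s.mem 1)) (fun v => s'.mem 8 v ≠ 0) ≤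
          cutSum n (entries n (s.mem 1)) Z := by
  have hZ₀ : Separates n (s.mem 5) (s.mem 6) fun v => s.mem 5 v ≠ 0 := fun v hv =>
    ⟨id, fun h h' => h (hdisj v hv h')⟩
  refine (Runs.seq (T₁ := n * n * 3 + 2) (R := fun s' => ∀ e < n * n, s'.mem 7 e = s.mem 1 e)
    (T₂ := 1 + ((b * (2 * (n * n) + 1) + 1) *
      ((n + 1) * (n * n * 6 + 7) + n * 13 + 9 + 1) + 1)) ?_ fun s₁ a₁ h₁ => ?_).mono
    (by linarith) fun _ _ h => h
  · refine Runs.forTo (T := 1) (n * n) (fun j s' => ∀ e < j, s'.mem 7 e = s.mem 1 e) rfl rfl h3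
      (fun _ _ _ h => h) (fun v hv => absurd hv (Nat.not_lt_zero _)) (fun j hj s' ha hr hI => ?_)
      fun _ _ h => h
    refine Runs.write (fun hb' => hb'.2 _ _) fun v hv => ?_
    have g1 : s'.mem 1 = s.mem 1 := ha.2 1 rfl
    simp only [State.mem_setMem_same, eval_reg, eval_read, hr, g1]
    split_ifs with h
    · rw [h]
    · exact hI v (by omega)
  · have g0 : s₁.reg 0 = n := (a₁.1 0 rfl).trans h0
    have g3 : s₁.reg 3 = n * n := (a₁.1 3 rfl).trans h3
    have g4 : s₁.reg 4 = tot := (a₁.1 4 rfl).trans h4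
    have g5 : s₁.mem 5 = s.mem 5 := a₁.2 5 rfl
    have g6 : s₁.mem 6 = s.mem 6 := a₁.2 6 rfl
    have hent : ∀ u < n, ∀ v < n, entries n (s₁.mem 7) u v = entries n (s.mem 1) u v :=
      fun u hu v hv => h₁ _ (address_lt hu hv)
    have hcut : ∀ Z, cutSum n (entries n (s₁.mem 7)) Z = cutSum n (entries n (s.mem 1)) Z :=
      fun Z => cutSum_congr hent fun _ _ => Iff.rfl
    have htot₁ : pairSum n (entries n (s₁.mem 7)) (fun _ _ => True) = tot :=
      (pairSum_congr hent).trans hsum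
    refine Runs.assign_seq (fun _ => by simp only [eval_add, eval_reg, eval_one, g4]; omega)
      (Runs.loop (fun k s' =>
        FlowInvariant n tot (s'.reg 9) (s.mem 5) (s.mem 6) (s.mem 1) (s'.mem 7) (s'.mem 8) ∧
        ∃ j', (s'.reg 9 ≠ 0 → ∃ Z, Separates n (s.mem 5) (s.mem 6) Z ∧
          cutSum n (entries n (s'.mem 7)) Z ≤ j' * s'.reg 9) ∧
          j' + (s'.reg 9).size * (2 * (n * n) + 1) ≤ k) _ ?_ (fun k s' ha hI he => ?_)
      fun k s' ha hI he => ?_)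
    · simp only [eval_add, eval_reg, eval_one, g4, State.reg_setReg, State.mem_setReg, if_true]
      refine ⟨⟨le_rfl, htot₁, ⟨0, fun Z _ => by rw [hcut, add_zero]⟩,
        fun h => absurd h (Nat.succ_ne_zero _)⟩, 1, fun _ => ⟨_, hZ₀, ?_⟩, ?_⟩
      -- The initial scale tot + 1 exceeds the weight of every cut, so j = 1 is a valid start.
      · have := cutSum_le_total n (entries n (s₁.mem 7)) fun v => s.mem 5 v ≠ 0
        omega
      · have : (tot + 1).size ≤ b := Nat.size_le.2 (by omega)
        have := Nat.mul_le_mul_right (2 * (n * n) + 1) this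
        omega
    · obtain ⟨hI, j, hj, hk⟩ := hI
      have k0 : s'.reg 0 = n := (ha.1 0 rfl).trans g0
      have k3 : s'.reg 3 = n * n := (ha.1 3 rfl).trans g3
      have k5 : s'.mem 5 = s.mem 5 := (ha.2 5 rfl).trans g5
      have k6 : s'.mem 6 = s.mem 6 := (ha.2 6 rfl).trans g6
      refine (runs_flowStep (j := j) k0 k3 hn hb htot (by rw [k5]; exact hsrc) he
        (by rw [k5, k6]; exact hI) (by rw [k5, k6]; exact hj he)).mono le_rfl fun s'' _ h => ?_
      rw [k5, k6] at h
      obtain ⟨h1, j', h2, h3⟩ := h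
      exact ⟨_, by omega, h1, j', h2, le_rfl⟩
    · obtain ⟨hsep, hzero, hlev⟩ := hI.1.done he
      obtain ⟨f, hf⟩ := hI.1.cut
      refine ⟨hsep, hlev, fun Z hZ => ?_⟩
      have h1 := hf _ hsep
      have h2 := hf Z hZ
      omega

/-! ### The best balanced cut -/

/-- The data that are computed at the beginning and never changed. -/
structure Context (n k m tot : ℕ) (s : State) : Prop where
  reg_zero : s.reg 0 = n
  reg_one : s.reg 1 = k
  reg_two : s.reg 2 = m
  reg_three : s.reg 3 = n * n
  reg_four : s.reg 4 = tot
  total : pairSum n (entries n (s.mem 1)) (fun _ _ => True) = tot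
  pow : ∀ v ≤ n, s.mem 3 v = 2 ^ v

/-- The program does not modify the data of the context. -/
def Program.keepsContext (p : Program) : Bool :=
  p.keepsReg 0 && p.keepsReg 1 && p.keepsReg 2 && p.keepsReg 3 && p.keepsReg 4 && p.keepsMem 1 &&
    p.keepsMem 3

theorem Context.agrees {n k m tot : ℕ} {p : Program} {s s' : State} (h : Context n k m tot s)
    (ha : p.Agrees s s') (hk : p.keepsContext = true) : Context n k m tot s' := by
  simp only [Program.keepsContext, Bool.and_eq_true] at hk
  obtain ⟨⟨⟨⟨⟨⟨k0, k1⟩, k2⟩, k3⟩, k4⟩, m1⟩, m3⟩ := hk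
  exact ⟨(ha.1 _ k0).trans h.1, (ha.1 _ k1).trans h.2, (ha.1 _ k2).trans h.3,
    (ha.1 _ k3).trans h.4, (ha.1 _ k4).trans h.5, by rw [ha.2 _ m1]; exact h.6,
    by rw [ha.2 _ m3]; exact h.7⟩

/-- The binary digit of `x` at the power `p` of two. -/
def Expr.bit (x p : Expr) : Expr := rem (x / p) (const 2)

theorem Expr.eval_bit (s : State) (x p : Expr) {v : ℕ} (h : p.eval s = 2 ^ v) :
    (bit x p).eval s = ((x.eval s).testBit v).toNat := by
  rw [bit, eval_rem, eval_div, eval_const, h, Nat.toNat_testBit]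

/-- Read off sources and sinks from the mask in register `7`, and count the sources. -/
def setup : Program :=
  assign 8 0 ;; forTo 10 0 (write 5 (reg 10) (bit (reg 7) (read 3 (reg 10))) ;;
    write 6 (reg 10) ((1 - read 5 (reg 10)) * (1 - (reg 10 + 1 - reg 2))) ;;
    assign 8 (reg 8 + read 5 (reg 10)))

/-- The difference `reg 10 + 1 - reg 2` vanishes exactly for vertices below m, so the others are
never sinks and stay free for the minimum cut. -/
theorem runs_setup {b n k m tot : ℕ} {s : State} (hs : Context n k m tot s) (hn : n + 1 < 2 ^ b) :
    Runs b setup (n * 5 + 3) s fun s' =>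
      (∀ v < n, s'.mem 5 v = ((s.reg 7).testBit v).toNat ∧
        (s'.mem 6 v ≠ 0 ↔ v < m ∧ (s.reg 7).testBit v = false)) ∧
      s'.reg 8 = countBelow n fun v => (s.reg 7).testBit v = true := by
  refine (Runs.assign_seq (fun _ => by simp) (Runs.forTo (i := 10) (rN := 0) (T := 3) n
    (fun j s' => (∀ v < j, s'.mem 5 v = ((s.reg 7).testBit v).toNat ∧
        (s'.mem 6 v ≠ 0 ↔ v < m ∧ (s.reg 7).testBit v = false)) ∧
      s'.reg 8 = countBelow j fun v => (s.reg 7).testBit v = true)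
    rfl rfl (by simpa using hs.reg_zero) (fun _ _ _ h => h)
    ⟨fun v hv => absurd hv (Nat.not_lt_zero _), by simp [countBelow]⟩
    (fun j hj s' ha hr hI => ?_)
    (fun _ _ h => h))).mono (by omega) fun _ _ h => h
  have g2 : s'.reg 2 = m := (ha.1 2 rfl).trans hs.reg_two
  have g7 : s'.reg 7 = s.reg 7 := ha.1 7 rfl
  have g3 : s'.mem 3 = s.mem 3 := ha.2 3 rfl
  have hbit : (bit (reg 7) (read 3 (reg 10))).eval s' = ((s.reg 7).testBit j).toNat := by
    rw [eval_bit s' (reg 7) _ (v := j), eval_reg, g7]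
    rw [eval_read, eval_reg, hr, g3, hs.pow j hj.le]
  have hle : ((s.reg 7).testBit j).toNat ≤ 1 := Bool.toNat_le _
  refine Runs.write_seq (T := 2) (fun _ => by omega) (Runs.write_seq (T := 1) (fun _ => ?_)
    (Runs.assign (fun _ => ?_) ?_))
  · simp only [eval_mul, eval_sub, eval_one, eval_add, eval_reg]
    exact (Nat.mul_le_mul (Nat.sub_le 1 _) (Nat.sub_le 1 _)).trans_lt (by omega)
  · have := countBelow_le j fun v => (s.reg 7).testBit v = true
    simp only [eval_add, eval_reg, State.reg_setMem, eval_read, hr, hI.2,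
      State.mem_setMem_of_ne _ _ _ _ (by decide : 5 ≠ 6), State.mem_setMem_same, if_true, hbit]
    omega
  · simp only [eval_add, eval_reg, State.reg_setMem, eval_read, hr, hI.2, eval_mul, eval_sub,
      eval_one, g2, State.mem_setReg, State.reg_setReg,
      State.mem_setMem_of_ne _ _ _ _ (by decide : 5 ≠ 6),
      State.mem_setMem_of_ne _ _ _ _ (by decide : 6 ≠ 5), State.mem_setMem_same, if_true, hbit]
    refine ⟨fun v hv => ?_, ?_⟩
    · rcases Nat.lt_succ_iff_lt_or_eq.1 hv with h | rfl
      · rw [if_neg h.ne, if_neg h.ne]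
        exact hI.1 v h
      · simp only [if_true, true_and, mul_ne_zero_iff]
        cases (s.reg 7).testBit v <;> simp
        omega
    · rw [countBelow_succ]
      cases (s.reg 7).testBit j <;> simp

/-- Compute the weight of the cut between the marked and the unmarked vertices. -/
def evalCut : Program :=
  assign 14 0 ;; forTo 10 3
    (.cond (read 8 (reg 10 / reg 0) * (1 - read 8 (rem (reg 10) (reg 0))))
      (assign 14 (reg 14 + read 1 (reg 10))) skip)

theorem runs_evalCut {b n k m tot : ℕ} {s : State} (hs : Context n k m tot s)
    (htot : 2 * tot + 1 < 2 ^ b) :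
    Runs b evalCut (n * n * 4 + 3) s fun s' =>
      s'.reg 14 = cutSum n (entries n (s.mem 1)) fun v => s.mem 8 v ≠ 0 := by
  classical
  set f : ℕ → ℕ := fun e => if s.mem 8 (e / n) ≠ 0 ∧ ¬s.mem 8 (e % n) ≠ 0 then
    entries n (s.mem 1) (e / n) (e % n) else 0 with hf
  have hfull : ∑ e ∈ Finset.range (n * n), f e =
      cutSum n (entries n (s.mem 1)) fun v => s.mem 8 v ≠ 0 := by
    rw [cutSum_eq_sum_range_mul]
    exact Finset.sum_congr rfl fun e _ => by simp only [hf]; congr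
  have hle := cutSum_le_total n (entries n (s.mem 1)) fun v => s.mem 8 v ≠ 0
  rw [hs.total] at hle
  rw [← hfull] at hle ⊢
  refine (Runs.assign_seq (fun _ => by simp) (Runs.forTo (i := 10) (rN := 3) (T := 2) (n * n)
    (fun j s' => s'.reg 14 = ∑ e ∈ Finset.range j, f e)
    rfl rfl (by simpa using hs.reg_three) (fun _ _ _ h => h) (by simp)
    (fun j hj s' ha hr hI => ?_) (fun _ _ h => h))).mono (by omega) fun _ _ h => h
  have g0 : s'.reg 0 = n := (ha.1 0 rfl).trans hs.reg_zero
  have g8 : s'.mem 8 = s.mem 8 := ha.2 8 rfl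
  have g1 : s'.mem 1 = s.mem 1 := ha.2 1 rfl
  have hfj : f j = if s.mem 8 (j / n) ≠ 0 ∧ ¬s.mem 8 (j % n) ≠ 0 then s.mem 1 j else 0 := by
    simp only [hf, entries, Nat.div_add_mod']
  have hsucc := Finset.sum_range_succ f j
  refine Runs.cond (T := 1) (fun he => ?_) fun he => ?_
  · simp only [eval_mul, eval_read, eval_div, eval_reg, eval_sub, eval_one, eval_rem, hr, g0, g8,
      mul_ne_zero_iff] at he
    rw [if_pos ⟨he.1, by omega⟩] at hfj
    have hval : (reg 14 + read 1 (reg 10)).eval s' = ∑ e ∈ Finset.range (j + 1), f e := by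
      simp only [eval_add, eval_reg, eval_read, hr, g1, hI]
      omega
    refine Runs.assign (fun _ => ?_) ?_
    · rw [hval]
      have : ∑ e ∈ Finset.range (j + 1), f e ≤ ∑ e ∈ Finset.range (n * n), f e :=
        Finset.sum_le_sum_of_subset (Finset.range_subset_range.2 hj)
      omega
    · simp only [State.reg_setReg, if_true, hval]
  · simp only [eval_mul, eval_read, eval_div, eval_reg, eval_sub, eval_one, eval_rem, hr, g0, g8,
      mul_eq_zero] at he
    rw [if_neg fun h => by omega] at hfj
    refine Runs.skip ?_
    rw [hI]
    omega

/-- Process the mask in register `7`. -/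
def enumBody : Program :=
  setup ;; .cond ((reg 8 + 1 - reg 1) * (reg 2 + 1 - (reg 8 + reg 1)))
    (minCut ;; evalCut ;; .cond (reg 6 - reg 14)
      (assign 6 (reg 14) ;; forTo 10 0 (write 4 (reg 10) (1 - (1 - read 8 (reg 10))))) skip) skip

/-- The cut stored in array `4` has value `best` and is at least as good as the cuts of the
balanced sets with property `P`. -/
structure BestCut (n k m tot best : ℕ) (w flag : ℕ → ℕ) (P : (ℕ → Prop) → Prop) : Prop where
  le : best ≤ tot + 1
  best_le : ∀ Z, P Z → k ≤ countBelow m Z → countBelow m Z + k ≤ m → best ≤ cutSum n (entries n w) Z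
  attained : best ≤ tot → (∀ v < n, flag v ≤ 1) ∧ k ≤ countBelow n (fun v => flag v ≠ 0) ∧
    countBelow n (fun v => flag v ≠ 0) + k ≤ n ∧
    cutSum n (entries n w) (fun v => flag v ≠ 0) = best

theorem countBelow_mono_right {m n : ℕ} (h : m ≤ n) (Z : ℕ → Prop) :
    countBelow m Z ≤ countBelow n Z := by
  classical
  rw [countBelow_add_card h]
  omega

/-- The time for processing one mask. -/
def enumTime (b n : ℕ) : ℕ :=
  (b * (2 * (n * n) + 1) + 1) * ((n + 1) * (n * n * 6 + 7) + n * 13 + 10) + n * n * 7 + n * 8 + 15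

/-- The sets separating these sources and sinks are exactly those whose trace on the first m
vertices is the mask, so one minimum cut settles the whole class. An unbalanced mask makes the test
product zero; its class imposes nothing on `best_le`. -/
theorem runs_enumBody {b n k m tot : ℕ} {s : State} {P : (ℕ → Prop) → Prop}
    (hs : Context n k m tot s) (hmn : m ≤ n) (hn : n + 1 < 2 ^ b) (hb : 1 ≤ b)
    (htot : 2 * tot + 1 < 2 ^ b) (hmask : s.reg 7 < 2 ^ m)
    (hI : BestCut n k m tot (s.reg 6) (s.mem 1) (s.mem 4) P) :
    Runs b enumBody (enumTime b n) s fun s' =>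
      BestCut n k m tot (s'.reg 6) (s.mem 1) (s'.mem 4) fun Z =>
        P Z ∨ ∀ v < m, (Z v ↔ (s.reg 7).testBit v = true) := by
  set M := s.reg 7 with hM
  have hcount : countBelow n (fun v => M.testBit v = true) =
      countBelow m fun v => M.testBit v = true := by
    refine le_antisymm ?_ (countBelow_mono_right hmn _)
    classical
    refine Finset.card_le_card fun v hv => ?_
    simp only [Finset.mem_filter, Finset.mem_range] at hv ⊢
    exact ⟨lt_of_testBit hmask hv.2, hv.2⟩
  refine (Runs.seq (T₂ := 1 + ((((b * (2 * (n * n) + 1) + 1) *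
    ((n + 1) * (n * n * 6 + 7) + n * 13 + 10) + n * n * 3 + 4)) +
      ((n * n * 4 + 3) + (1 + (1 + (n * 3 + 2)))))) (runs_setup hs hn) fun s₁ a₁ h₁ =>
      Runs.cond (fun he => ?_) fun he => ?_).mono (by rw [enumTime]; linarith) fun _ _ h => h
  all_goals
    have c₁ : Context n k m tot s₁ := hs.agrees a₁ rfl
    have m1 : s₁.mem 1 = s.mem 1 := a₁.2 1 rfl
    have m4 : s₁.mem 4 = s.mem 4 := a₁.2 4 rfl
    have r6 : s₁.reg 6 = s.reg 6 := a₁.1 6 rfl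
    simp only [eval_mul, eval_sub, eval_add, eval_reg, eval_one, c₁.reg_one, c₁.reg_two, h₁.2,
      hcount, ← hM] at he
  · rw [mul_ne_zero_iff] at he
    refine Runs.seq (runs_minCut c₁.reg_zero c₁.reg_three c₁.reg_four hn hb htot
      (fun v hv => (h₁.1 v hv).1 ▸ Bool.toNat_le _) c₁.total fun v hv h => ?_) fun s₂ a₂ h₂ =>
        Runs.seq (runs_evalCut (c₁.agrees a₂ rfl) htot) fun s₃ a₃ h₃ => ?_
    · by_contra h'
      have h1 := ((h₁.1 v hv).2.1 h').2
      rw [(h₁.1 v hv).1, ← hM, h1] at h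
      exact h rfl
    have n1 : s₂.mem 1 = s.mem 1 := (a₂.2 1 rfl).trans m1
    have q1 : s₃.mem 1 = s.mem 1 := (a₃.2 1 rfl).trans n1
    have q4 : s₃.mem 4 = s.mem 4 := (a₃.2 4 rfl).trans ((a₂.2 4 rfl).trans m4)
    have q8 : s₃.mem 8 = s₂.mem 8 := a₃.2 8 rfl
    have q6 : s₃.reg 6 = s.reg 6 := (a₃.1 6 rfl).trans ((a₂.1 6 rfl).trans r6)
    have q0 : s₃.reg 0 = n := (a₃.1 0 rfl).trans ((a₂.1 0 rfl).trans c₁.reg_zero)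
    rw [m1] at h₂
    rw [n1] at h₃
    obtain ⟨hsep, hlev, hmin⟩ := h₂
    have hbest : ∀ Z : ℕ → Prop, (∀ v < m, (Z v ↔ M.testBit v = true)) →
        s₃.reg 14 ≤ cutSum n (entries n (s.mem 1)) Z := fun Z hZ => by
      rw [h₃]
      refine hmin Z fun v hv => ⟨fun h => ?_, fun h h' => ?_⟩
      · rw [(h₁.1 v hv).1] at h
        have hbit : M.testBit v = true := by
          by_contra h'
          rw [Bool.not_eq_true] at h'
          rw [← hM, h'] at h
          exact h rfl
        exact (hZ v (lt_of_testBit hmask hbit)).2 hbit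
      · obtain ⟨h1, h2⟩ := (h₁.1 v hv).2.1 h
        rw [(hZ v h1).1 h'] at h2
        exact absurd h2 (by simp)
    -- The minimum cut contains the mask and avoids its complement below m, so each side inherits at
    -- least k vertices. This bounds the larger side by n - k.
    have hk1 : countBelow m (fun v => M.testBit v = true) ≤
        countBelow n fun v => s₂.mem 8 v ≠ 0 := by
      rw [← hcount]
      refine countBelow_mono fun v hv h => (hsep v hv).1 ?_
      rw [(h₁.1 v hv).1, ← hM, h]
      simp
    have hk2 : countBelow m (fun v => ¬M.testBit v = true) ≤
        countBelow n fun v => ¬s₂.mem 8 v ≠ 0 := by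
      refine le_trans (countBelow_mono fun v hv h => (hsep v (by omega)).2 ?_)
        (countBelow_mono_right hmn _)
      exact (h₁.1 v (by omega)).2.2 ⟨hv, by simpa using h⟩
    have hk3 := countBelow_not m fun v => M.testBit v = true
    have hk4 := countBelow_not n fun v => s₂.mem 8 v ≠ 0
    refine Runs.cond (T := 1 + (n * 3 + 2)) (fun hlt => ?_) fun hlt => ?_
    · simp only [eval_sub, eval_reg, q6] at hlt
      refine Runs.assign_seq (fun hb' => hb'.1 14) (Runs.forTo (i := 10) (rN := 0) (T := 1) n
        (fun j s' => s'.reg 6 = s₃.reg 14 ∧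
          ∀ v < j, s'.mem 4 v = 1 - (1 - s₂.mem 8 v)) rfl rfl (by simpa using q0)
        (fun _ _ _ h => h) ⟨by simp, fun v hv => absurd hv (Nat.not_lt_zero _)⟩
        (fun j hj s' ha hr hI' => Runs.write (fun _ => ?_) ⟨?_, fun v hv => ?_⟩) fun s' ha h' => ?_)
      · simp only [eval_sub, eval_one]
        exact (Nat.sub_le _ _).trans_lt (by omega)
      · exact hI'.1
      · have g8 : s'.mem 8 = s₂.mem 8 := (ha.2 8 rfl).trans q8
        simp only [State.mem_setMem_same, eval_reg, eval_read, hr, g8, eval_sub, eval_one]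
        split_ifs with h
        · rw [h]
        · exact hI'.2 v (by omega)
      · have hflag : ∀ v < n, (s'.mem 4 v ≠ 0 ↔ s₂.mem 8 v ≠ 0) := fun v hv => by
          rw [h'.2 v hv]; omega
        rw [h'.1]
        refine ⟨by have := hI.le; omega, fun Z hZ h1 h2 => ?_, fun _ => ⟨fun v hv => ?_, ?_, ?_, ?_⟩⟩
        · rcases hZ with hZ | hZ
          · have := hI.best_le Z hZ h1 h2
            omega
          · exact hbest Z hZ
        · rw [h'.2 v hv]; omega
        · rw [countBelow_congr hflag]; omega
        · rw [countBelow_congr hflag]; omega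
        · rw [cutSum_congr (fun _ _ _ _ => rfl) hflag, h₃]
    · simp only [eval_sub, eval_reg, q6] at hlt
      refine Runs.skip ?_ |>.mono (by omega) fun _ _ h => h
      rw [q6, q4]
      refine ⟨hI.le, fun Z hZ h1 h2 => ?_, hI.attained⟩
      rcases hZ with hZ | hZ
      · exact hI.best_le Z hZ h1 h2
      · have := hbest Z hZ
        omega
  · refine Runs.skip ?_ |>.mono (by omega) fun _ _ h => h
    rw [m4, r6]
    refine ⟨hI.le, fun Z hZ h1 h2 => ?_, hI.attained⟩
    rcases hZ with hZ | hZ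
    · exact hI.best_le Z hZ h1 h2
    · rw [countBelow_congr hZ] at h1 h2
      rw [mul_eq_zero] at he
      omega

/-- Compute the best balanced cut. -/
def bestCut : Program := assign 6 (reg 4 + 1) ;; forTo 7 5 enumBody

/-- Every set has some mask below 2^m as its trace, so the enumeration is exhaustive. The initial
value tot + 1 plays the role of infinity. -/
theorem runs_bestCut {b n k m tot : ℕ} {s : State} (hs : Context n k m tot s) (hmn : m + k = n)
    (hkm : 2 * k ≤ m) (h5 : s.reg 5 = 2 ^ m) (hn : n + 1 < 2 ^ b) (hb : 1 ≤ b)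
    (htot : 2 * tot + 1 < 2 ^ b) :
    Runs b bestCut (2 ^ m * (enumTime b n + 2) + 3) s fun s' =>
      BestCut n k m tot (s'.reg 6) (s.mem 1) (s'.mem 4) (fun _ => True) ∧ s'.reg 6 ≤ tot := by
  refine (Runs.assign_seq (fun _ => ?_) (Runs.forTo (i := 7) (rN := 5) (T := enumTime b n) (2 ^ m)
    (fun j s' => BestCut n k m tot (s'.reg 6) (s.mem 1) (s'.mem 4) fun Z =>
      ∃ M < j, ∀ v < m, (Z v ↔ M.testBit v = true)) rfl rfl (by simpa using h5)
    (fun _ _ _ h => h) ?_ (fun j hj s' ha hr hI => ?_) fun s' ha h => ?_)).mono (by omega)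
    fun _ _ h => h
  · simp only [eval_add, eval_reg, eval_one, hs.reg_four]; omega
  · simp only [eval_add, eval_reg, eval_one, hs.reg_four, State.reg_setReg, if_true]
    exact ⟨le_rfl, fun Z ⟨M, hM, _⟩ => absurd hM (Nat.not_lt_zero _), fun h => by omega⟩
  · have c' : Context n k m tot s' := (hs.agrees (p := bestCut) (s' := s') ⟨fun r hr => by
      simp only [bestCut, keepsReg, Bool.and_eq_true, bne_iff_ne] at hr
      rw [ha.1 r hr.2, State.reg_setReg, if_neg (Ne.symm hr.1)], fun r hr => by
      simp only [bestCut, keepsMem, Bool.and_eq_true] at hr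
      rw [ha.2 r hr.2, State.mem_setReg]⟩ rfl)
    have g1 : s'.mem 1 = s.mem 1 := ha.2 1 rfl
    refine (runs_enumBody c' (by omega) hn hb htot (by rw [hr]; exact hj)
      (by rw [g1]; exact hI)).mono le_rfl fun s'' _ h => ?_
    rw [g1, hr] at h
    refine ⟨h.le, fun Z ⟨M, hM, hZ⟩ => h.best_le Z ?_, h.attained⟩
    rcases Nat.lt_succ_iff_lt_or_eq.1 hM with hlt | rfl
    · exact Or.inl ⟨M, hlt, hZ⟩
    · exact Or.inr hZ
  · have hall : BestCut n k m tot (s'.reg 6) (s.mem 1) (s'.mem 4) fun _ => True :=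
      ⟨h.le, fun Z _ => h.best_le Z (by
        obtain ⟨M, hM, hZ⟩ := exists_mask m Z
        exact ⟨M, hM, fun v hv => (hZ v hv).symm⟩), h.attained⟩
    refine ⟨hall, ?_⟩
    -- The set of the first k vertices is balanced because 2k ≤ m, so the infinite value cannot
    -- survive.
    have hk : countBelow m (fun v => v < k) = k :=
      (congrArg Finset.card (Finset.ext fun v => by
        simp only [Finset.mem_filter, Finset.mem_range]; omega)).trans (Finset.card_range k)
    refine (hall.best_le (fun v => v < k) trivial hk.ge (by omega)).trans ?_
    have := cutSum_le_total n (entries n (s.mem 1)) fun v => v < k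
    rwa [hs.total] at this

/-! ### The subset table -/

/-- The table `D` with choices `ch` is correct below `t`. -/
structure Table (r B t : ℕ) (V : ℕ → ℕ → ℕ) (D ch : ℕ → ℕ) : Prop where
  zero : 0 < t → D 0 = 0
  choice : ∀ M < t, M ≠ 0 → ch M < r ∧ M.testBit (ch M) = true ∧
    D M = D (M - 2 ^ ch M) + cutSum r V fun i => M.testBit i = false
  bellman : ∀ M < t, ∀ j < r, M.testBit j = true →
    D M ≤ D (M - 2 ^ j) + cutSum r V fun i => M.testBit i = false
  le : ∀ M < t, D M ≤ M * B

/-- Removing a vertex gives a numerically smaller mask, so filling in increasing order meets every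
dependency, and entry t does not disturb the equations below t. The same fact gives the crude bound
M · B, used only to limit the length of entries. -/
theorem Table.update {r B t x c : ℕ} {V : ℕ → ℕ → ℕ} {D ch : ℕ → ℕ} (h : Table r B t V D ch)
    (h0 : t = 0 → x = 0)
    (hc : t ≠ 0 → c < r ∧ t.testBit c = true ∧
      x = D (t - 2 ^ c) + cutSum r V fun i => t.testBit i = false)
    (hx : ∀ j < r, t.testBit j = true →
      x ≤ D (t - 2 ^ j) + cutSum r V fun i => t.testBit i = false)
    (hV : (cutSum r V fun i => t.testBit i = false) ≤ B) :
    Table r B (t + 1) V (Function.update D t x) (Function.update ch t c) := by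
  have hsub : ∀ M j, M.testBit j = true → M - 2 ^ j < M := fun M j hj =>
    Nat.sub_lt ((two_pow_le_of_testBit hj).trans_lt' (by positivity)) (by positivity)
  refine ⟨fun _ => ?_, fun M hM hM0 => ?_, fun M hM j hj hb => ?_, fun M hM => ?_⟩
  · rw [Function.update_apply]; split_ifs with h'
    · exact h0 h'.symm
    · exact h.zero (by omega)
  · rcases Nat.lt_succ_iff_lt_or_eq.1 hM with hlt | rfl
    · obtain ⟨h1, h2, h3⟩ := h.choice M hlt hM0
      have := hsub _ _ h2
      rw [Function.update_of_ne hlt.ne, Function.update_of_ne hlt.ne,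
        Function.update_of_ne (by omega)]
      exact ⟨h1, h2, h3⟩
    · obtain ⟨h1, h2, h3⟩ := hc hM0
      have := hsub _ _ h2
      rw [Function.update_self, Function.update_self, Function.update_of_ne (by omega)]
      exact ⟨h1, h2, h3⟩
  · have := hsub _ _ hb
    rcases Nat.lt_succ_iff_lt_or_eq.1 hM with hlt | rfl
    · rw [Function.update_of_ne hlt.ne, Function.update_of_ne (by omega)]
      exact h.bellman M hlt j hj hb
    · rw [Function.update_self, Function.update_of_ne (by omega)]
      exact hx j hj hb
  · rcases Nat.lt_succ_iff_lt_or_eq.1 hM with hlt | rfl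
    · rw [Function.update_of_ne hlt.ne]
      exact h.le M hlt
    · rw [Function.update_self]
      rcases Nat.eq_zero_or_pos M with rfl | hpos
      · simp [h0 rfl]
      · obtain ⟨h1, h2, h3⟩ := hc hpos.ne'
        have h4 := hsub _ _ h2
        have h5 := h.le _ h4
        obtain ⟨i, rfl⟩ := Nat.exists_eq_succ_of_ne_zero hpos.ne'
        have h6 := Nat.mul_le_mul_right B (Nat.lt_succ_iff.1 h4)
        rw [h3, Nat.succ_mul]
        omega

/-- The weights between the listed vertices from index `base` on. -/
def listed (n base : ℕ) (w el : ℕ → ℕ) (i j : ℕ) : ℕ :=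
  entries n w (el (base + i)) (el (base + j))

/-- Compare the best value found so far with the value for the last vertex of index `reg 24`. -/
def chooseBody : Program :=
  .cond (bit (reg 23) (read 3 (reg 24)) *
      ((1 - reg 25) + (reg 25 - (read 11 (reg 23 - read 3 (reg 24)) + 1))))
    (assign 25 (read 11 (reg 23 - read 3 (reg 24)) + 1) ;; assign 26 (reg 24)) skip

/-- Add the weight of the pair with number `reg 24` to the weight of the cut. -/
def cutBody : Program :=
  .cond ((1 - bit (reg 23) (read 3 (reg 24 / reg 21))) *
      bit (reg 23) (read 3 (rem (reg 24) (reg 21))))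
    (assign 27 (reg 27 + read 1 (read 10 (reg 20 + reg 24 / reg 21) * reg 0 +
      read 10 (reg 20 + rem (reg 24) (reg 21))))) skip

/-- Compute the table entry for the mask in register `23`. -/
def tableBody : Program :=
  assign 25 0 ;; forTo 24 21 chooseBody ;; assign 27 0 ;; forTo 24 28 cutBody ;;
    write 11 (reg 23) (reg 25 - 1 + reg 27) ;; write 12 (reg 23) (reg 26)

/-- Register `25` holds one more than the least predecessor value found so far, with 0 meaning that
there is none yet. -/
theorem runs_choose {b n r : ℕ} {s : State} (h21 : s.reg 21 = r)
    (hpow : ∀ v ≤ n, s.mem 3 v = 2 ^ v) (hr : r ≤ n) (h25 : s.reg 25 = 0)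
    (hD : ∀ M < s.reg 23, s.mem 11 M + 1 < 2 ^ b) :
    Runs b (forTo 24 21 chooseBody) (r * 5 + 2) s fun s' =>
      (s'.reg 25 = 0 → ∀ i < r, (s.reg 23).testBit i = false) ∧
      (s'.reg 25 ≠ 0 → s'.reg 26 < r ∧ (s.reg 23).testBit (s'.reg 26) = true ∧
        s'.reg 25 = s.mem 11 (s.reg 23 - 2 ^ s'.reg 26) + 1) ∧
      ∀ i < r, (s.reg 23).testBit i = true → s'.reg 25 ≤ s.mem 11 (s.reg 23 - 2 ^ i) + 1 := by
  set M := s.reg 23 with hM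
  refine Runs.forTo (T := 3) r (fun t s' =>
      (s'.reg 25 = 0 → ∀ i < t, M.testBit i = false) ∧
      (s'.reg 25 ≠ 0 → s'.reg 26 < r ∧ M.testBit (s'.reg 26) = true ∧
        s'.reg 25 = s.mem 11 (M - 2 ^ s'.reg 26) + 1) ∧
      ∀ i < t, M.testBit i = true → s'.reg 25 ≤ s.mem 11 (M - 2 ^ i) + 1) rfl rfl h21
    (fun _ _ _ h => h) ⟨fun _ v hv => absurd hv (Nat.not_lt_zero _), fun h => absurd h25 h,
      fun v hv => absurd hv (Nat.not_lt_zero _)⟩ (fun t ht s' ha hreg hI => ?_) fun _ _ h => h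
  obtain ⟨i1, i2, i3⟩ := hI
  have g23 : s'.reg 23 = M := ha.1 23 rfl
  have g3 : s'.mem 3 t = 2 ^ t := (congrFun (ha.2 3 rfl) t).trans (hpow t (by omega))
  have g11 : s'.mem 11 = s.mem 11 := ha.2 11 rfl
  have hbit : (bit (reg 23) (read 3 (reg 24))).eval s' = (M.testBit t).toNat := by
    rw [eval_bit s' (reg 23) _ (v := t), eval_reg, g23]
    rw [eval_read, eval_reg, hreg, g3]
  have hval : (read 11 (reg 23 - read 3 (reg 24)) + 1).eval s' = s.mem 11 (M - 2 ^ t) + 1 := by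
    simp only [eval_add, eval_read, eval_sub, eval_reg, eval_one, g11, g23, hreg, g3]
  refine Runs.cond (T := 2) (fun he => ?_) fun he => ?_
  all_goals
    simp only [eval_mul, hbit, eval_add _ (1 - reg 25), eval_sub _ (reg 25) (_ + _), hval, eval_sub,
      eval_one, eval_reg] at he
  · rw [mul_ne_zero_iff] at he
    have hb : M.testBit t = true := by
      by_contra h
      rw [Bool.not_eq_true] at h
      rw [h] at he
      exact he.1 rfl
    have hlt : M - 2 ^ t < M := Nat.sub_lt ((two_pow_le_of_testBit hb).trans_lt' (by positivity))
      (by positivity)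
    refine Runs.assign_seq (T := 1) (fun _ => by rw [hval]; exact hD _ hlt)
      (Runs.assign (fun hb' => hb'.1 24) ?_)
    rw [hval]
    simp only [State.reg_setReg, eval_reg, Nat.reduceEqDiff, if_true, if_false, hreg]
    refine ⟨fun h => h.elim, fun _ => ⟨ht, hb, trivial⟩, fun i hi hib => ?_⟩
    rcases Nat.lt_succ_iff_lt_or_eq.1 hi with hlt | rfl
    · have h1 := i3 i hlt hib
      have h2 : s'.reg 25 ≠ 0 := fun h => by rw [i1 h i hlt] at hib; exact absurd hib (by simp)
      omega
    · exact le_rfl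
  · refine Runs.skip ⟨fun h i hi => ?_, i2, fun i hi hib => ?_⟩ |>.mono (by omega) fun _ _ h => h
    · rcases Nat.lt_succ_iff_lt_or_eq.1 hi with hlt | rfl
      · exact i1 h i hlt
      · rcases mul_eq_zero.1 he with h' | h'
        · exact Bool.toNat_eq_zero.1 h'
        · omega
    · rcases Nat.lt_succ_iff_lt_or_eq.1 hi with hlt | rfl
      · exact i3 i hlt hib
      · rw [hib] at he
        simp only [Bool.toNat_true] at he
        omega

theorem runs_cut {b n k m tot r base : ℕ} {s : State} (hs : Context n k m tot s)
    (h20 : s.reg 20 = base) (h21 : s.reg 21 = r) (h28 : s.reg 28 = r * r) (h27 : s.reg 27 = 0)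
    (hel : ∀ i < n, s.mem 10 i < n) (hbr : base + r ≤ n) (hB : n * n * tot + 1 < 2 ^ b) :
    Runs b (forTo 24 28 cutBody) (r * r * 4 + 2) s fun s' =>
      s'.reg 27 = cutSum r (listed n base (s.mem 1) (s.mem 10)) fun i =>
        (s.reg 23).testBit i = false := by
  classical
  set M := s.reg 23 with hM
  set V := listed n base (s.mem 1) (s.mem 10) with hV
  set f : ℕ → ℕ := fun e => if M.testBit (e / r) = false ∧ ¬M.testBit (e % r) = false then
    V (e / r) (e % r) else 0 with hf
  have hfull : ∑ e ∈ Finset.range (r * r), f e = cutSum r V fun i => M.testBit i = false := by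
    rw [cutSum_eq_sum_range_mul]
    exact Finset.sum_congr rfl fun e _ => by simp only [hf]; congr
  have hent : ∀ i < r, ∀ j < r, V i j ≤ tot := fun i hi j hj => by
    rw [← hs.total]
    exact le_pairSum (entries n (s.mem 1)) (hel (base + i) (by omega)) (hel (base + j) (by omega))
      trivial
  have hle : ∑ e ∈ Finset.range (r * r), f e ≤ n * n * tot := by
    rw [hfull, cutSum_eq_pairSum]
    exact (pairSum_le_mul fun u hu v hv _ => hent u hu v hv).trans
      (Nat.mul_le_mul_right _ (Nat.mul_le_mul (by omega) (by omega)))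
  rw [← hfull]
  refine Runs.forTo (T := 2) (r * r) (fun t s' => s'.reg 27 = ∑ e ∈ Finset.range t, f e) rfl rfl h28
    (fun _ _ _ h => h) (by simpa using h27) (fun t ht s' ha hreg hI => ?_) fun _ _ h => h
  have c' : Context n k m tot s' := hs.agrees ha rfl
  have g0 : s'.reg 0 = n := c'.reg_zero
  have g20 : s'.reg 20 = base := (ha.1 20 rfl).trans h20
  have g21 : s'.reg 21 = r := (ha.1 21 rfl).trans h21
  have g23 : s'.reg 23 = M := ha.1 23 rfl
  have g1 : s'.mem 1 = s.mem 1 := ha.2 1 rfl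
  have g10 : s'.mem 10 = s.mem 10 := ha.2 10 rfl
  have hr : 0 < r := Nat.pos_of_ne_zero (by rintro rfl; simp at ht)
  have hdiv : t / r < r := Nat.div_lt_of_lt_mul ht
  have hmod : t % r < r := Nat.mod_lt _ hr
  have hbit1 : (bit (reg 23) (read 3 (reg 24 / reg 21))).eval s' = (M.testBit (t / r)).toNat := by
    rw [eval_bit s' (reg 23) _ (v := t / r), eval_reg, g23]
    rw [eval_read, eval_div, eval_reg, eval_reg, hreg, g21, c'.pow _ (by omega)]
  have hbit2 : (bit (reg 23) (read 3 (rem (reg 24) (reg 21)))).eval s' =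
      (M.testBit (t % r)).toNat := by
    rw [eval_bit s' (reg 23) _ (v := t % r), eval_reg, g23]
    rw [eval_read, eval_rem, eval_reg, eval_reg, hreg, g21, c'.pow _ (by omega)]
  have hsucc := Finset.sum_range_succ f t
  have hft : f t = if M.testBit (t / r) = false ∧ ¬M.testBit (t % r) = false then
    V (t / r) (t % r) else 0 := rfl
  refine Runs.cond (T := 1) (fun he => ?_) fun he => ?_
  all_goals
    rw [eval_mul, eval_sub, hbit1, hbit2, eval_one] at he
  · have h1 : M.testBit (t / r) = false ∧ ¬M.testBit (t % r) = false := by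
      revert he
      cases M.testBit (t / r) <;> cases M.testBit (t % r) <;> simp
    rw [if_pos h1] at hft
    have hval : (reg 27 + read 1 (read 10 (reg 20 + reg 24 / reg 21) * reg 0 +
        read 10 (reg 20 + rem (reg 24) (reg 21)))).eval s' = ∑ e ∈ Finset.range (t + 1), f e := by
      simp only [eval_add, eval_reg, eval_read, eval_mul, eval_div, eval_rem, hreg, g1, g10, g20,
        g21, g0, hI, hsucc, hft, hV, listed, entries]
    refine Runs.assign (fun _ => ?_) ?_
    · rw [hval]
      have : ∑ e ∈ Finset.range (t + 1), f e ≤ ∑ e ∈ Finset.range (r * r), f e :=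
        Finset.sum_le_sum_of_subset (Finset.range_subset_range.2 ht)
      omega
    · simp only [State.reg_setReg, if_true, hval]
  · have h1 : ¬(M.testBit (t / r) = false ∧ ¬M.testBit (t % r) = false) := by
      revert he
      cases M.testBit (t / r) <;> cases M.testBit (t % r) <;> simp
    rw [if_neg h1] at hft
    refine Runs.skip ?_
    rw [hI]
    omega

theorem runs_tableBody {b n k m tot r base : ℕ} {s : State} (hs : Context n k m tot s)
    (h20 : s.reg 20 = base) (h21 : s.reg 21 = r) (h28 : s.reg 28 = r * r)
    (hel : ∀ i < n, s.mem 10 i < n) (hbr : base + r ≤ n) (hM : s.reg 23 < 2 ^ r)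
    (hB : 2 ^ n * (n * n * tot) + n * n * tot + 1 < 2 ^ b)
    (hT : Table r (n * n * tot) (s.reg 23) (listed n base (s.mem 1) (s.mem 10)) (s.mem 11)
      (s.mem 12)) :
    Runs b tableBody (r * r * 4 + r * 5 + 8) s fun s' =>
      Table r (n * n * tot) (s.reg 23 + 1) (listed n base (s.mem 1) (s.mem 10)) (s'.mem 11)
      (s'.mem 12) := by
  set M := s.reg 23 with hMdef
  set V := listed n base (s.mem 1) (s.mem 10) with hV
  set B := n * n * tot with hBdef
  have hM2 : 2 ^ r ≤ 2 ^ n := Nat.pow_le_pow_right two_pos (by omega)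
  have hMB : M * B ≤ 2 ^ n * B := Nat.mul_le_mul_right _ (by omega)
  have hG : (cutSum r V fun i => M.testBit i = false) ≤ B := by
    rw [cutSum_eq_pairSum]
    refine (pairSum_le_mul (d := tot) fun u hu v hv _ => ?_).trans
      (Nat.mul_le_mul_right _ (Nat.mul_le_mul (by omega) (by omega)))
    rw [← hs.total]
    exact le_pairSum (entries n (s.mem 1)) (hel (base + u) (by omega)) (hel (base + v) (by omega))
      trivial
  refine (Runs.assign_seq (fun _ => by simp) (Runs.seq (T₂ := 1 + ((r * r * 4 + 2) + (1 + 1)))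
    (runs_choose (n := n) (by simpa using h21) hs.pow (by omega) (by simp) fun M' hM' => ?_)
    fun s₁ a₁ h₁ => Runs.assign_seq (fun _ => by simp) (Runs.seq (T₂ := 1 + 1)
      (runs_cut (n := n) (k := k) (m := m) (tot := tot) (base := base) (r := r)
        ⟨?_, ?_, ?_, ?_, ?_, ?_, ?_⟩ ?_ ?_ ?_ ?_ ?_ hbr (by omega))
      fun s₂ a₂ h₂ => ?_))).mono (by omega) fun _ _ h => h
  · simp only [State.reg_setReg, Nat.reduceEqDiff, if_false, ← hMdef] at hM'
    have h1 := hT.le M' hM'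
    have h2 := Nat.mul_le_mul_right B hM'.le
    simp only [State.mem_setReg]
    omega
  · exact (a₁.1 0 rfl).trans hs.reg_zero
  · exact (a₁.1 1 rfl).trans hs.reg_one
  · exact (a₁.1 2 rfl).trans hs.reg_two
  · exact (a₁.1 3 rfl).trans hs.reg_three
  · exact (a₁.1 4 rfl).trans hs.reg_four
  · have := a₁.2 1 rfl
    simp only [State.mem_setReg] at this ⊢
    rw [this]; exact hs.total
  · have := a₁.2 3 rfl
    simp only [State.mem_setReg] at this ⊢
    rw [this]; exact hs.pow
  · exact (a₁.1 20 rfl).trans h20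
  · exact (a₁.1 21 rfl).trans h21
  · exact (a₁.1 28 rfl).trans h28
  · simp
  · have := a₁.2 10 rfl
    simp only [State.mem_setReg] at this ⊢
    rw [this]; exact hel
  · have q1 : s₁.mem 1 = s.mem 1 := a₁.2 1 rfl
    have q10 : s₁.mem 10 = s.mem 10 := a₁.2 10 rfl
    have q23 : s₁.reg 23 = M := a₁.1 23 rfl
    have p25 : s₂.reg 25 = s₁.reg 25 := a₂.1 25 rfl
    have p26 : s₂.reg 26 = s₁.reg 26 := a₂.1 26 rfl
    have p23 : s₂.reg 23 = M := (a₂.1 23 rfl).trans q23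
    have p11 : s₂.mem 11 = s.mem 11 := (a₂.2 11 rfl).trans (a₁.2 11 rfl)
    have p12 : s₂.mem 12 = s.mem 12 := (a₂.2 12 rfl).trans (a₁.2 12 rfl)
    simp only [State.reg_setReg, State.mem_setReg, Nat.reduceEqDiff, if_false, q1, q10, q23, ← hV]
      at h₂
    simp only [State.reg_setReg, State.mem_setReg, Nat.reduceEqDiff, if_false, ← hMdef] at h₁
    obtain ⟨h1, h2, h3⟩ := h₁
    set G := cutSum r V fun i => M.testBit i = false with hGdef
    have hT' : Table r B (M + 1) V (Function.update (s.mem 11) M (s₁.reg 25 - 1 + G))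
        (Function.update (s.mem 12) M (s₁.reg 26)) := by
      refine hT.update (fun h0 => ?_) (fun h0 => ?_) (fun j hj hjb => ?_) hG
      -- For the empty mask there is no candidate; truncation turns 0 - 1 into 0 and the cut is
      -- empty, so the entry is 0 without a special case.
      · have hz : s₁.reg 25 = 0 := by
          by_contra h
          have := (h2 h).2.1
          rw [h0] at this
          simp at this
        rw [hz, hGdef, cutSum_eq_zero_of_forall fun v _ => by simp [h0]]
      · have hz : s₁.reg 25 ≠ 0 := fun h => h0 (mask_ext hM (by positivity) fun j hj => by
          simp [h1 h j hj])
        obtain ⟨e1, e2, e3⟩ := h2 hz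
        exact ⟨e1, e2, by rw [e3, Nat.add_sub_cancel]⟩
      · have := h3 j hj hjb
        omega
    have hle := hT'.le M (Nat.lt_succ_self M)
    rw [Function.update_self] at hle
    refine Runs.write_seq (T := 1) (fun _ => ?_) (Runs.write (fun hb' => hb'.1 26) ?_)
    · simp only [eval_add, eval_sub, eval_reg, eval_one, p25, h₂]
      omega
    · simp only [eval_add, eval_sub, eval_reg, eval_one, p25, p26, p23, h₂, State.reg_setMem]
      rw [State.mem_setMem_of_ne _ _ _ _ (by decide : 11 ≠ 12), State.mem_setMem_self,
        State.mem_setMem_self, State.mem_setMem_of_ne _ _ _ _ (by decide : 12 ≠ 11), p11, p12]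
      exact hT'

/-- Fill the table for the vertices listed at indices `reg 20, …, reg 20 + reg 21 - 1`. -/
def fillTable : Program :=
  assign 28 (reg 21 * reg 21) ;; assign 22 (read 3 (reg 21)) ;; forTo 23 22 tableBody

theorem runs_fillTable {b n k m tot r base : ℕ} {s : State} (hs : Context n k m tot s)
    (h20 : s.reg 20 = base) (h21 : s.reg 21 = r)
    (hel : ∀ i < n, s.mem 10 i < n) (hbr : base + r ≤ n) (hnn : n * n < 2 ^ b)
    (hB : 2 ^ n * (n * n * tot) + n * n * tot + 1 < 2 ^ b) :
    Runs b fillTable (2 ^ r * (r * r * 4 + r * 5 + 10) + 4) s fun s' =>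
      s'.reg 22 = 2 ^ r ∧ Table r (n * n * tot) (2 ^ r) (listed n base (s.mem 1) (s.mem 10))
        (s'.mem 11) (s'.mem 12) := by
  have hrn : r * r ≤ n * n := Nat.mul_le_mul (by omega) (by omega)
  have h3 : s.mem 3 r = 2 ^ r := hs.pow r (by omega)
  refine (Runs.assign_seq (fun _ => ?_) (Runs.assign_seq (fun hb' => hb'.2 _ _)
    (Runs.forTo (i := 23) (rN := 22) (T := r * r * 4 + r * 5 + 8) (2 ^ r) (fun t s' =>
      Table r (n * n * tot) t (listed n base (s.mem 1) (s.mem 10)) (s'.mem 11) (s'.mem 12)) rfl rfl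
      ?_ (fun _ _ _ h => h) ⟨fun h => absurd h (Nat.not_lt_zero _),
        fun _ h => absurd h (Nat.not_lt_zero _), fun _ h => absurd h (Nat.not_lt_zero _),
        fun _ h => absurd h (Nat.not_lt_zero _)⟩ (fun t ht s' ha hreg hI => ?_)
      fun s' ha h => ⟨?_, h⟩))).mono (by linarith) fun _ _ h => h
  · simp only [eval_mul, eval_reg, h21]; omega
  · simp [h21, h3]
  · have c' : Context n k m tot s' := by
      refine hs.agrees (p := fillTable) ⟨fun i hi => ?_, fun i hi => ?_⟩ rfl
      · simp only [fillTable, keepsReg, Bool.and_eq_true, bne_iff_ne] at hi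
        rw [ha.1 i hi.2.2, State.reg_setReg, if_neg (Ne.symm hi.2.1), State.reg_setReg,
          if_neg (Ne.symm hi.1)]
      · simp only [fillTable, keepsMem, Bool.and_eq_true] at hi
        rw [ha.2 i hi.2.2]; rfl
    have g20 : s'.reg 20 = base := (ha.1 20 rfl).trans (by simpa using h20)
    have g21 : s'.reg 21 = r := (ha.1 21 rfl).trans (by simpa using h21)
    have g28 : s'.reg 28 = r * r := (ha.1 28 rfl).trans (by simp [h21])
    have g1 : s'.mem 1 = s.mem 1 := ha.2 1 rfl
    have g10 : s'.mem 10 = s.mem 10 := ha.2 10 rfl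
    refine (runs_tableBody c' g20 g21 g28 (by rw [g10]; exact hel) hbr (by rw [hreg]; exact ht) hB
      (by rw [hreg, g1, g10]; exact hI)).mono le_rfl fun s'' _ h => ?_
    rwa [hreg, g1, g10] at h
  · exact (ha.1 22 rfl).trans (by simp [h21, h3])

/-! ### Reading off an optimal ordering -/

/-- Place the vertex that is last in an optimal ordering of the set in register `23`. -/
def placeBody : Program :=
  assign 26 (read 12 (reg 23)) ;; write 2 (read 10 (reg 20 + reg 26)) (reg 25) ;;
    assign 25 (reg 25 - 1) ;; assign 23 (reg 23 - read 3 (reg 26))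

/-- Write the positions of the vertices listed at indices `reg 20, …, reg 20 + reg 21 - 1`. -/
def place : Program :=
  assign 23 (reg 22 - 1) ;; assign 25 (reg 20 + reg 21) ;; forTo 24 21 placeBody

/-- The positions `out` form an optimal ordering of the vertices listed at indices
`base, …, base + r - 1`. -/
structure Solved (n base r : ℕ) (w el out : ℕ → ℕ) : Prop where
  range : ∀ j < r, base < out (el (base + j)) ∧ out (el (base + j)) ≤ base + r
  inj : ∀ i < r, ∀ j < r, out (el (base + i)) = out (el (base + j)) → i = j
  optimal : ∀ p, IsOrdering n p →
    ∑ i ∈ Finset.Ioc base (base + r), cutSum r (listed n base w el)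
        (fun j => i < out (el (base + j))) ≤
      ∑ i ∈ Finset.Icc 1 (n - 1), cutSum r (listed n base w el) fun j => i < p (el (base + j))

/-- The vertices outside `M` have been placed at the positions `pos + 1, …, base + r`. -/
structure Placed (n base r pos M : ℕ) (w el D out : ℕ → ℕ) : Prop where
  lt : M < 2 ^ r
  card : base + countBelow r (fun j => M.testBit j = true) = pos
  range : ∀ j < r, M.testBit j = false →
    pos < out (el (base + j)) ∧ out (el (base + j)) ≤ base + r
  inj : ∀ i < r, ∀ j < r, M.testBit i = false → M.testBit j = false →
    out (el (base + i)) = out (el (base + j)) → i = j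
  cost : D M + ∑ i ∈ Finset.Ioc pos (base + r), cutSum r (listed n base w el)
    (fun j => M.testBit j = false ∧ i < out (el (base + j))) = D (2 ^ r - 1)

theorem countBelow_sub_two_pow {r M c : ℕ} (hc : c < r) (hb : M.testBit c = true) :
    countBelow r (fun j => (M - 2 ^ c).testBit j = true) + 1 =
      countBelow r fun j => M.testBit j = true := by
  classical
  refine Eq.symm (Eq.trans (congrArg Finset.card (Finset.ext fun a => ?_))
    (Finset.card_insert_of_notMem (a := c) ?_))
  · simp only [Finset.mem_filter, Finset.mem_range, Finset.mem_insert, testBit_sub_two_pow hb,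
      Bool.and_eq_true, decide_eq_true_eq]
    constructor
    · rintro ⟨h1, h2⟩
      by_cases h : a = c
      · exact Or.inl h
      · exact Or.inr ⟨h1, h2, h⟩
    · rintro (rfl | h)
      · exact ⟨hc, hb⟩
      · exact ⟨h.1, h.2.1⟩
  · simp [testBit_sub_two_pow hb]

/-- At position `pos` the vertices after it are exactly those outside M, so the new summand is the
cut in the table equation for M. At later positions the vertex just placed lies before the cut, and
nothing changes. -/
theorem Placed.update {n base r pos M c B : ℕ} {w el D ch out : ℕ → ℕ}
    (h : Placed n base r pos M w el D out)
    (hT : Table r B (2 ^ r) (listed n base w el) D ch) (hM : M ≠ 0) (hc : ch M = c)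
    (hel : ∀ i < r, ∀ j < r, el (base + i) = el (base + j) → i = j) :
    Placed n base r (pos - 1) (M - 2 ^ c) w el D (Function.update out (el (base + c)) pos) := by
  obtain ⟨h1, h2, h3⟩ := hT.choice M h.lt hM
  rw [hc] at h1 h2 h3
  have hcard := countBelow_sub_two_pow h1 h2
  have hpos := h.card
  have hle := countBelow_le r fun j => M.testBit j = true
  have hbit : ∀ j, (M - 2 ^ c).testBit j = false ↔ M.testBit j = false ∨ j = c := fun j => by
    rw [testBit_sub_two_pow h2]
    cases M.testBit j <;> simp
  have hother : ∀ j < r, M.testBit j = false →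
      Function.update out (el (base + c)) pos (el (base + j)) = out (el (base + j)) :=
    fun j hj hb => Function.update_of_ne (fun e => by
      have := hel j hj c h1 e
      rw [this, h2] at hb
      exact absurd hb (by simp)) _ _
  refine ⟨(Nat.sub_le _ _).trans_lt h.lt, by omega, fun j hj hb => ?_, fun i hi j hj hbi hbj e => ?_,
    ?_⟩
  · rcases (hbit j).1 hb with hb | rfl
    · rw [hother j hj hb]
      have := h.range j hj hb
      omega
    · rw [Function.update_self]
      omega
  · rcases (hbit i).1 hbi with hi' | rfl <;> rcases (hbit j).1 hbj with hj' | rfl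
    · rw [hother i hi hi', hother j hj hj'] at e
      exact h.inj i hi j hj hi' hj' e
    · rw [hother i hi hi', Function.update_self] at e
      have := h.range i hi hi'
      omega
    · rw [hother j hj hj', Function.update_self] at e
      have := h.range j hj hj'
      omega
    · rfl
  · have hIoc : Finset.Ioc (pos - 1) (base + r) = insert pos (Finset.Ioc pos (base + r)) := by
      ext x
      simp only [Finset.mem_Ioc, Finset.mem_insert]
      omega
    rw [hIoc, Finset.sum_insert (by simp), ← h.cost, h3, add_assoc]
    congr 1
    congr 1
    · refine cutSum_congr (fun _ _ _ _ => rfl) fun j hj => ?_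
      rw [hbit]
      constructor
      · rintro ⟨hb | rfl, h'⟩
        · exact hb
        · rw [Function.update_self] at h'
          omega
      · intro hb
        rw [hother j hj hb]
        exact ⟨Or.inl hb, (h.range j hj hb).1⟩
    · refine Finset.sum_congr rfl fun i hi => cutSum_congr (fun _ _ _ _ => rfl) fun j hj => ?_
      rw [Finset.mem_Ioc] at hi
      rw [hbit]
      constructor
      · rintro ⟨hb | rfl, h'⟩
        · rw [hother j hj hb] at h'
          exact ⟨hb, h'⟩
        · rw [Function.update_self] at h'
          omega
      · rintro ⟨hb, h'⟩
        rw [hother j hj hb]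
        exact ⟨Or.inl hb, h'⟩

/-- Once the mask is empty, the cost invariant says that the ordering realizes the full table entry,
which `table_le_sum_cutSum` bounds by the share of any ordering of all vertices. -/
theorem Placed.solved {n base r B : ℕ} {w el D ch out : ℕ → ℕ}
    (h : Placed n base r base 0 w el D out) (hT : Table r B (2 ^ r) (listed n base w el) D ch)
    (hbr : base + r ≤ n) (hlt : ∀ i < n, el i < n)
    (hinj : ∀ i < n, ∀ j < n, el i = el j → i = j) :
    Solved n base r w el out := by
  have h0 : D 0 = 0 := hT.zero (by positivity)
  refine ⟨fun j hj => h.range j hj (by simp), fun i hi j hj => h.inj i hi j hj (by simp) (by simp),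
    fun p hp => ?_⟩
  have := h.cost
  simp only [Nat.zero_testBit, true_and, h0, zero_add] at this
  rw [this]
  refine table_le_sum_cutSum (fun j hj => hp.pos _ (hlt _ (by omega)))
    (fun j hj => hp.le _ (hlt _ (by omega))) (fun i hi j hj e => ?_) h0 hT.bellman
  have := hinj _ (by omega) _ (by omega)
    (hp.inj _ (hlt (base + i) (by omega)) _ (hlt (base + j) (by omega)) e)
  omega

theorem runs_place {b n k m tot r base : ℕ} {s : State} (hs : Context n k m tot s)
    (h20 : s.reg 20 = base) (h21 : s.reg 21 = r) (h22 : s.reg 22 = 2 ^ r)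
    (hlt : ∀ i < n, s.mem 10 i < n) (hinj : ∀ i < n, ∀ j < n, s.mem 10 i = s.mem 10 j → i = j)
    (hbr : base + r ≤ n) (hnb : n < 2 ^ b)
    (hT : Table r (n * n * tot) (2 ^ r) (listed n base (s.mem 1) (s.mem 10)) (s.mem 11)
      (s.mem 12)) :
    Runs b place (r * 6 + 4) s fun s' =>
      Solved n base r (s.mem 1) (s.mem 10) (s'.mem 2) ∧
        ∀ v, (∀ j < r, v ≠ s.mem 10 (base + j)) → s'.mem 2 v = s.mem 2 v := by
  refine (Runs.assign_seq (fun hb' => (Nat.sub_le _ _).trans_lt (hb'.1 22)) (Runs.assign_seq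
    (fun _ => ?_) (Runs.forTo (i := 24) (rN := 21) (T := 4) r (fun t s' =>
      Placed n base r (base + r - t) (s'.reg 23) (s.mem 1) (s.mem 10) (s.mem 11) (s'.mem 2) ∧
      s'.reg 25 = base + r - t ∧ t ≤ r ∧
      ∀ v, (∀ j < r, v ≠ s.mem 10 (base + j)) → s'.mem 2 v = s.mem 2 v) rfl rfl
      (by simpa using h21) (fun _ _ _ h => h) ?_ (fun t ht s' ha hreg hI => ?_)
      fun s' ha hI => ?_))).mono (by omega) fun _ _ h => h
  · simp only [eval_add, eval_reg, State.reg_setReg, Nat.reduceEqDiff, if_false, h20, h21]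
    omega
  · simp only [eval_add, eval_reg, eval_sub, eval_one, State.reg_setReg, Nat.reduceEqDiff, if_false,
      if_true, h20, h21, h22, State.mem_setReg]
    refine ⟨⟨Nat.sub_lt (by positivity) one_pos, ?_, fun j hj hb => ?_, fun i hi _ _ hb => ?_, ?_⟩,
      rfl, Nat.zero_le _, fun _ _ => trivial⟩
    · rw [countBelow_of_forall fun v hv => by simp [hv]]
      omega
    · simp [hj] at hb
    · simp [hi] at hb
    · simp
  · obtain ⟨i1, i2, i3, i4⟩ := hI
    have g20 : s'.reg 20 = base := (ha.1 20 rfl).trans (by simpa using h20)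
    have g12 : s'.mem 12 = s.mem 12 := ha.2 12 rfl
    have g10 : s'.mem 10 = s.mem 10 := ha.2 10 rfl
    have g3 : s'.mem 3 = s.mem 3 := ha.2 3 rfl
    -- An unfilled position remains above `base`, and the mask has as many elements as unfilled
    -- positions.
    have hM : s'.reg 23 ≠ 0 := fun h => by
      have := i1.card
      rw [h, countBelow_of_forall_not (by simp)] at this
      omega
    set M := s'.reg 23 with hMdef
    set c := s.mem 12 M with hc
    have hcr : c < r := (hT.choice M i1.lt hM).1
    have hpow : s.mem 3 c = 2 ^ c := hs.pow c (by omega)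
    refine Runs.assign_seq (T := 3) (fun hb' => hb'.2 _ _) (Runs.write_seq (T := 2)
      (fun hb' => hb'.1 25) (Runs.assign_seq (T := 1) (fun hb' => (Nat.sub_le _ _).trans_lt
        (hb'.1 25)) (Runs.assign (fun hb' => (Nat.sub_le _ _).trans_lt (hb'.1 23)) ?_)))
    simp only [eval_sub, eval_reg, eval_read, eval_one, eval_add, State.reg_setReg,
      State.mem_setReg, State.reg_setMem, Nat.reduceEqDiff, if_true, if_false, ← hMdef, g12, ← hc,
      g20, g10, i2, State.mem_setMem_self, State.mem_setMem_of_ne _ _ _ _ (by decide : 3 ≠ 2), g3,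
      hpow]
    refine ⟨i1.update hT hM hc.symm fun i hi j hj e => ?_, by omega, ht, fun v hv => ?_⟩
    · have := hinj _ (by omega) _ (by omega) e
      omega
    · rw [Function.update_of_ne (hv c hcr)]
      exact i4 v hv
  · obtain ⟨i1, i2, i3, i4⟩ := hI
    rw [Nat.add_sub_cancel] at i1
    have hM : s'.reg 23 = 0 := mask_ext i1.lt (by positivity) fun j hj => by
      have h0 : countBelow r (fun j => (s'.reg 23).testBit j = true) = 0 := by
        have := i1.card
        omega
      simp only [Nat.zero_testBit, Bool.false_eq_true, iff_false]
      intro hb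
      have : 1 ≤ countBelow r fun j => (s'.reg 23).testBit j = true :=
        Finset.card_pos.2 ⟨j, by simp [hj, hb]⟩
      omega
    rw [hM] at i1
    exact ⟨i1.solved hT hbr hlt hinj, i4⟩

/-- Order the vertices listed at indices `reg 20, …, reg 20 + reg 21 - 1` optimally. -/
def solve : Program := fillTable ;; place

theorem runs_solve {b n k m tot r base : ℕ} {s : State} (hs : Context n k m tot s)
    (h20 : s.reg 20 = base) (h21 : s.reg 21 = r)
    (hlt : ∀ i < n, s.mem 10 i < n) (hinj : ∀ i < n, ∀ j < n, s.mem 10 i = s.mem 10 j → i = j)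
    (hbr : base + r ≤ n) (hnb : n < 2 ^ b) (hnn : n * n < 2 ^ b)
    (hB : 2 ^ n * (n * n * tot) + n * n * tot + 1 < 2 ^ b) :
    Runs b solve (2 ^ r * (r * r * 4 + r * 5 + 10) + r * 6 + 8) s fun s' =>
      Solved n base r (s.mem 1) (s.mem 10) (s'.mem 2) ∧
        ∀ v, (∀ j < r, v ≠ s.mem 10 (base + j)) → s'.mem 2 v = s.mem 2 v := by
  refine (Runs.seq (T₂ := r * 6 + 4) (runs_fillTable hs h20 h21 hlt hbr hnn hB)
    fun s' ha h => ?_).mono (by omega) fun _ _ h => h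
  have g1 : s'.mem 1 = s.mem 1 := ha.2 1 rfl
  have g10 : s'.mem 10 = s.mem 10 := ha.2 10 rfl
  have g2 : s'.mem 2 = s.mem 2 := ha.2 2 rfl
  have := runs_place (b := b) (hs.agrees ha rfl) ((ha.1 20 rfl).trans h20) ((ha.1 21 rfl).trans h21)
    h.1 (by rw [g10]; exact hlt) (by rw [g10]; exact hinj) hbr hnb (by rw [g1, g10]; exact h.2)
  rwa [g1, g2, g10] at this

/-! ### Listing the two sides of the best cut -/

/-- Append the vertices for which `x` is nonzero to the list in array `10`. -/
def append (x : Expr) : Program :=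
  forTo 10 0 (.cond x (write 10 (reg 16) (reg 10) ;; assign 16 (reg 16 + 1)) skip)

theorem runs_append {b n base : ℕ} {s : State} {x : Expr} {P : ℕ → Prop} (h0 : s.reg 0 = n)
    (h16 : s.reg 16 = base) (hlt : ∀ i < base, s.mem 10 i < n)
    (hinj : ∀ i < base, ∀ j < base, s.mem 10 i = s.mem 10 j → i = j)
    (hP : ∀ i < base, ¬P (s.mem 10 i)) (hnb : base + n < 2 ^ b)
    (hx : ∀ s', s'.mem 4 = s.mem 4 → (x.eval s' ≠ 0 ↔ P (s'.reg 10))) :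
    Runs b (append x) (n * 5 + 2) s fun s' =>
      s'.reg 16 = base + countBelow n P ∧ (∀ i < base, s'.mem 10 i = s.mem 10 i) ∧
      (∀ i < s'.reg 16, s'.mem 10 i < n) ∧ (∀ i < s'.reg 16, base ≤ i → P (s'.mem 10 i)) ∧
      ∀ i < s'.reg 16, ∀ j < s'.reg 16, s'.mem 10 i = s'.mem 10 j → i = j := by
  classical
  refine Runs.forTo (T := 3) n (fun t s' =>
      s'.reg 16 = base + countBelow t P ∧ (∀ i < base, s'.mem 10 i = s.mem 10 i) ∧
      (∀ i < s'.reg 16, s'.mem 10 i < n) ∧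
      (∀ i < s'.reg 16, base ≤ i → P (s'.mem 10 i) ∧ s'.mem 10 i < t) ∧
      ∀ i < s'.reg 16, ∀ j < s'.reg 16, s'.mem 10 i = s'.mem 10 j → i = j) rfl rfl h0
    (fun _ _ _ h => h) ⟨by simpa [countBelow] using h16, fun _ _ => rfl, by rwa [h16],
      fun i hi hi' => by omega, by rwa [h16]⟩ (fun t ht s' ha hreg hI => ?_)
    fun s' _ h => ⟨h.1, h.2.1, h.2.2.1, fun i hi hi' => (h.2.2.2.1 i hi hi').1, h.2.2.2.2⟩
  obtain ⟨i1, i2, i3, i4, i5⟩ := hI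
  have hx' := hx s' (ha.2 4 rfl)
  rw [hreg] at hx'
  have hsucc := countBelow_succ t P
  have hcle := countBelow_le t P
  refine Runs.cond (T := 2) (fun he => ?_) fun he => ?_
  · have hPt := hx'.1 he
    rw [if_pos hPt] at hsucc
    -- Older entries violate P, and those added in this pass are smaller than t.
    have hfresh : ∀ i < s'.reg 16, s'.mem 10 i ≠ t := fun i hi h => by
      by_cases hib : i < base
      · exact hP i hib (by rw [← i2 i hib, h]; exact hPt)
      · have := (i4 i hi (by omega)).2
        omega
    refine Runs.write_seq (T := 1) (fun hb' => hb'.1 10) (Runs.assign (fun _ => ?_) ?_)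
    · simp only [eval_add, eval_reg, eval_one, State.reg_setMem]
      omega
    · simp only [eval_add, eval_reg, eval_one, State.reg_setMem, State.reg_setReg, if_true,
        State.mem_setReg, State.mem_setMem_same, hreg]
      refine ⟨by omega, fun i hi => ?_, fun i hi => ?_, fun i hi hib => ?_, fun i hi j hj e => ?_⟩
      · rw [if_neg (by omega)]
        exact i2 i hi
      · split_ifs with h
        · exact ht
        · exact i3 i (by omega)
      · split_ifs with h
        · exact ⟨hPt, Nat.lt_succ_self t⟩
        · have := i4 i (by omega) hib
          exact ⟨this.1, by omega⟩
      · split_ifs at e with h1 h2 h2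
        · omega
        · exact absurd e.symm (hfresh j (by omega))
        · exact absurd e (hfresh i (by omega))
        · exact i5 i (by omega) j (by omega) e
  · have hPt : ¬P t := fun h => hx'.2 h he
    rw [if_neg hPt] at hsucc
    refine Runs.skip ⟨by omega, i2, i3, fun i hi hib => ?_, i5⟩ |>.mono (by omega) fun _ _ h => h
    have := i4 i hi hib
    exact ⟨this.1, by omega⟩

/-- List the vertices outside the best cut, followed by those inside. -/
def listSides : Program :=
  assign 16 0 ;; append (1 - read 4 (reg 10)) ;; assign 17 (reg 16) ;; append (read 4 (reg 10))

/-- Register `17` keeps the length of the list after the first pass, which is the split index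
between the two sides. -/
theorem runs_listSides {b n : ℕ} {s : State} (h0 : s.reg 0 = n) (hnb : n + n < 2 ^ b) :
    Runs b listSides (n * 10 + 6) s fun s' =>
      s'.reg 17 + countBelow n (fun v => s.mem 4 v ≠ 0) = n ∧
      (∀ i < n, s'.mem 10 i < n) ∧ (∀ i < n, (s.mem 4 (s'.mem 10 i) ≠ 0 ↔ s'.reg 17 ≤ i)) ∧
      ∀ i < n, ∀ j < n, s'.mem 10 i = s'.mem 10 j → i = j := by
  have hcount := countBelow_not n fun v => s.mem 4 v ≠ 0
  refine (Runs.assign_seq (fun _ => by simp) (Runs.seq (T₂ := 1 + (n * 5 + 2))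
    (runs_append (n := n) (base := 0) (P := fun v => ¬s.mem 4 v ≠ 0) (by simpa using h0) (by simp)
      (fun i hi => absurd hi (Nat.not_lt_zero _)) (fun i hi => absurd hi (Nat.not_lt_zero _))
      (fun i hi => absurd hi (Nat.not_lt_zero _)) (by omega) fun s' h4 => ?_)
    fun s₁ a₁ h₁ => Runs.assign_seq (fun hb' => hb'.1 16) ((runs_append (n := n)
      (s := s₁.setReg 17 (s₁.reg 16)) (base := s₁.reg 16) (P := fun v => s.mem 4 v ≠ 0) ?_ (by simp) h₁.2.2.1 h₁.2.2.2.2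
      (fun i hi => h₁.2.2.2.1 i hi (Nat.zero_le _)) ?_ fun s' h4 => ?_).mono le_rfl
      fun s₂ a₂ h₂ => ?_))).mono (by omega) fun _ _ h => h
  · simp only [eval_sub, eval_one, eval_read, eval_reg, h4, State.mem_setReg]
    omega
  · simpa using (a₁.1 0 rfl).trans h0
  · have := h₁.1
    omega
  · have g4 : s₁.mem 4 = s.mem 4 := a₁.2 4 rfl
    simp only [eval_read, eval_reg, h4, State.mem_setReg, g4]
  · have g17 : s₂.reg 17 = s₁.reg 16 := (a₂.1 17 rfl).trans (by simp)
    obtain ⟨i1, i2, i3, i4, i5⟩ := h₂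
    have h1 := h₁.1
    have hn : s₂.reg 16 = n := by omega
    rw [hn] at i3 i4 i5
    refine ⟨by omega, i3, fun i hi => ⟨fun h => ?_, fun h => i4 i hi (by omega)⟩, i5⟩
    by_contra hlt
    rw [i2 i (by omega)] at h
    exact h₁.2.2.2.1 i (by omega) (Nat.zero_le _) h

/-! ### The approximation algorithm -/

/-- Compute the data of the context. -/
def prepare (q : ℕ) : Program :=
  assign 1 ((reg 0 - 1) / const q) ;; assign 2 (reg 0 - reg 1) ;; assign 3 (reg 0 * reg 0) ;;
    assign 4 0 ;; forTo 10 3 (assign 4 (reg 4 + read 1 (reg 10))) ;;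
    assign 15 (reg 0 + 1) ;; assign 14 1 ;;
    forTo 10 15 (write 3 (reg 10) (reg 14) ;; assign 14 (reg 14 + reg 14)) ;;
    assign 5 (read 3 (reg 2))

theorem sum_range_eq_total (n : ℕ) (w : ℕ → ℕ) :
    ∑ e ∈ Finset.range (n * n), w e = pairSum n (entries n w) fun _ _ => True := by
  rw [sum_range_mul_eq, pairSum]
  simp [entries]

/-- Tabulated powers of two let later programs read bits of masks by division. The loop doubles once
more than needed, which is why two spare binary digits beyond n are required. -/
theorem runs_prepare {b n q tot : ℕ} {s : State} (h0 : s.reg 0 = n)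
    (htot : pairSum n (entries n (s.mem 1)) (fun _ _ => True) = tot) (hnn : n * n < 2 ^ b)
    (hb : n + 2 ≤ b) (htb : tot < 2 ^ b) :
    Runs b (prepare q) (n * n * 3 + n * 4 + 15) s fun s' =>
      Context n ((n - 1) / q) (n - (n - 1) / q) tot s' ∧ s'.reg 5 = 2 ^ (n - (n - 1) / q) := by
  have hsum := sum_range_eq_total n (s.mem 1)
  rw [htot] at hsum
  have hnb : n < 2 ^ n := Nat.lt_two_pow_self
  have hpb : 2 ^ (n + 2) ≤ 2 ^ b := Nat.pow_le_pow_right two_pos hb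
  rw [pow_succ, pow_succ] at hpb
  refine (Runs.assign_seq (fun hb' => ?_) (Runs.assign_seq (fun hb' => (Nat.sub_le _ _).trans_lt
    ?_) (Runs.assign_seq (fun _ => ?_) (Runs.assign_seq (fun _ => by simp) (Runs.seq
    (T₁ := n * n * 3 + 2) (T₂ := 1 + (1 + (((n + 1) * 4 + 2) + 1)))
    (R := fun s' => s'.reg 4 = tot) ?_ fun s₁ a₁ h₁ =>
    Runs.assign_seq (fun _ => ?_) (Runs.assign_seq (fun _ => ?_) (Runs.seq (T₁ := (n + 1) * 4 + 2)
      (R := fun s' => ∀ v ≤ n, s'.mem 3 v = 2 ^ v) ?_ fun s₂ a₂ h₂ => ?_))))))).mono (by omega)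
      fun _ _ h => h
  · exact (Nat.div_le_self _ _).trans_lt ((Nat.sub_le _ _).trans_lt (hb'.1 0))
  · simp only [eval_reg, State.reg_setReg]
    rw [if_neg (by decide)]
    omega
  · simp only [eval_mul, eval_reg, State.reg_setReg]
    rw [if_neg (by decide), if_neg (by decide), h0]
    exact hnn
  · refine Runs.forTo (T := 1) (n * n)
      (fun t s' => s'.reg 4 = ∑ e ∈ Finset.range t, s.mem 1 e) rfl rfl (by simp [h0])
      (fun _ _ _ h => h) (by simp) (fun t ht s' ha hreg hI => ?_) fun s' _ h => h.trans hsum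
    have g1 : s'.mem 1 = s.mem 1 := ha.2 1 rfl
    have hle : ∑ e ∈ Finset.range (t + 1), s.mem 1 e ≤ tot := by
      rw [← hsum]
      exact Finset.sum_le_sum_of_subset (Finset.range_subset_range.2 ht)
    rw [Finset.sum_range_succ] at hle
    refine Runs.assign (fun _ => ?_) ?_
    · simp only [eval_add, eval_reg, eval_read, hreg, g1, hI]
      omega
    · simp only [eval_add, eval_reg, eval_read, hreg, g1, hI, State.reg_setReg, if_true,
        Finset.sum_range_succ]
  · have : s₁.reg 0 = n := (a₁.1 0 rfl).trans (by simpa using h0)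
    simp only [eval_add, eval_reg, eval_one, this]
    omega
  · simp only [eval_one]
    omega
  · have k0 : s₁.reg 0 = n := (a₁.1 0 rfl).trans (by simpa using h0)
    refine Runs.forTo (T := 2) (n + 1)
      (fun t s' => s'.reg 14 = 2 ^ t ∧ ∀ v < t, s'.mem 3 v = 2 ^ v) rfl rfl (by simp [k0])
      (fun _ _ _ h => h) ⟨by simp, fun v hv => absurd hv (Nat.not_lt_zero _)⟩
      (fun t ht s' ha hreg hI => ?_) fun s' _ h v hv => h.2 v (by omega)
    have hpt : 2 ^ t ≤ 2 ^ n := Nat.pow_le_pow_right two_pos (by omega)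
    refine Runs.write_seq (T := 1) (fun hb' => hb'.1 14) (Runs.assign (fun _ => ?_) ?_)
    · simp only [eval_add, eval_reg, State.reg_setMem, hI.1]
      omega
    · simp only [eval_add, eval_reg, State.reg_setMem, hI.1, State.reg_setReg, if_true,
        State.mem_setReg, State.mem_setMem_same, hreg]
      refine ⟨by rw [pow_succ]; omega, fun v hv => ?_⟩
      split_ifs with h
      · rw [h]
      · exact hI.2 v (by omega)
  · have k0 : s₂.reg 0 = n := (a₂.1 0 rfl).trans ((a₁.1 0 rfl).trans (by simpa using h0))
    have k1 : s₂.reg 1 = (n - 1) / q := (a₂.1 1 rfl).trans ((a₁.1 1 rfl).trans (by simp [h0]))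
    have k2 : s₂.reg 2 = n - (n - 1) / q := (a₂.1 2 rfl).trans ((a₁.1 2 rfl).trans (by simp [h0]))
    have k3 : s₂.reg 3 = n * n := (a₂.1 3 rfl).trans ((a₁.1 3 rfl).trans (by simp [h0]))
    have k4 : s₂.reg 4 = tot := (a₂.1 4 rfl).trans (by simpa using h₁)
    have m1 : s₂.mem 1 = s.mem 1 := (a₂.2 1 rfl).trans (a₁.2 1 rfl)
    refine Runs.assign (fun hb' => hb'.2 _ _) ⟨⟨?_, ?_, ?_, ?_, ?_, ?_, ?_⟩, ?_⟩
    · simpa using k0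
    · simpa using k1
    · simpa using k2
    · simpa using k3
    · simpa using k4
    · simpa [m1] using htot
    · exact h₂
    · simp only [eval_read, eval_reg, State.reg_setReg, if_true, k2]
      exact h₂ _ (Nat.sub_le _ _)

/-- The approximation algorithm: find a best balanced cut and order both sides optimally. -/
def approximate (q : ℕ) : Program :=
  prepare q ;; bestCut ;; listSides ;;
    (assign 20 0 ;; assign 21 (reg 17) ;; solve) ;;
    (assign 20 (reg 17) ;; assign 21 (reg 0 - reg 17) ;; solve)

theorem exists_el_eq {n v : ℕ} {el : ℕ → ℕ} (hlt : ∀ i < n, el i < n)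
    (hinj : ∀ i < n, ∀ j < n, el i = el j → i = j) (hv : v < n) : ∃ i < n, el i = v := by
  have : v ∈ (Finset.range n).image el := by rw [image_el hlt hinj]; exact Finset.mem_range.2 hv
  obtain ⟨i, hi, h⟩ := Finset.mem_image.1 this
  exact ⟨i, Finset.mem_range.1 hi, h⟩

theorem isOrdering_of_solved {n r : ℕ} {w el out : ℕ → ℕ} (hlt : ∀ i < n, el i < n)
    (hinj : ∀ i < n, ∀ j < n, el i = el j → i = j) (hr : r ≤ n)
    (h₁ : Solved n 0 r w el out) (h₂ : Solved n r (n - r) w el out) : IsOrdering n out := by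
  have hfst : ∀ i < r, 1 ≤ out (el i) ∧ out (el i) ≤ r := fun i hi => by
    have := h₁.range i hi
    rw [zero_add] at this
    omega
  have hsnd : ∀ i, r ≤ i → i < n → r < out (el i) ∧ out (el i) ≤ n := fun i hri hi => by
    have := h₂.range (i - r) (by omega)
    rw [Nat.add_sub_cancel' hri] at this
    omega
  have hboth : ∀ i < n, 1 ≤ out (el i) ∧ out (el i) ≤ n := fun i hi => by
    by_cases h : i < r
    · have := hfst i h; omega
    · have := hsnd i (by omega) hi; omega
  refine ⟨fun v hv => ?_, fun v hv => ?_, fun u hu v hv e => ?_⟩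
  · obtain ⟨i, hi, rfl⟩ := exists_el_eq hlt hinj hv
    exact (hboth i hi).1
  · obtain ⟨i, hi, rfl⟩ := exists_el_eq hlt hinj hv
    exact (hboth i hi).2
  · obtain ⟨i, hi, rfl⟩ := exists_el_eq hlt hinj hu
    obtain ⟨j, hj, rfl⟩ := exists_el_eq hlt hinj hv
    rcases Nat.lt_or_ge i r with h1 | h1 <;> rcases Nat.lt_or_ge j r with h2 | h2
    · have := h₁.inj i h1 j h2 (by simpa using e)
      rw [this]
    · have := hfst i h1
      have := hsnd j h2 hj
      omega
    · have := hfst j h2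
      have := hsnd i h1 hi
      omega
    · have := h₂.inj (i - r) (by omega) (j - r) (by omega)
        (by rwa [Nat.add_sub_cancel' h1, Nat.add_sub_cancel' h2])
      rw [show i = j by omega]

/-- Lets the solution for the first side survive the second call of `solve`, which writes only to
vertices of the other side. -/
theorem Solved.congr {n base r : ℕ} {w el out out' : ℕ → ℕ} (h : Solved n base r w el out)
    (he : ∀ j < r, out' (el (base + j)) = out (el (base + j))) : Solved n base r w el out' := by
  refine ⟨fun j hj => by rw [he j hj]; exact h.range j hj, fun i hi j hj e => ?_, fun p hp => ?_⟩
  · rw [he i hi, he j hj] at e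
    exact h.inj i hi j hj e
  · refine le_trans (Finset.sum_le_sum fun i _ => ?_) (h.optimal p hp)
    exact (cutSum_congr (fun _ _ _ _ => rfl) fun j hj => by rw [he j hj]).le

theorem orderCost_le_of_solved {n r : ℕ} {w el out p : ℕ → ℕ} (hlt : ∀ i < n, el i < n)
    (hinj : ∀ i < n, ∀ j < n, el i = el j → i = j) (hr : r ≤ n)
    (h₁ : Solved n 0 r w el out) (h₂ : Solved n r (n - r) w el out) (Z : ℕ → Prop)
    (hZ : ∀ i < n, (Z (el i) ↔ r ≤ i)) (hp : IsOrdering n p) :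
    orderCost n (entries n w) out ≤
      orderCost n (entries n w) p + (n - 1) * cutSum n (entries n w) Z := by
  have hn : r + (n - r) = n := by omega
  have o₁ := h₁.optimal p hp
  have o₂ := h₂.optimal p hp
  have r₁ := h₁.range
  have r₂ := h₂.range
  simp only [zero_add, hn] at o₁ o₂ r₁ r₂
  have e : listed n 0 w el = fun i j => entries n w (el i) (el j) := by
    funext i j
    simp only [listed, zero_add]
  rw [e] at o₁
  exact orderCost_concat_le hn hlt hinj Z hZ o₁ o₂ rfl rfl r₁ r₂

/-- The number of steps of the approximation algorithm. -/
def approximateTime (b n m : ℕ) : ℕ :=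
  2 ^ m * (enumTime b n + 2 * (n * n * 4 + n * 5 + 10) + 2) + n * n * 3 + n * 26 + 44

theorem runs_approximate {b n q tot : ℕ} {s : State} (h0 : s.reg 0 = n) (hq : 3 ≤ q)
    (htot : pairSum n (entries n (s.mem 1)) (fun _ _ => True) = tot) (hb : n + 2 ≤ b)
    (hnn : n * n < 2 ^ b) (htb : 2 * tot + 1 < 2 ^ b)
    (hB : 2 ^ n * (n * n * tot) + n * n * tot + 1 < 2 ^ b) :
    Runs b (approximate q) (approximateTime b n (n - (n - 1) / q)) s fun s' =>
      IsOrdering n (s'.mem 2) ∧ ∃ best, ∀ p, IsOrdering n p →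
        (n - 1 - 3 * ((n - 1) / q)) * best ≤ orderCost n (entries n (s.mem 1)) p ∧
        orderCost n (entries n (s.mem 1)) (s'.mem 2) ≤
          orderCost n (entries n (s.mem 1)) p + (n - 1) * best := by
  set k := (n - 1) / q with hk
  set m := n - k with hm
  -- Dividing n - 1 rather than n makes n - 1 - 3k a genuine difference; it also yields 2k ≤ m, so
  -- balanced sets exist.
  have hkn : 3 * k ≤ n - 1 := by
    calc 3 * k ≤ q * k := Nat.mul_le_mul_right _ hq
      _ ≤ n - 1 := Nat.mul_div_le _ _
  have hnb : n < 2 ^ n := Nat.lt_two_pow_self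
  have hpb : 2 ^ (n + 2) ≤ 2 ^ b := Nat.pow_le_pow_right two_pos hb
  rw [pow_succ, pow_succ] at hpb
  refine Runs.mono (T₁ := (n * n * 3 + n * 4 + 15) + ((2 ^ m * (enumTime b n + 2) + 3) +
    ((n * 10 + 6) + ((1 + (1 + (2 ^ m * (n * n * 4 + n * 5 + 10) + n * 6 + 8))) +
      (1 + (1 + (2 ^ m * (n * n * 4 + n * 5 + 10) + n * 6 + 8)))))))
    (Runs.seq (runs_prepare h0 htot hnn hb (by omega)) fun s₁ a₁ h₁ =>
      Runs.seq (runs_bestCut h₁.1 (by omega) (by omega) h₁.2 (by omega) (by omega) htb)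
      fun s₂ a₂ h₂ => Runs.seq (runs_listSides (n := n) ?_ (by omega)) fun s₃ a₃ h₃ => ?_)
    (by rw [approximateTime]; linarith) fun _ _ h => h
  · exact (a₂.1 0 rfl).trans h₁.1.reg_zero
  · have m1 : s₁.mem 1 = s.mem 1 := a₁.2 1 rfl
    have c₃ : Context n k m tot s₃ := (h₁.1.agrees a₂ rfl).agrees a₃ rfl
    have n1 : s₃.mem 1 = s.mem 1 := (a₃.2 1 rfl).trans ((a₂.2 1 rfl).trans m1)
    obtain ⟨hbest, hle⟩ := h₂
    rw [m1] at hbest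
    obtain ⟨-, hlow, hhigh, hval⟩ := hbest.attained hle
    obtain ⟨hcount, hlt, hside, hinj⟩ := h₃
    set r := s₃.reg 17 with hr
    set el := s₃.mem 10 with hel
    -- Z has between k and n - k vertices, so both tables have at most 2^m entries.
    have hrm : r ≤ m := by omega
    have hrm' : n - r ≤ m := by omega
    have hsolve : ∀ r' ≤ m, 2 ^ r' * (r' * r' * 4 + r' * 5 + 10) + r' * 6 + 8 ≤
        2 ^ m * (n * n * 4 + n * 5 + 10) + n * 6 + 8 := fun r' hr' => by
      have hrn : r' ≤ n := by omega
      have : 2 ^ r' ≤ 2 ^ m := Nat.pow_le_pow_right two_pos hr'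
      gcongr
    refine Runs.seq (R := fun s' => Solved n 0 r (s.mem 1) el (s'.mem 2))
      (Runs.assign_seq (fun _ => by simp) (Runs.assign_seq (fun hb' => hb'.1 17) ?_))
      fun s₄ a₄ h₄ => ?_
    · refine (runs_solve (n := n) (k := k) (m := m) (tot := tot) (base := 0) (r := r)
        (c₃.agrees (p := assign 20 0 ;; assign 21 (reg 17)) (Exec.seq (.assign _ _ _)
          (.assign _ _ _)).agrees rfl) (by simp) (by simp [hr]) hlt hinj (by omega) (by omega) hnn
        hB).mono (hsolve r hrm) fun s' _ h => ?_
      have := h.1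
      simp only [State.mem_setReg, n1] at this
      exact this
    · have g17 : s₄.reg 17 = r := a₄.1 17 rfl
      have g10 : s₄.mem 10 = el := a₄.2 10 rfl
      have g1 : s₄.mem 1 = s.mem 1 := (a₄.2 1 rfl).trans n1
      have c₄ : Context n k m tot s₄ := c₃.agrees a₄ rfl
      have g0 := c₄.reg_zero
      refine Runs.assign_seq (fun hb' => hb'.1 17) (Runs.assign_seq (fun hb' =>
        (Nat.sub_le _ _).trans_lt (hb'.1 0)) ?_)
      refine (runs_solve (n := n) (k := k) (m := m) (tot := tot) (base := r) (r := n - r)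
        (c₄.agrees (p := assign 20 (reg 17) ;; assign 21 (reg 0 - reg 17)) (Exec.seq (.assign _ _ _)
          (.assign _ _ _)).agrees rfl) (by simp [g17]) (by simp [g17, g0]) (by simpa [g10] using hlt)
        (by simpa [g10] using hinj) (by omega) (by omega) hnn hB).mono (hsolve _ hrm')
        fun s₅ _ h => ?_
      simp only [State.mem_setReg, g1, g10] at h
      obtain ⟨h₅, hframe⟩ := h
      have h₄' : Solved n 0 r (s.mem 1) el (s₅.mem 2) := h₄.congr fun j hj =>
        hframe _ fun i hi e => by
          have := hinj _ (by omega) _ (by omega) e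
          omega
      have hrn : r ≤ n := by omega
      refine ⟨isOrdering_of_solved hlt hinj hrn h₄' h₅, s₂.reg 6, fun p hp =>
        ⟨mul_le_orderCost hp (by omega) (by omega) fun Z => hbest.best_le Z trivial, ?_⟩⟩
      rw [← hval]
      exact orderCost_le_of_solved hlt hinj hrn h₄' h₅ _ hside hp

/-! ### Size of the numbers and running time in terms of the input length. -/

theorem WeightedDigraph.rowMajor_le {n x : ℕ} {M : Fin n × Fin n → ℕ} (h : ∀ a, M a ≤ x) (k : ℕ) :
    rowMajor M k ≤ x := by
  rw [rowMajor]
  split_ifs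
  exacts [h _, Nat.zero_le _]

theorem WeightedDigraph.mem_one_le {n : ℕ} (G : WeightedDigraph n) (e : ℕ) :
    G.inputState.mem 1 e ≤ G.maxWeight := by
  classical
  change rowMajor (fun a => if a ∈ G.arcs then G.weight a else 0) e ≤ _
  refine rowMajor_le (fun a => ?_) e
  split_ifs with h
  exacts [Finset.le_sup (f := G.weight) h, Nat.zero_le _]

theorem WeightedDigraph.bounded_inputState {n b : ℕ} (G : WeightedDigraph n) (hn : n + 1 < 2 ^ b)
    (hw : G.maxWeight < 2 ^ b) : Bounded b G.inputState := by
  classical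
  refine ⟨fun i => ?_, fun j a => ?_⟩
  · simp only [inputState]
    split_ifs <;> omega
  · by_cases h0 : j = 0
    · subst h0
      change rowMajor (fun a => if a ∈ G.arcs then 1 else 0) a < _
      refine lt_of_le_of_lt (b := 1) (rowMajor_le (fun a => ?_) a) (by omega)
      split_ifs <;> simp
    · by_cases h1 : j = 1
      · subst h1
        exact (G.mem_one_le a).trans_lt hw
      · simp only [inputState, if_neg h0, if_neg h1]
        positivity

/-- Cubic in b for the number of flow steps and cubic for the time of each; the remaining terms have
lower degree. -/
theorem enumTime_le {b n : ℕ} (hb : n + 1 ≤ b) : enumTime b n ≤ 180 * b ^ 6 := by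
  have hpow : ∀ i, i ≤ 6 → b ^ i ≤ b ^ 6 := fun i hi => Nat.pow_le_pow_right (by omega) hi
  have hn : n ≤ b := by omega
  have h1 : 1 ≤ b := by omega
  have hsq : n * n ≤ b ^ 2 := by rw [pow_two]; exact Nat.mul_le_mul hn hn
  have hb13 : b ≤ b ^ 3 := by simpa using Nat.pow_le_pow_right h1 (show 1 ≤ 3 by omega)
  have hb12 : 1 ≤ b ^ 2 := Nat.one_le_pow _ _ h1
  have hA : b * (2 * (n * n) + 1) + 1 ≤ 4 * b ^ 3 := by
    calc b * (2 * (n * n) + 1) + 1 ≤ b * (2 * b ^ 2 + 1) + 1 := by gcongr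
      _ = 2 * b ^ 3 + b + 1 := by ring
      _ ≤ _ := by omega
  have hC : (n + 1) * (n * n * 6 + 7) + n * 13 + 10 ≤ 36 * b ^ 3 := by
    calc (n + 1) * (n * n * 6 + 7) + n * 13 + 10
        ≤ b * (b ^ 2 * 6 + 7 * b ^ 2) + b * 13 + 10 := by gcongr; omega
      _ = 13 * b ^ 3 + b * 13 + 10 := by ring
      _ ≤ _ := by omega
  calc enumTime b n ≤ 4 * b ^ 3 * (36 * b ^ 3) + b ^ 2 * 7 + b * 8 + 15 := by
        rw [enumTime]; gcongr
    _ = 144 * b ^ 6 + b ^ 2 * 7 + b ^ 1 * 8 + b ^ 0 * 15 := by ring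
    _ ≤ _ := by
      have := hpow 2 (by omega)
      have := hpow 1 (by omega)
      have := hpow 0 (by omega)
      omega

theorem approximateTime_le {b n m : ℕ} (hb : n + 1 ≤ b) :
    approximateTime b n m ≤ 2 ^ m * (300 * b ^ 6) := by
  have hpow : ∀ i, i ≤ 6 → b ^ i ≤ b ^ 6 := fun i hi => Nat.pow_le_pow_right (by omega) hi
  have hn : n ≤ b ^ 1 := by rw [pow_one]; omega
  have hsq : n * n ≤ b ^ 2 := by rw [pow_two]; exact Nat.mul_le_mul (by omega) (by omega)
  have h6 := enumTime_le hb
  have h2 := hpow 2 (by omega)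
  have h1 := hpow 1 (by omega)
  have h0 := hpow 0 (by omega)
  rw [pow_zero] at h0
  have hm : 1 ≤ 2 ^ m := Nat.one_le_two_pow
  have hrest : n * n * 3 + n * 26 + 44 ≤ 73 * b ^ 6 := by omega
  have hmain : enumTime b n + 2 * (n * n * 4 + n * 5 + 10) + 2 ≤ 220 * b ^ 6 := by omega
  calc approximateTime b n m
      = 2 ^ m * (enumTime b n + 2 * (n * n * 4 + n * 5 + 10) + 2) +
        (n * n * 3 + n * 26 + 44) := by rw [approximateTime]; ring
    _ ≤ 2 ^ m * (220 * b ^ 6) + 2 ^ m * (73 * b ^ 6) :=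
      add_le_add (Nat.mul_le_mul_left _ hmain) (hrest.trans (Nat.le_mul_of_pos_left _ hm))
    _ ≤ _ := by rw [← mul_add]; exact Nat.mul_le_mul_left _ (by omega)

/-- The resource bounds of the algorithm in terms of the input size. -/
theorem runs_approximate_inputState {n q : ℕ} (G : WeightedDigraph n) (hq : 3 ≤ q) :
    ∃ s t, Exec (approximate q) G.inputState s t ∧
      t ≤ 9000000000 * (approximate q).unit * (n + G.maxWeight.size + 1) ^ 7 *
        2 ^ (n - (n - 1) / q) ∧
      IsOrdering n (s.mem 2) ∧ ∃ best, ∀ p, IsOrdering n p →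
        (n - 1 - 3 * ((n - 1) / q)) * best ≤
          orderCost n (entries n (G.inputState.mem 1)) p ∧
        orderCost n (entries n (G.inputState.mem 1)) (s.mem 2) ≤
          orderCost n (entries n (G.inputState.mem 1)) p + (n - 1) * best := by
  set N := n + G.maxWeight.size + 1 with hN
  -- The largest numbers are table entries, bounded through 2^n · n² · tot ≤ 2^(5n + ℓ) with ℓ the
  -- length of the largest weight; 10N leaves ample room.
  set b := 10 * N with hb
  set tot := pairSum n (entries n (G.inputState.mem 1)) fun _ _ => True with htot
  have hn : n < 2 ^ n := Nat.lt_two_pow_self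
  have hw : G.maxWeight < 2 ^ G.maxWeight.size := Nat.lt_size_self _
  have hnn : n * n ≤ 2 ^ (2 * n) := by
    rw [two_mul, pow_add]; exact Nat.mul_le_mul hn.le hn.le
  have htle : tot ≤ 2 ^ (2 * n + G.maxWeight.size) := by
    rw [pow_add]
    exact (pairSum_le_mul fun u _ v _ _ => (G.mem_one_le _).trans hw.le).trans
      (Nat.mul_le_mul_right _ hnn)
  have hBle : n * n * tot ≤ 2 ^ (4 * n + G.maxWeight.size) := by
    calc n * n * tot ≤ 2 ^ (2 * n) * 2 ^ (2 * n + G.maxWeight.size) := Nat.mul_le_mul hnn htle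
      _ = _ := by rw [← pow_add]; congr 1; ring
  have hBle' : 2 ^ n * (n * n * tot) ≤ 2 ^ (5 * n + G.maxWeight.size) := by
    calc 2 ^ n * (n * n * tot) ≤ 2 ^ n * 2 ^ (4 * n + G.maxWeight.size) :=
        Nat.mul_le_mul_left _ hBle
      _ = _ := by rw [← pow_add]; congr 1; ring
  have hpow : ∀ i, i ≤ 5 * n + G.maxWeight.size → 4 * 2 ^ i ≤ 2 ^ b := fun i hi => by
    calc 4 * 2 ^ i = 2 ^ (i + 2) := by rw [pow_add]; ring
      _ ≤ _ := Nat.pow_le_pow_right two_pos (by omega)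
  have hone : ∀ i, 1 ≤ 2 ^ i := fun i => Nat.one_le_two_pow
  have p1 := hpow n (by omega)
  have p2 := hpow (2 * n) (by omega)
  have p3 := hpow (2 * n + G.maxWeight.size) (by omega)
  have p4 := hpow (4 * n + G.maxWeight.size) (by omega)
  have p5 := hpow (5 * n + G.maxWeight.size) (by omega)
  have p6 := hpow G.maxWeight.size (by omega)
  have o1 := hone (2 * n)
  have o3 := hone (2 * n + G.maxWeight.size)
  have o5 := hone (5 * n + G.maxWeight.size)
  obtain ⟨s, t, hex, -, ht, hQ⟩ := runs_approximate (b := b) (q := q) (s := G.inputState) (n := n)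
    rfl hq htot.symm (by omega) (by omega) (by omega) (by omega)
    (G.bounded_inputState (by omega) (by omega))
  refine ⟨s, t, hex, ht.trans ?_, hQ⟩
  -- With b + 2 ≤ 3b the bound is 900 · b^7, and b = 10N gives the constant 9 · 10^9.
  calc approximateTime b n (n - (n - 1) / q) * (approximate q).unit * (b + 2)
      ≤ 2 ^ (n - (n - 1) / q) * (300 * b ^ 6) * (approximate q).unit * (b + 2 * b) := by
        gcongr
        · exact approximateTime_le (by omega)
        · omega
    _ = 9000000000 * (approximate q).unit * N ^ 7 * 2 ^ (n - (n - 1) / q) := by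
        rw [hb]; ring

end DirectedOLA

/-! ### Choice of q, the exponent of the running time and the approximation ratio. -/

theorem mainTheorem10 (α : ℝ) (hα₀ : 0 < α) (hα₁ : α < 1)
    (τ : ℝ) (hτ : DirectedOLA.matMulExponent < τ) :
    ∃ p : DirectedOLA.Program,
      DirectedOLA.ApproximatesOLA p (1 + 1 / (1 - α)) fun n : ℕ =>
        (2 : ℝ) ^ (τ * n / 3) + (2 : ℝ) ^ ((1 - α / 4) * n) := by
  -- The lower bound on αq serves the ratio, the upper bound the running time; rounding up 3/α gives
  -- αq ≤ 3 + α ≤ 4.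
  obtain ⟨q, hq₁, hq₂⟩ : ∃ q : ℕ, 3 ≤ α * q ∧ α * q ≤ 4 := by
    refine ⟨⌈3 / α⌉₊, ?_, ?_⟩
    · have := Nat.le_ceil (3 / α)
      rwa [div_le_iff₀' hα₀] at this
    · have h := (Nat.ceil_lt_add_one (by positivity : 0 ≤ 3 / α)).le
      have h2 := mul_le_mul_of_nonneg_left h hα₀.le
      rw [mul_add, mul_div_cancel₀ _ hα₀.ne'] at h2
      linarith
  have hq0 : (0 : ℝ) < q := by
    by_contra h
    have : (q : ℝ) = 0 := le_antisymm (not_lt.1 h) (Nat.cast_nonneg q)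
    rw [this] at hq₁
    linarith
  have hq3 : 3 ≤ q := by
    have : (3 : ℝ) ≤ q := by nlinarith
    exact_mod_cast this
  refine ⟨DirectedOLA.approximate q, 4 * (9000000000 * (DirectedOLA.approximate q).unit), 7,
    fun n G => ?_⟩
  obtain ⟨s, t, hex, ht, hord, best, hbest⟩ := DirectedOLA.runs_approximate_inputState G hq3
  obtain ⟨π, hπ⟩ := hord.exists_perm
  set k := (n - 1) / q with hk
  have hk₁ : (q : ℝ) * k ≤ (n - 1 : ℕ) := by exact_mod_cast Nat.mul_div_le (n - 1) q
  have hk₂ : ((n - 1 : ℕ) : ℝ) < q * (k + 1) := by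
    exact_mod_cast Nat.lt_mul_div_succ (n - 1) (by omega)
  have hkn : k ≤ n := (Nat.div_le_self _ _).trans (Nat.sub_le _ _)
  have hn1 : (n : ℝ) - 1 ≤ (n - 1 : ℕ) := by
    have : n ≤ (n - 1) + 1 := by omega
    have : (n : ℝ) ≤ (n - 1 : ℕ) + 1 := by exact_mod_cast this
    linarith
  refine ⟨s, t, π, hex, ?_, hπ, fun σ => ?_⟩
  -- From k + 1 > (n - 1)/q ≥ α(n - 1)/4 one gets k ≥ αn/4 - 2, so rounding costs at most the factor
  -- 2² = 4.
  · have hexp : ((2 : ℝ) ^ (n - k : ℕ)) ≤ 4 * (2 : ℝ) ^ ((1 - α / 4) * n) := by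
      have hm : ((n - k : ℕ) : ℝ) ≤ 2 + (1 - α / 4) * n := by
        rw [Nat.cast_sub hkn]
        nlinarith
      calc (2 : ℝ) ^ (n - k : ℕ) = (2 : ℝ) ^ ((n - k : ℕ) : ℝ) := (Real.rpow_natCast _ _).symm
        _ ≤ (2 : ℝ) ^ (2 + (1 - α / 4) * n) := Real.rpow_le_rpow_of_exponent_le one_le_two hm
        _ = _ := by rw [Real.rpow_add two_pos]; norm_num
    have hτ0 : (0 : ℝ) ≤ (2 : ℝ) ^ (τ * n / 3) := by positivity
    have ht' : (t : ℝ) ≤ 9000000000 * (DirectedOLA.approximate q).unit *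
        ((n : ℝ) + G.maxWeight.size + 1) ^ 7 * (2 : ℝ) ^ (n - k : ℕ) := by exact_mod_cast ht
    refine ht'.trans ?_
    push_cast
    calc 9000000000 * ((DirectedOLA.approximate q).unit : ℝ) *
          ((n : ℝ) + G.maxWeight.size + 1) ^ 7 * (2 : ℝ) ^ (n - k : ℕ)
        ≤ 9000000000 * ((DirectedOLA.approximate q).unit : ℝ) *
          ((n : ℝ) + G.maxWeight.size + 1) ^ 7 *
            (4 * ((2 : ℝ) ^ (τ * n / 3) + (2 : ℝ) ^ ((1 - α / 4) * n))) := by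
          gcongr
          linarith
      _ = _ := by ring
  · set p : ℕ → ℕ := fun v => if h : v < n then DirectedOLA.position σ ⟨v, h⟩ else 0 with hp
    have hpσ : ∀ v : Fin n, p v = DirectedOLA.position σ v := fun v => by simp [hp]
    obtain ⟨h1, h2⟩ := hbest p (DirectedOLA.isOrdering_of_perm σ p hpσ)
    rw [G.olaCost_eq_orderCost π _ hπ, G.olaCost_eq_orderCost σ _ hpσ]
    change (DirectedOLA.orderCost n (DirectedOLA.entries n (G.inputState.mem 1)) (s.mem 2) : ℝ) ≤
      _ * (DirectedOLA.orderCost n (DirectedOLA.entries n (G.inputState.mem 1)) p : ℝ)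
    set cost := DirectedOLA.orderCost n (DirectedOLA.entries n (G.inputState.mem 1)) p
    have h1' : (((n - 1 : ℕ) : ℝ) - 3 * k) * best ≤ cost := by
      have h3 : 3 * k ≤ n - 1 := (Nat.mul_le_mul_right _ hq3).trans (Nat.mul_div_le _ _)
      have h4 : ((n - 1 - 3 * k : ℕ) : ℝ) = ((n - 1 : ℕ) : ℝ) - 3 * k := by
        rw [Nat.cast_sub h3]; push_cast; ring
      rw [← h4]
      exact_mod_cast h1
    have h2' : (DirectedOLA.orderCost n (DirectedOLA.entries n (G.inputState.mem 1)) (s.mem 2) : ℝ) ≤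
        cost + (n - 1 : ℕ) * best := by exact_mod_cast h2
    have h3k : 3 * (k : ℝ) ≤ α * (n - 1 : ℕ) := by
      have := mul_le_mul_of_nonneg_left hk₁ hα₀.le
      have hk0 : (0 : ℝ) ≤ k := Nat.cast_nonneg k
      nlinarith
    have h1α : 0 < 1 - α := by linarith
    -- Here (1 - α)(n - 1) · best ≤ (n - 1 - 3k) · best ≤ cost, by `h3k` and `h1'`.
    have hfin : ((n - 1 : ℕ) : ℝ) * best ≤ 1 / (1 - α) * cost := by
      rw [div_mul_eq_mul_div, one_mul, le_div_iff₀ h1α]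
      have hb0 : (0 : ℝ) ≤ best := Nat.cast_nonneg best
      nlinarith
    calc _ ≤ _ := h2'
      _ ≤ _ := by rw [add_mul, one_mul]; linarith
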